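/- Let $K\subset\mathbb{R}^2$ be a polygon, i.e. the bounded domain enclosed by a simple closed polygonal curve with vertices $\mathsf v_1,\dots,\mathsf v_N$, $N\ge 3$ ($K$ need not be convex and consecutive edges may be aligned). Let $-1<\nu<1$ and let $\ell\ge 2$ be an integer. Denote by $\mathbb{P}^k(K)$ and $\mathbb{P}^k(e)$ the polynomials of degree at most $k$ on $K$ and on an edge $e$ of $\partial K$ (they are $\{0\}$ if $k<0$), and by $n$ and $t$ the outward unit normal and the unit tangent on $e$. For $v\in H^2(K)$ let $$M_{nn}(v)=\nu\,\Delta v+(1-\nu)\,v_{,nn},\qquad T(v)=\partial_n(\Delta v)+(1-\nu)\,v_{,ntt}$$ on each edge, where, for $v\in H^2(K)$ with $\Delta^2 v\in L^2(K)$, these are the distributions on the open edge $e$ determined by Green's formula $$\int_K\big(\nu\,\Delta v\,\Delta\varphi+(1-\nu)\,v_{,ij}\varphi_{,ij}\big)dx=\int_K\Delta^2v\,\varphi\,dx+\int_e M_{nn}(v)\,\partial_n\varphi\,ds-\int_e T(v)\,\varphi\,ds$$ for all $\varphi\in C_c^\infty(\mathbb{R}^2)$ vanishing near the other edges. The local virtual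 element space is $$V_{h,\ell}^K=\big\{v\in H^2(K):\ \Delta^2 v\in\mathbb{P}^{\ell-4}(K),\ M_{nn}(v)_{|e}\in\mathbb{P}^{\ell-2}(e),\ T(v)_{|e}\in\mathbb{P}^{\ell-3}(e)\ \text{ for every edge } e\text{ of }\partial K\big\}.$$ Then the following degrees of freedom are unisolvent for $V_{h,\ell}^K$: (D1) the values $v(\mathsf v_i)$ at all vertices $\mathsf v_i$ of $K$; (D2) the moments $\int_e\partial_n v\,q\,ds$ for $q\in\mathbb{P}^{\ell-2}(e)$ and every edge $e$ of $\partial K$; (D3) the moments $\frac1{|e|}\int_e v\,q\,ds$ for $q\in\mathbb{P}^{\ell-3}(e)$ and every edge $e$ of $\partial K$; (D4) the moments $\frac1{|K|}\int_K v\,q\,dx$ for $q\in\mathbb{P}^{\ell-4}(K)$. That is, these quantities are well defined for each $v\in V_{h,\ell}^K$, and the linear map that sends $v$ to the collection of its vertex values and of the linear functionals on $\mathbb{P}^{\ell-2}(e)$, $\mathbb{P}^{\ell-3}(e)$ (for all $e$) and $\mathbb{P}^{\ell-4}(K)$ given by its moments is a bijection from $V_{h,\ell}^K$ onto $$\mathbb{R}^N\times\prod_e\mathbb{P}^{\ell-2}(e)^*\times\prod_e\mathbb{P}^{\ell-3}(e)^*\times\mathbb{P}^{\ell-4}(K)^*.$$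 -/

import Mathlib

open MeasureTheory Filter Topology
open scoped ContDiff

/-- The Euclidean plane. -/
abbrev Plane : Type := EuclideanSpace ℝ (Fin 2)

/-- The partial derivative of `φ` in the `i`-th coordinate direction. -/
noncomputable def pd (i : Fin 2) (φ : Plane → ℝ) (x : Plane) : ℝ :=
  fderiv ℝ φ x (EuclideanSpace.single i 1)

/-- The Laplacian of a smooth function. -/
noncomputable def lap (φ : Plane → ℝ) (x : Plane) : ℝ := ∑ i, pd i (pd i φ) x

/-- Smooth compactly supported functions on the plane. -/
structure IsTest (φ : Plane → ℝ) : Prop where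
  smooth : ContDiff ℝ ∞ φ
  compact : HasCompactSupport φ

/-- A polygon `K` with `n` vertices, listed counterclockwise: `carrier` is the bounded domain
enclosed by the simple closed polygonal curve through the vertices.  Consecutive edges may be
aligned (an angle equal to `π` is allowed), and `K` need not be convex. -/
structure PlanePolygon (n : ℕ) where
  three_le : 3 ≤ n
  vertex : ZMod n → Plane
  vertex_injective : Function.Injective vertex
  /-- consecutive edges meet only in their common vertex -/
  adjacent : ∀ i, segment ℝ (vertex i) (vertex (i + 1)) ∩
    segment ℝ (vertex (i + 1)) (vertex (i + 1 + 1)) = {vertex (i + 1)}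
  /-- edges that are not consecutive do not meet -/
  nonadjacent : ∀ i j, j ≠ i → j ≠ i + 1 → i ≠ j + 1 →
    Disjoint (segment ℝ (vertex i) (vertex (i + 1))) (segment ℝ (vertex j) (vertex (j + 1)))
  /-- the open set `K` -/
  carrier : Set Plane
  isOpen : IsOpen carrier
  isConnected : IsConnected carrier
  isBounded : Bornology.IsBounded carrier
  frontier_eq : frontier carrier = ⋃ i, segment ℝ (vertex i) (vertex (i + 1))
  /-- counterclockwise orientation: `K` lies to the left of each of its directed edges -/
  left_mem : ∀ i, ∀ x ∈ openSegment ℝ (vertex i) (vertex (i + 1)), ∀ᶠ s in 𝓝[>] (0 : ℝ),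
    x + s • !₂[-(vertex (i + 1) 1 - vertex i 1), vertex (i + 1) 0 - vertex i 0] ∈ carrier

namespace PlanePolygon

variable {n : ℕ} (P : PlanePolygon n)

/-- Lebesgue measure on `K`. -/
noncomputable abbrev vol : Measure Plane := volume.restrict P.carrier

/-- The closed edge joining the vertices `i` and `i + 1`. -/
def edge (i : ZMod n) : Set Plane := segment ℝ (P.vertex i) (P.vertex (i + 1))

/-- The length `|e|` of an edge. -/
noncomputable def edgeLength (i : ZMod n) : ℝ := dist (P.vertex i) (P.vertex (i + 1))

/-- The affine parametrization of an edge by `[0, 1]`. -/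
noncomputable def edgePt (i : ZMod n) (s : ℝ) : Plane :=
  AffineMap.lineMap (P.vertex i) (P.vertex (i + 1)) s

/-- The outward unit normal on an edge: the unit tangent turned clockwise. -/
noncomputable def normal (i : ZMod n) : Plane :=
  (P.edgeLength i)⁻¹ •
    !₂[P.vertex (i + 1) 1 - P.vertex i 1, -(P.vertex (i + 1) 0 - P.vertex i 0)]

/-- The integral `∫_e f ds` of a function given in the affine parameter of the edge. -/
noncomputable def edgeIntegral (i : ZMod n) (f : ℝ → ℝ) : ℝ :=
  P.edgeLength i * ∫ s in (0 : ℝ)..1, f s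

/-- The normal derivative `∂_n φ` on an edge of a smooth function `φ`, in the affine parameter. -/
noncomputable def normalDeriv (i : ZMod n) (φ : Plane → ℝ) (s : ℝ) : ℝ :=
  ∑ j, pd j φ (P.edgePt i s) * P.normal i j

end PlanePolygon

/-- The polynomials in two variables of total degree at most `k`; zero if `k < 0`. -/
noncomputable abbrev cellPoly (k : ℤ) : Submodule ℝ (MvPolynomial (Fin 2) ℝ) :=
  MvPolynomial.restrictSupport ℝ {m | (m.degree : ℤ) ≤ k}

/-- The polynomials of degree at most `k` in the affine parameter of an edge; zero if `k < 0`. -/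
noncomputable abbrev edgePoly (k : ℤ) : Submodule ℝ (Polynomial ℝ) :=
  Polynomial.degreeLT ℝ (k + 1).toNat

/-- A polynomial in two variables as a function on the plane. -/
noncomputable def polyFun (p : MvPolynomial (Fin 2) ℝ) (x : Plane) : ℝ :=
  MvPolynomial.eval (fun i => x i) p

namespace PlanePolygon

variable {n : ℕ} (P : PlanePolygon n)

/-- `L²(K)`. -/
abbrev L2 : Type := Lp ℝ 2 P.vol

/-- `w` is the weak derivative of `u` in `K` in the `i`-th coordinate direction. -/
def HasWeakDeriv (i : Fin 2) (u w : P.L2) : Prop :=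
  ∀ φ : Plane → ℝ, IsTest φ → tsupport φ ⊆ P.carrier →
    ∫ x, u x * pd i φ x ∂P.vol = -∫ x, w x * φ x ∂P.vol

/-- `u` belongs to `H²(K)`, with weak gradient `G` and weak Hessian `H`. -/
structure HasWeakHessian (u : P.L2) (G : Fin 2 → P.L2) (H : Fin 2 → Fin 2 → P.L2) : Prop where
  grad : ∀ i, P.HasWeakDeriv i u (G i)
  hess : ∀ i j, P.HasWeakDeriv j (G i) (H i j)

/-- `∫_K (ν Δu Δφ + (1 - ν) u_{,ij} φ_{,ij}) dx`, the plate bending form with unit rigidity,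
where `H` is the weak Hessian of `u` and `φ` is smooth. -/
noncomputable def plateForm (ν : ℝ) (H : Fin 2 → Fin 2 → P.L2) (φ : Plane → ℝ) : ℝ :=
  ∫ x, (ν * ((∑ i, H i i x) * lap φ x) +
    (1 - ν) * ∑ i, ∑ j, H i j x * pd j (pd i φ) x) ∂P.vol

/-- `Δ²u = p` in `K` in the sense of distributions. -/
def HasBilaplacian (u : P.L2) (p : MvPolynomial (Fin 2) ℝ) : Prop :=
  ∀ φ : Plane → ℝ, IsTest φ → tsupport φ ⊆ P.carrier →
    ∫ x, u x * lap (lap φ) x ∂P.vol = ∫ x, polyFun p x * φ x ∂P.vol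

/-- For `u ∈ H²(K)` with weak Hessian `H` and `Δ²u = p`: the bending moment
`M_nn(u) = ν Δu + (1 - ν) u_{,nn}` and the effective shear force
`T(u) = ∂_n(Δu) + (1 - ν) u_{,ntt}` on the (relatively open) edge `i` are `g` and `h`.
As usual for functions that are only in `H²`, these traces are the distributions on the edge that
are defined by Green's formula, tested with the smooth functions that vanish near all other edges
(and in particular near the vertices). -/
def HasNaturalTraces (ν : ℝ) (H : Fin 2 → Fin 2 → P.L2) (p : MvPolynomial (Fin 2) ℝ)
    (i : ZMod n) (g h : Polynomial ℝ) : Prop :=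
  ∀ φ : Plane → ℝ, IsTest φ → (∀ j, j ≠ i → Disjoint (tsupport φ) (P.edge j)) →
    P.plateForm ν H φ = ∫ x, polyFun p x * φ x ∂P.vol
      + P.edgeIntegral i (fun s => g.eval s * P.normalDeriv i φ s)
      - P.edgeIntegral i (fun s => h.eval s * φ (P.edgePt i s))

/-- Membership in the local virtual element space: `u ∈ H²(K)`, `Δ²u ∈ ℙ^{ℓ-4}(K)`, and
`M_nn(u) ∈ ℙ^{ℓ-2}(e)`, `T(u) ∈ ℙ^{ℓ-3}(e)` on every edge `e`. -/
def IsLocalVE (ν : ℝ) (ℓ : ℕ) (u : P.L2) : Prop :=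
  ∃ (G : Fin 2 → P.L2) (H : Fin 2 → Fin 2 → P.L2), P.HasWeakHessian u G H ∧
    ∃ p ∈ cellPoly ((ℓ : ℤ) - 4), P.HasBilaplacian u p ∧
      ∀ i, ∃ g ∈ edgePoly ((ℓ : ℤ) - 2), ∃ h ∈ edgePoly ((ℓ : ℤ) - 3),
        P.HasNaturalTraces ν H p i g h

/-- `g`, a function of the affine parameter, is the trace on the edge `i` of `w ∈ H¹(K)`, where `dw`
is the weak gradient of `w`: the trace operator is the continuous extension to `H¹(K)` of
the restriction to the edge of functions that are smooth up to the boundary. -/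
def HasEdgeTrace (i : ZMod n) (w : P.L2) (dw : Fin 2 → P.L2) (g : ℝ → ℝ) : Prop :=
  MemLp g 2 (volume.restrict (Set.Ioc 0 1)) ∧
  ∃ φ : ℕ → Plane → ℝ, (∀ k, ContDiff ℝ ∞ (φ k)) ∧
    Tendsto (fun k => eLpNorm (fun x => φ k x - w x) 2 P.vol) atTop (𝓝 0) ∧
    (∀ j, Tendsto (fun k => eLpNorm (fun x => pd j (φ k) x - dw j x) 2 P.vol) atTop (𝓝 0)) ∧
    Tendsto (fun k => eLpNorm (fun s => φ k (P.edgePt i s) - g s) 2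
      (volume.restrict (Set.Ioc 0 1))) atTop (𝓝 0)

/-- Values of the degrees of freedom: one number for each vertex, and, for the moments, linear
functionals on `ℙ^{ℓ-2}(e)` and on `ℙ^{ℓ-3}(e)` for each edge `e`, and on `ℙ^{ℓ-4}(K)`. -/
abbrev DofData (n ℓ : ℕ) : Type :=
  (ZMod n → ℝ) × (ZMod n → Module.Dual ℝ (edgePoly ((ℓ : ℤ) - 2))) ×
    (ZMod n → Module.Dual ℝ (edgePoly ((ℓ : ℤ) - 3))) × Module.Dual ℝ (cellPoly ((ℓ : ℤ) - 4))

/-- `d` consists of the degrees of freedom of `u ∈ H²(K)`: the vertex values, the moments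
`∫_e ∂_n u q ds`, the moments `|e|⁻¹ ∫_e u q ds`, and the moments `|K|⁻¹ ∫_K u q dx`.  Here `f` is
the representative of `u` that is continuous up to the boundary, and `τ i j` is the trace of
the `j`-th partial derivative of `u` on the edge `i`. -/
def HasDofs (ℓ : ℕ) (u : P.L2) (d : DofData n ℓ) : Prop :=
  ∃ (G : Fin 2 → P.L2) (H : Fin 2 → Fin 2 → P.L2) (f : Plane → ℝ)
    (τ : ZMod n → Fin 2 → ℝ → ℝ),
    P.HasWeakHessian u G H ∧ ContinuousOn f (closure P.carrier) ∧ u =ᵐ[P.vol] f ∧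
    (∀ i j, P.HasEdgeTrace i (G j) (H j) (τ i j)) ∧
    (∀ i, d.1 i = f (P.vertex i)) ∧
    (∀ i q, d.2.1 i q =
      P.edgeIntegral i (fun s => (∑ j, τ i j s * P.normal i j) * q.1.eval s)) ∧
    (∀ i q, d.2.2.1 i q =
      (P.edgeLength i)⁻¹ * P.edgeIntegral i (fun s => f (P.edgePt i s) * q.1.eval s)) ∧
    (∀ q, d.2.2.2 q = (volume.real P.carrier)⁻¹ * ∫ x, u x * polyFun q.1 x ∂P.vol)

end PlanePolygon

theorem IsTest.pd {φ : Plane → ℝ} (h : IsTest φ) (i : Fin 2) : IsTest (pd i φ) where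
  smooth := by
    unfold _root_.pd
    exact (h.smooth.fderiv_right (m := ∞) (by simp)).clm_apply contDiff_const
  compact := h.compact.fderiv_apply ℝ _

theorem IsTest.lap {φ : Plane → ℝ} (h : IsTest φ) : IsTest (lap φ) := by
  have e : _root_.lap φ = _root_.pd 0 (_root_.pd 0 φ) + _root_.pd 1 (_root_.pd 1 φ) := by
    ext x; simp [_root_.lap, Fin.sum_univ_two]
  rw [e]
  exact ⟨((h.pd 0).pd 0).smooth.add ((h.pd 1).pd 1).smooth,
    ((h.pd 0).pd 0).compact.add ((h.pd 1).pd 1).compact⟩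

theorem continuous_polyFun (p : MvPolynomial (Fin 2) ℝ) : Continuous (polyFun p) := by
  unfold polyFun
  exact (MvPolynomial.continuous_eval p).comp (continuous_pi fun i => by fun_prop)

theorem polyFun_add_smul (c : ℝ) (p q : MvPolynomial (Fin 2) ℝ) (x : Plane) :
    polyFun (p + c • q) x = polyFun p x + c * polyFun q x := by
  simp [polyFun, MvPolynomial.smul_eval]

namespace PlanePolygon

variable {n : ℕ} (P : PlanePolygon n)

theorem integrable_mul (u : P.L2) {φ : Plane → ℝ} (h : IsTest φ) :
    Integrable (fun x => u x * φ x) P.vol :=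
  MemLp.integrable_mul (p := 2) (q := 2) (Lp.memLp u)
    ((h.smooth.continuous.memLp_of_hasCompactSupport h.compact).restrict _)

theorem integrable_poly (p : MvPolynomial (Fin 2) ℝ) {φ : Plane → ℝ} (h : IsTest φ) :
    Integrable (fun x => polyFun p x * φ x) P.vol :=
  (((continuous_polyFun p).mul h.smooth.continuous).integrable_of_hasCompactSupport
    h.compact.mul_left).restrict

theorem coe_add_smul (c : ℝ) (u v : P.L2) :
    ∀ᵐ x ∂P.vol, (u + c • v : P.L2) x = u x + c * v x := by
  filter_upwards [Lp.coeFn_add u (c • v), Lp.coeFn_smul c v] with x h1 h2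
  rw [h1, Pi.add_apply, h2, Pi.smul_apply, smul_eq_mul]

theorem pairing_add_smul (c : ℝ) (u v : P.L2) {φ : Plane → ℝ} (h : IsTest φ) :
    ∫ x, (u + c • v : P.L2) x * φ x ∂P.vol =
      ∫ x, u x * φ x ∂P.vol + c * ∫ x, v x * φ x ∂P.vol := by
  rw [← integral_const_mul, ← integral_add (P.integrable_mul u h)
    ((P.integrable_mul v h).const_mul c)]
  refine integral_congr_ae ?_
  filter_upwards [P.coe_add_smul c u v] with x hx
  rw [hx]; ring

theorem poly_add_smul (c : ℝ) (p q : MvPolynomial (Fin 2) ℝ) {φ : Plane → ℝ} (h : IsTest φ) :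
    ∫ x, polyFun (p + c • q) x * φ x ∂P.vol =
      ∫ x, polyFun p x * φ x ∂P.vol + c * ∫ x, polyFun q x * φ x ∂P.vol := by
  rw [← integral_const_mul, ← integral_add (P.integrable_poly p h)
    ((P.integrable_poly q h).const_mul c)]
  congr 1; ext x; rw [polyFun_add_smul]; ring

theorem plateForm_eq (ν : ℝ) (H : Fin 2 → Fin 2 → P.L2) {φ : Plane → ℝ} (h : IsTest φ) :
    P.plateForm ν H φ = ν * (∑ i, ∫ x, H i i x * lap φ x ∂P.vol) +
      (1 - ν) * ∑ i, ∑ j, ∫ x, H i j x * pd j (pd i φ) x ∂P.vol := by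
  have h1 : ∀ i, Integrable (fun x => H i i x * lap φ x) P.vol :=
    fun i => P.integrable_mul _ h.lap
  have h2 : ∀ i j, Integrable (fun x => H i j x * pd j (pd i φ) x) P.vol :=
    fun i j => P.integrable_mul _ ((h.pd i).pd j)
  unfold plateForm
  simp only [Finset.sum_mul]
  rw [integral_add ((integrable_finsetSum _ fun i _ => h1 i).const_mul _)
    ((integrable_finsetSum _ fun i _ => integrable_finsetSum _ fun j _ => h2 i j).const_mul _),
    integral_const_mul, integral_const_mul, integral_finsetSum _ (fun i _ => h1 i),
    integral_finsetSum _ (fun i _ => integrable_finsetSum _ fun j _ => h2 i j)]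
  congr 2
  exact Finset.sum_congr rfl fun i _ => integral_finsetSum _ fun j _ => h2 i j

theorem edgeIntegral_add_smul (i : ZMod n) (c : ℝ) (p q : Polynomial ℝ) {f : ℝ → ℝ}
    (hf : Continuous f) :
    P.edgeIntegral i (fun s => (p + c • q).eval s * f s) =
      P.edgeIntegral i (fun s => p.eval s * f s) +
        c * P.edgeIntegral i (fun s => q.eval s * f s) := by
  unfold edgeIntegral
  have e : (fun s => (p + c • q).eval s * f s) =
      fun s => p.eval s * f s + c * (q.eval s * f s) := by
    ext s; simp; ring
  rw [e, intervalIntegral.integral_add (Continuous.intervalIntegrable (by fun_prop) _ _)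
    (Continuous.intervalIntegrable (by fun_prop) _ _), intervalIntegral.integral_const_mul]
  ring

theorem continuous_edgePt (i : ZMod n) : Continuous (P.edgePt i) := by
  unfold edgePt
  exact AffineMap.lineMap_continuous

theorem continuous_normalDeriv (i : ZMod n) {φ : Plane → ℝ} (h : IsTest φ) :
    Continuous (P.normalDeriv i φ) := by
  unfold normalDeriv
  exact continuous_finsetSum _ fun j _ =>
    (((h.pd j).smooth.continuous.comp (P.continuous_edgePt i)).mul continuous_const)

theorem isLocalVE_add_smul (ν : ℝ) (ℓ : ℕ) (c : ℝ) {u v : P.L2} (hu : P.IsLocalVE ν ℓ u)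
    (hv : P.IsLocalVE ν ℓ v) : P.IsLocalVE ν ℓ (u + c • v) := by
  obtain ⟨G, H, hGH, p, hp, hbp, ht⟩ := hu
  obtain ⟨G', H', hGH', p', hp', hbp', ht'⟩ := hv
  refine ⟨fun i => G i + c • G' i, fun i j => H i j + c • H' i j, ⟨?_, ?_⟩, p + c • p',
    Submodule.add_mem _ hp (Submodule.smul_mem _ _ hp'), ?_, ?_⟩
  · intro i φ h1 h2
    rw [P.pairing_add_smul c _ _ (h1.pd i), P.pairing_add_smul c _ _ h1,
      hGH.grad i φ h1 h2, hGH'.grad i φ h1 h2]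
    ring
  · intro i j φ h1 h2
    rw [P.pairing_add_smul c _ _ (h1.pd j), P.pairing_add_smul c _ _ h1,
      hGH.hess i j φ h1 h2, hGH'.hess i j φ h1 h2]
    ring
  · intro φ h1 h2
    rw [P.pairing_add_smul c _ _ h1.lap.lap, P.poly_add_smul c _ _ h1, hbp φ h1 h2,
      hbp' φ h1 h2]
  · intro i
    obtain ⟨g, hg, h, hh, hgh⟩ := ht i
    obtain ⟨g', hg', h', hh', hgh'⟩ := ht' i
    refine ⟨g + c • g', Submodule.add_mem _ hg (Submodule.smul_mem _ _ hg'), h + c • h',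
      Submodule.add_mem _ hh (Submodule.smul_mem _ _ hh'), ?_⟩
    intro φ h1 h2
    have e : P.plateForm ν (fun i j => H i j + c • H' i j) φ =
        P.plateForm ν H φ + c * P.plateForm ν H' φ := by
      rw [P.plateForm_eq ν _ h1, P.plateForm_eq ν _ h1, P.plateForm_eq ν _ h1]
      simp only [Fin.sum_univ_two]
      simp only [P.pairing_add_smul c _ _ h1.lap, P.pairing_add_smul c _ _ ((h1.pd _).pd _)]
      ring
    rw [e, hgh φ h1 h2, hgh' φ h1 h2, P.poly_add_smul c _ _ h1,
      P.edgeIntegral_add_smul i c _ _ (P.continuous_normalDeriv i h1),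
      P.edgeIntegral_add_smul i c _ _ (f := fun s => φ (P.edgePt i s))
        (h1.smooth.continuous.comp (P.continuous_edgePt i))]
    ring

theorem pairing_zero (φ : Plane → ℝ) : ∫ x, (0 : P.L2) x * φ x ∂P.vol = 0 := by
  rw [integral_eq_zero_of_ae]
  filter_upwards [Lp.coeFn_zero ℝ 2 P.vol] with x hx
  rw [hx, Pi.zero_apply, zero_mul]

theorem isLocalVE_zero (ν : ℝ) (ℓ : ℕ) : P.IsLocalVE ν ℓ 0 := by
  refine ⟨fun _ => 0, fun _ _ => 0, ⟨?_, ?_⟩, 0, Submodule.zero_mem _, ?_, fun i =>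
    ⟨0, Submodule.zero_mem _, 0, Submodule.zero_mem _, ?_⟩⟩
  · intro i φ _ _; rw [pairing_zero, pairing_zero, neg_zero]
  · intro i j φ _ _; rw [pairing_zero, pairing_zero, neg_zero]
  · intro φ _ _; rw [pairing_zero]; simp [polyFun]
  · intro φ h1 _
    rw [P.plateForm_eq ν _ h1]
    simp only [pairing_zero]
    simp [ polyFun, edgeIntegral]

/-- The local virtual element space `V_{h,ℓ}^K` of order `ℓ`, as a subspace of `L²(K)`. -/
def localVE (ν : ℝ) (ℓ : ℕ) : Submodule ℝ P.L2 where
  carrier := {u | P.IsLocalVE ν ℓ u}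
  zero_mem' := P.isLocalVE_zero ν ℓ
  add_mem' := by
    intro u v hu hv
    simpa using P.isLocalVE_add_smul ν ℓ 1 hu hv
  smul_mem' := by
    intro c u hu
    simpa using P.isLocalVE_add_smul ν ℓ c (P.isLocalVE_zero ν ℓ) hu

end PlanePolygon

/-!
A member of the virtual element space is the weak solution of a plate problem: the bending form
`a(u, w) = ∫_K (ν Δu Δw + (1 - ν) u_{,ij} w_{,ij})` represents a functional of the degrees of freedom
of `w`. Unisolvence says that this problem, with the degrees of freedom of `u` as data, has exactly
one solution.

*The space.* `PlanePolygon.sobolev` is the closure, in the product of seven copies of `L²(K)`, of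
the jets of smooth functions. All analysis rests on one geometric fact,
`PlanePolygon.exists_translation`: near each point of its closure, `K` is invariant under short
translations along the positive combinations of two independent vectors. Integrating along these
directions gives the Sobolev and trace inequalities (`exists_sobolev`, `exists_trace`), and, together
with connectedness of `K`, the Poincaré inequality (`exists_poincare`). Mollifying with a kernel
supported in the opposite cone shows that smooth functions are dense in `H²(K)`
(`mem_sobolev_of_weakJet`). Hence the degrees of freedom extend to a continuous linear map
`PlanePolygon.dofs` on `H²(K)`.

*Existence.* The map `dofs` is onto (`dofs_surjective`). An affine function that vanishes at all
vertices is zero (`eq_zero_of_affineFn_vertex`), so by the Poincaré inequality the bending form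
is coercive on the kernel of `dofs` (`exists_mul_norm_sq_le_energy`). The function with the smallest
bending energy among those with given degrees of freedom satisfies `a(u, w) = 0` for all `w` in that
kernel, that is, `a(u, w)` is a functional of the degrees of freedom of `w`; this makes `u` a member
of the virtual element space (`exists_isLocalVE_dofs_eq`).

*Uniqueness.* For a member `u` of the virtual element space, let `L(w)` be the difference of the two
sides of Green's formula, with the contributions of all edges. It is a continuous functional on
`H²(K)` that vanishes on the test functions that meet at most one edge, hence on those supported
away from the vertices. The plane case of the Sobolev embedding is borderline for point values of
the gradient: a smooth function that vanishes at a vertex, when cut off near that vertex at scale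
`ε`, stays bounded in `H²(K)` while its support shrinks, so its image under `L` tends to zero
(`tendsto_apply_mul_zoom`). Therefore `L` is a combination of vertex values
(`apply_eq_zero_of_vertexValue_eq_zero`). If the degrees of freedom of `u` vanish, this gives
`a(u, u) = 0`, and `u = 0` by coercivity (`eq_zero_of_isLocalVE`).
-/

open scoped ENNReal NNReal

/-! ### The geometry of a polygon near its boundary -/

/-- The determinant of two plane vectors. -/
def cross (a b : Plane) : ℝ := a 0 * b 1 - a 1 * b 0

theorem cross_add_left (a b c : Plane) : cross (a + b) c = cross a c + cross b c := by
  simp [cross]; ring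

theorem cross_add_right (a b c : Plane) : cross a (b + c) = cross a b + cross a c := by
  simp [cross]; ring

theorem cross_smul_left (r : ℝ) (a b : Plane) : cross (r • a) b = r * cross a b := by
  simp [cross]; ring

theorem cross_smul_right (r : ℝ) (a b : Plane) : cross a (r • b) = r * cross a b := by
  simp [cross]; ring

theorem cross_same (a : Plane) : cross a a = 0 := by
  simp [cross]; ring

theorem cross_swap (a b : Plane) : cross b a = -cross a b := by
  simp [cross]; ring

theorem cross_neg_left (a b : Plane) : cross (-a) b = -cross a b := by
  simp [cross]; ring

theorem cross_neg_right (a b : Plane) : cross a (-b) = -cross a b := by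
  simp [cross]; ring

theorem cross_zero_right (a : Plane) : cross a 0 = 0 := by simp [cross]

theorem cross_zero_left (a : Plane) : cross 0 a = 0 := by simp [cross]

theorem continuous_cross_left (b : Plane) : Continuous fun a => cross a b := by
  unfold cross; fun_prop

/-- Rotation of a plane vector by a right angle, counterclockwise. -/
noncomputable def rot (a : Plane) : Plane := !₂[-(a 1), a 0]

theorem cross_rot_pos {a : Plane} (ha : a ≠ 0) : 0 < cross a (rot a) := by
  have : a 0 ≠ 0 ∨ a 1 ≠ 0 := by
    by_contra! h
    apply ha
    ext i
    fin_cases i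
    · simpa using h.1
    · simpa using h.2
  have e : cross a (rot a) = a 0 ^ 2 + a 1 ^ 2 := by simp [cross, rot]; ring
  rw [e]
  rcases this with h | h <;> positivity

/-- Cramer's rule. -/
theorem cross_smul_eq (a b x : Plane) : cross a b • x = cross x b • a + cross a x • b := by
  ext i
  fin_cases i <;> simp [cross] <;> ring

theorem exists_eq_smul_of_cross_eq_zero {a b : Plane} (ha : a ≠ 0) (h : cross a b = 0) :
    ∃ t : ℝ, b = t • a := by
  have hp := cross_rot_pos ha
  have := cross_smul_eq a (rot a) b
  rw [h, zero_smul, add_zero] at this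
  refine ⟨(cross a (rot a))⁻¹ * cross b (rot a), ?_⟩
  rw [mul_smul, ← this, smul_smul, inv_mul_cancel₀ hp.ne', one_smul]

/-- The closed ray from the origin through `a`. -/
def ray (a : Plane) : Set Plane := {x | ∃ t : ℝ, 0 ≤ t ∧ x = t • a}

/-- Two nonzero vectors that do not span the same ray. -/
structure RayPair (a b : Plane) : Prop where
  left : a ≠ 0
  right : b ≠ 0
  opposite : cross a b = 0 → ∃ t : ℝ, 0 < t ∧ b = -(t • a)

theorem RayPair.symm {a b : Plane} (h : RayPair a b) : RayPair b a := by
  refine ⟨h.right, h.left, fun h0 => ?_⟩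
  obtain ⟨t, ht, rfl⟩ := h.opposite (by rw [cross_swap, h0, neg_zero])
  refine ⟨t⁻¹, inv_pos.2 ht, ?_⟩
  rw [smul_neg, smul_smul, inv_mul_cancel₀ ht.ne', one_smul, neg_neg]

/-- The open sector swept counterclockwise from the ray through `a` to the ray through `b`. -/
def sector (a b : Plane) : Set Plane :=
  {x | if 0 ≤ cross a b then 0 < cross a x ∧ 0 < cross x b else 0 < cross a x ∨ 0 < cross x b}

theorem mem_sector_of_nonneg {a b x : Plane} (h : 0 ≤ cross a b) :
    x ∈ sector a b ↔ 0 < cross a x ∧ 0 < cross x b := by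
  simp [sector, h]

theorem mem_sector_of_neg {a b x : Plane} (h : cross a b < 0) :
    x ∈ sector a b ↔ 0 < cross a x ∨ 0 < cross x b := by
  simp [sector, not_le.2 h]

/-- The two sectors between two rays cover everything but the rays. -/
theorem RayPair.mem_or_mem_sector {a b x : Plane} (h : RayPair a b) (ha : x ∉ ray a)
    (hb : x ∉ ray b) : x ∈ sector a b ∨ x ∈ sector b a := by
  have key : ∀ a b : Plane, RayPair a b → 0 < cross a b → x ∉ ray a → x ∉ ray b →
      x ∈ sector a b ∨ x ∈ sector b a := by
    intro a b h hc ha hb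
    rw [mem_sector_of_nonneg hc.le, mem_sector_of_neg (by rw [cross_swap]; linarith),
      cross_swap x b, cross_swap a x]
    by_contra! hx
    have e := cross_smul_eq a b x
    have e' : x = (cross x b / cross a b) • a + (cross a x / cross a b) • b := by
      rw [div_eq_inv_mul, div_eq_inv_mul, mul_smul, mul_smul, ← smul_add, ← e, smul_smul,
        inv_mul_cancel₀ hc.ne', one_smul]
    rcases lt_or_ge 0 (cross a x) with h1 | h1
    · have h0 : cross x b = 0 := le_antisymm (hx.1 h1) (by linarith [hx.2.1])
      refine hb ⟨cross a x / cross a b, by positivity, ?_⟩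
      conv_lhs => rw [e']
      rw [h0]; simp
    · have h0 : cross a x = 0 := le_antisymm h1 (by linarith [hx.2.2])
      refine ha ⟨cross x b / cross a b, div_nonneg (by linarith [hx.2.1]) hc.le, ?_⟩
      conv_lhs => rw [e']
      rw [h0]; simp
  rcases lt_trichotomy (cross a b) 0 with hc | hc | hc
  · exact (key b a h.symm (by rw [cross_swap]; linarith) hb ha).symm
  · obtain ⟨t, ht, rfl⟩ := h.opposite hc
    rw [mem_sector_of_nonneg hc.ge, mem_sector_of_nonneg (by rw [cross_swap, hc, neg_zero]),
      cross_neg_right, cross_neg_left, cross_smul_left, cross_smul_right, cross_swap a x]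
    rcases lt_trichotomy (cross a x) 0 with h1 | h1 | h1
    · right; constructor <;> nlinarith
    · exfalso
      obtain ⟨s, rfl⟩ := exists_eq_smul_of_cross_eq_zero h.left h1
      rcases le_total 0 s with hs | hs
      · exact ha ⟨s, hs, rfl⟩
      · refine hb ⟨-s / t, div_nonneg (by linarith) ht.le, ?_⟩
        rw [smul_neg, smul_smul, div_mul_cancel₀ _ ht.ne', neg_smul, neg_neg]
    · left; constructor <;> nlinarith
  · exact key a b h hc ha hb

/-- For opposite rays both conditions that define the sector single out the same half-plane. -/
theorem RayPair.cross_right_pos_iff {a b : Plane} (h : RayPair a b) (hc : cross a b = 0)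
    (x : Plane) : 0 < cross x b ↔ 0 < cross a x := by
  obtain ⟨t, ht, rfl⟩ := h.opposite hc
  rw [cross_neg_right, cross_smul_right, cross_swap a x]
  constructor <;> intro h <;> nlinarith

theorem not_mem_sector_left {a b x : Plane} (hx : x ∈ ray a) :
    x ∉ sector a b := by
  obtain ⟨t, ht, rfl⟩ := hx
  rcases lt_or_ge (cross a b) 0 with hc | hc
  · rw [mem_sector_of_neg hc]
    simp only [cross_smul_right, cross_smul_left, cross_same, mul_zero, lt_irrefl, false_or]
    nlinarith
  · rw [mem_sector_of_nonneg hc]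
    simp [cross_smul_right, cross_same]

theorem not_mem_sector_right {a b x : Plane} (hx : x ∈ ray b) :
    x ∉ sector a b := by
  obtain ⟨t, ht, rfl⟩ := hx
  rcases lt_or_ge (cross a b) 0 with hc | hc
  · rw [mem_sector_of_neg hc]
    simp only [cross_smul_right, cross_smul_left, cross_same, mul_zero, lt_irrefl, or_false]
    nlinarith
  · rw [mem_sector_of_nonneg hc]
    simp [cross_smul_left, cross_same]

theorem convex_cross_pos_left (a : Plane) : Convex ℝ {x | 0 < cross a x} :=
  convex_halfSpace_gt (f := cross a) ⟨cross_add_right a, fun c x => cross_smul_right c a x⟩ 0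

theorem convex_cross_pos_right (b : Plane) : Convex ℝ {x | 0 < cross x b} :=
  convex_halfSpace_gt (f := fun x => cross x b)
    ⟨fun x y => cross_add_left x y b, fun c x => cross_smul_left c x b⟩ 0

/-- A convex sector is an intersection of two half-planes; a reflex one is the union of two
half-planes that meet near the tip, at `-(a + b)`. -/
theorem isPreconnected_sector_inter_ball (a b : Plane) {ρ : ℝ} (hρ : 0 < ρ) :
    IsPreconnected (sector a b ∩ Metric.ball 0 ρ) := by
  rcases lt_or_ge (cross a b) 0 with hc | hc
  · have e : sector a b ∩ Metric.ball 0 ρ = ({x | 0 < cross a x} ∩ Metric.ball 0 ρ) ∪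
        ({x | 0 < cross x b} ∩ Metric.ball 0 ρ) := by
      ext x
      simp only [Set.mem_inter_iff, mem_sector_of_neg hc, Set.mem_union, Set.mem_ofPred_eq]
      tauto
    rw [e]
    obtain ⟨c, hc0, hc1⟩ : ∃ c : ℝ, 0 < c ∧ c * ‖a + b‖ < ρ := by
      refine ⟨ρ / (‖a + b‖ + 1), by positivity, ?_⟩
      rw [div_mul_eq_mul_div, div_lt_iff₀ (by positivity)]
      nlinarith [norm_nonneg (a + b)]
    have hm : -(c • (a + b)) ∈ Metric.ball (0 : Plane) ρ := by
      rw [mem_ball_zero_iff, norm_neg, norm_smul, Real.norm_of_nonneg hc0.le]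
      exact hc1
    refine IsPreconnected.union (-(c • (a + b))) ⟨?_, hm⟩ ⟨?_, hm⟩
      ((convex_cross_pos_left a).inter (convex_ball _ _)).isPreconnected
      ((convex_cross_pos_right b).inter (convex_ball _ _)).isPreconnected
    · simp only [Set.mem_ofPred_eq, cross_neg_right, cross_smul_right, cross_add_right, cross_same]
      nlinarith
    · simp only [Set.mem_ofPred_eq, cross_neg_left, cross_smul_left, cross_add_left, cross_same]
      nlinarith
  · have e : sector a b = {x | 0 < cross a x} ∩ {x | 0 < cross x b} := by
      ext x
      simp [mem_sector_of_nonneg hc]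
    rw [e]
    exact (((convex_cross_pos_left a).inter (convex_cross_pos_right b)).inter
      (convex_ball _ _)).isPreconnected

/-- Every sector, together with its bounding rays, is mapped into itself by the translations along
the positive combinations of two suitable independent vectors. -/
theorem RayPair.exists_add_mem_sector {a b : Plane} (h : RayPair a b) :
    ∃ c d : Plane, cross c d ≠ 0 ∧ ∀ x, x ∈ sector a b ∨ x ∈ ray a ∨ x ∈ ray b →
      ∀ α β : ℝ, 0 < α → 0 < β → x + α • c + β • d ∈ sector a b := by
  rcases lt_trichotomy (cross a b) 0 with hc | hc | hc
  · refine ⟨-a, -b, ?_, fun x hx α β hα hβ => ?_⟩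
    · rw [cross_neg_left, cross_neg_right, neg_neg]; exact hc.ne
    · have hα' := mul_pos hα (neg_pos.2 hc)
      have hβ' := mul_pos hβ (neg_pos.2 hc)
      rw [mem_sector_of_neg hc]
      rw [mem_sector_of_neg hc] at hx
      simp only [cross_add_left, cross_add_right, cross_smul_left, cross_smul_right,
        cross_neg_left, cross_neg_right, cross_same]
      rcases hx with (hx | hx) | ⟨t, ht, rfl⟩ | ⟨t, ht, rfl⟩
      · left; nlinarith
      · right; nlinarith
      · left; rw [cross_smul_right, cross_same]; nlinarith
      · right; rw [cross_smul_left, cross_same]; nlinarith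
  · have hp := cross_rot_pos h.left
    refine ⟨a, rot a, hp.ne', fun x hx α β hα hβ => ?_⟩
    have hβ' := mul_pos hβ hp
    rw [mem_sector_of_nonneg hc.ge, h.cross_right_pos_iff hc, and_self]
    rw [mem_sector_of_nonneg hc.ge, h.cross_right_pos_iff hc, and_self] at hx
    simp only [cross_add_right, cross_smul_right, cross_same]
    rcases hx with hx | ⟨t, ht, rfl⟩ | ⟨t, ht, rfl⟩
    · nlinarith
    · rw [cross_smul_right, cross_same]; nlinarith
    · rw [cross_smul_right, hc]; nlinarith
  · refine ⟨a, b, hc.ne', fun x hx α β hα hβ => ?_⟩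
    have hα' := mul_pos hα hc
    have hβ' := mul_pos hβ hc
    rw [mem_sector_of_nonneg hc.le]
    rw [mem_sector_of_nonneg hc.le] at hx
    simp only [cross_add_left, cross_add_right, cross_smul_left, cross_smul_right, cross_same]
    rcases hx with hx | ⟨t, ht, rfl⟩ | ⟨t, ht, rfl⟩
    · constructor <;> nlinarith
    · rw [cross_smul_left, cross_smul_right, cross_same]
      constructor <;> nlinarith [mul_nonneg ht hc.le]
    · rw [cross_smul_left, cross_smul_right, cross_same]
      constructor <;> nlinarith [mul_nonneg ht hc.le]

theorem mem_segment_iff_mem_ray {z a x : Plane} (hx : x ∈ Metric.ball z ‖a‖) :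
    x ∈ segment ℝ z (z + a) ↔ x - z ∈ ray a := by
  rw [segment_eq_image']
  simp only [add_sub_cancel_left, Set.mem_image, Set.mem_Icc, ray, Set.mem_ofPred_eq]
  constructor
  · rintro ⟨t, ht, rfl⟩
    exact ⟨t, ht.1, by simp⟩
  · rintro ⟨t, ht, h⟩
    refine ⟨t, ⟨ht, ?_⟩, by rw [← h]; abel⟩
    rw [Metric.mem_ball, dist_eq_norm, h, norm_smul, Real.norm_of_nonneg ht] at hx
    by_contra! h1
    nlinarith [norm_nonneg a]

/-- Near a point of the ray through `a`, the left side of the ray lies in the sector that starts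
at `a`. -/
theorem RayPair.eventually_add_rot_mem {a b d : Plane} (h : RayPair a b) {t r : ℝ} (ht : 0 < t)
    (hr : 0 < r) (hd : d = r • a) : ∀ᶠ s in 𝓝[>] (0 : ℝ), t • a + s • rot d ∈ sector a b := by
  have h0 : ∀ s : ℝ, 0 < s → 0 < cross a (t • a + s • rot d) := by
    intro s hs
    have e : cross a (rot d) = r * cross a (rot a) := by
      subst hd; simp [cross, rot]; ring
    rw [cross_add_right, cross_smul_right, cross_smul_right, cross_same, e]
    have := cross_rot_pos h.left
    positivity
  rcases lt_trichotomy (cross a b) 0 with hc | hc | hc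
  · filter_upwards [self_mem_nhdsWithin] with s hs
    exact (mem_sector_of_neg hc).2 (Or.inl (h0 s hs))
  · filter_upwards [self_mem_nhdsWithin] with s hs
    rw [mem_sector_of_nonneg hc.ge, h.cross_right_pos_iff hc, and_self]
    exact h0 s hs
  · have h1 : Tendsto (fun s : ℝ => cross (t • a + s • rot d) b) (𝓝[>] 0)
        (𝓝 (cross (t • a + (0 : ℝ) • rot d) b)) := by
      apply Tendsto.mono_left _ nhdsWithin_le_nhds
      apply Continuous.tendsto
      exact (continuous_cross_left b).comp (by fun_prop)
    rw [zero_smul, add_zero, cross_smul_left] at h1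
    filter_upwards [self_mem_nhdsWithin, h1.eventually (lt_mem_nhds (by positivity))] with s hs hs'
    exact (mem_sector_of_nonneg hc.le).2 ⟨h0 s hs, hs'⟩

namespace PlanePolygon

variable {n : ℕ} (P : PlanePolygon n)

theorem neZero (P : PlanePolygon n) : NeZero n := ⟨by have := P.three_le; omega⟩

/-- At `z` the boundary of `K` looks like the two rays through `a` and `b`, with `K` to the left
of the ray through `a`. -/
structure LocalFrame (z a b : Plane) : Prop where
  rayPair : RayPair a b
  frontier_iff : ∀ᶠ x in 𝓝 z, x ∈ frontier P.carrier ↔ x - z ∈ ray a ∨ x - z ∈ ray b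
  left_mem : ∃ d : Plane, ∃ r : ℝ, 0 < r ∧ d = r • a ∧ ∀ t : ℝ, 0 < t → t < 1 →
    ∀ᶠ s in 𝓝[>] (0 : ℝ), z + t • a + s • rot d ∈ P.carrier

theorem isClosed_edge (i : ZMod n) : IsClosed (P.edge i) := by
  unfold edge
  rw [segment_eq_image_lineMap]
  exact (isCompact_Icc.image AffineMap.lineMap_continuous).isClosed

theorem frontier_eq_iUnion_edge : frontier P.carrier = ⋃ i, P.edge i := P.frontier_eq

theorem eventually_not_mem_edge {z : Plane} (s : Set (ZMod n)) (hs : ∀ j ∈ s, z ∉ P.edge j) :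
    ∀ᶠ x in 𝓝 z, ∀ j ∈ s, x ∉ P.edge j := by
  have := P.neZero
  have hf : s.Finite := Set.toFinite s
  exact (hf.eventually_all).2 fun j hj => (P.isClosed_edge j).isOpen_compl.mem_nhds (hs j hj)

theorem vertex_ne (P : PlanePolygon n) (i : ZMod n) : P.vertex (i + 1) ≠ P.vertex i := by
  intro h
  replace h := P.vertex_injective h
  have : Fact (1 < n) := ⟨by have := P.three_le; omega⟩
  simp at h

theorem vertex_mem_edge (i : ZMod n) : P.vertex i ∈ P.edge i := left_mem_segment _ _ _

theorem vertex_add_one_mem_edge (i : ZMod n) : P.vertex (i + 1) ∈ P.edge i :=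
  right_mem_segment _ _ _

theorem eq_vertex_of_mem_edge_add_one {i : ZMod n} {x : Plane} (h : x ∈ P.edge i)
    (h' : x ∈ P.edge (i + 1)) : x = P.vertex (i + 1) := by
  have : x ∈ ({P.vertex (i + 1)} : Set Plane) := by rw [← P.adjacent i]; exact ⟨h, h'⟩
  exact this

/-- Two different edges meet at most in a vertex. -/
theorem exists_eq_vertex_of_mem_edge {i j : ZMod n} (hij : j ≠ i) {x : Plane} (h : x ∈ P.edge i)
    (h' : x ∈ P.edge j) : (j = i + 1 ∧ x = P.vertex (i + 1)) ∨
      (i = j + 1 ∧ x = P.vertex (j + 1)) := by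
  by_cases h1 : j = i + 1
  · subst h1; exact Or.inl ⟨rfl, P.eq_vertex_of_mem_edge_add_one h h'⟩
  by_cases h2 : i = j + 1
  · subst h2; exact Or.inr ⟨rfl, P.eq_vertex_of_mem_edge_add_one h' h⟩
  exact absurd h' (Set.disjoint_left.1 (P.nonadjacent i j hij h1 h2) h)

theorem vertex_mem_edge_iff {i j : ZMod n} : P.vertex (i + 1) ∈ P.edge j ↔ j = i ∨ j = i + 1 := by
  constructor
  · intro h
    by_cases hij : j = i
    · exact Or.inl hij
    rcases P.exists_eq_vertex_of_mem_edge hij (P.vertex_add_one_mem_edge i) h with h | h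
    · exact Or.inr h.1
    · obtain ⟨rfl, h⟩ := h
      have := P.vertex_injective h
      exact absurd this (by
        intro h; exact P.vertex_ne (j + 1) (by rw [h]))
  · rintro (rfl | rfl)
    · exact P.vertex_add_one_mem_edge _
    · exact P.vertex_mem_edge _

/-- At a vertex the two rays follow the outgoing edge and, backwards, the incoming edge. -/
theorem localFrame_vertex (i : ZMod n) : P.LocalFrame (P.vertex (i + 1))
    (P.vertex (i + 1 + 1) - P.vertex (i + 1)) (P.vertex i - P.vertex (i + 1)) := by
  set z := P.vertex (i + 1) with hz
  set a := P.vertex (i + 1 + 1) - z with ha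
  set b := P.vertex i - z with hb
  have ha0 : a ≠ 0 := sub_ne_zero.2 (P.vertex_ne _)
  have hb0 : b ≠ 0 := sub_ne_zero.2 (P.vertex_ne _).symm
  have hza : P.edge (i + 1) = segment ℝ z (z + a) := by simp [edge, ha, hz]
  have hzb : P.edge i = segment ℝ z (z + b) := by
    rw [edge, segment_symm]; simp [hb, hz]
  refine ⟨⟨ha0, hb0, fun hc => ?_⟩, ?_, ?_⟩
  · obtain ⟨t, ht⟩ := exists_eq_smul_of_cross_eq_zero ha0 hc
    have ht0 : t ≠ 0 := by rintro rfl; exact hb0 (by simp [ht])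
    rcases lt_or_gt_of_ne ht0 with h | h
    · exact ⟨-t, by linarith, by rw [neg_smul, neg_neg, ht]⟩
    · exfalso
      -- two rays in the same direction overlap beyond the common vertex
      have hmin : 0 < min 1 t := lt_min one_pos h
      have h1 : z + min 1 t • a ∈ P.edge (i + 1) := by
        rw [hza, segment_eq_image']
        exact ⟨min 1 t, ⟨hmin.le, min_le_left _ _⟩, by simp⟩
      have h2 : z + min 1 t • a ∈ P.edge i := by
        rw [hzb, segment_eq_image']
        refine ⟨min 1 t / t, ⟨by positivity, (div_le_one h).2 (min_le_right _ _)⟩, ?_⟩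
        simp only [add_sub_cancel_left, ht, smul_smul]
        rw [div_mul_cancel₀ _ h.ne']
      have := P.eq_vertex_of_mem_edge_add_one h2 h1
      rw [← hz, add_eq_left, smul_eq_zero] at this
      rcases this with h | h
      · exact hmin.ne' h
      · exact ha0 h
  · filter_upwards [P.eventually_not_mem_edge {j | j ≠ i ∧ j ≠ i + 1} (z := z) (by
        intro j hj h
        rw [P.vertex_mem_edge_iff] at h
        rcases h with h | h
        · exact hj.1 h
        · exact hj.2 h), Metric.ball_mem_nhds z (norm_pos_iff.2 ha0),
      Metric.ball_mem_nhds z (norm_pos_iff.2 hb0)] with x hx hxa hxb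
    rw [P.frontier_eq_iUnion_edge, Set.mem_iUnion, ← mem_segment_iff_mem_ray hxa,
      ← mem_segment_iff_mem_ray hxb, ← hza, ← hzb]
    constructor
    · rintro ⟨j, hj⟩
      by_contra! h
      refine hx j ⟨?_, ?_⟩ hj
      · rintro rfl; exact h.2 hj
      · rintro rfl; exact h.1 hj
    · rintro (h | h)
      · exact ⟨_, h⟩
      · exact ⟨_, h⟩
  · refine ⟨a, 1, one_pos, by simp, fun t ht0 ht1 => ?_⟩
    have := P.left_mem (i + 1) (z + t • a) (by
      rw [openSegment_eq_image']
      exact ⟨t, ⟨ht0, ht1⟩, rfl⟩)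
    simpa [rot, ha, hz] using this

/-- At an inner point of an edge the two rays are opposite. -/
theorem localFrame_openSegment (i : ZMod n) {z : Plane}
    (hz : z ∈ openSegment ℝ (P.vertex i) (P.vertex (i + 1))) :
    P.LocalFrame z (P.vertex (i + 1) - z) (P.vertex i - z) := by
  have hz' := hz
  rw [openSegment_eq_image'] at hz'
  obtain ⟨t, ⟨ht0, ht1⟩, htz⟩ := hz'
  set e := P.vertex (i + 1) - P.vertex i with he
  have he0 : e ≠ 0 := sub_ne_zero.2 (P.vertex_ne _)
  have ha : P.vertex (i + 1) - z = (1 - t) • e := by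
    rw [← htz, he]; simp only [sub_smul, one_smul]; abel
  have hb : P.vertex i - z = -(t • e) := by
    rw [← htz]; simp only; abel
  have hseg : P.edge i = segment ℝ z (z + (P.vertex (i + 1) - z)) ∪
      segment ℝ z (z + (P.vertex i - z)) := by
    rw [add_sub_cancel, add_sub_cancel]
    ext x
    constructor
    · intro hx
      rw [edge, segment_eq_image'] at hx
      obtain ⟨s, ⟨hs0, hs1⟩, rfl⟩ := hx
      rcases le_total t s with h | h
      · left
        rw [segment_eq_image']
        refine ⟨(s - t) / (1 - t), ⟨by apply div_nonneg <;> linarith,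
          by rw [div_le_one] <;> linarith⟩, ?_⟩
        simp only [ha, smul_smul]
        rw [div_mul_cancel₀ _ (by linarith), ← htz, sub_smul]
        simp only [he]; abel
      · right
        rw [segment_eq_image']
        refine ⟨(t - s) / t, ⟨by apply div_nonneg <;> linarith,
          by rw [div_le_one] <;> linarith⟩, ?_⟩
        simp only [hb, smul_neg, smul_smul]
        rw [div_mul_cancel₀ _ (by linarith), ← htz, sub_smul]
        simp only [he]; abel
    · have hze : z ∈ P.edge i := openSegment_subset_segment _ _ _ hz
      rintro (hx | hx)
      · exact (convex_segment _ _).segment_subset hze (right_mem_segment _ _ _) hx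
      · exact (convex_segment _ _).segment_subset hze (left_mem_segment _ _ _) hx
  have ha0 : P.vertex (i + 1) - z ≠ 0 := by
    rw [ha]; exact smul_ne_zero (by linarith) he0
  have hb0 : P.vertex i - z ≠ 0 := by
    rw [hb]; exact neg_ne_zero.2 (smul_ne_zero (by linarith) he0)
  refine ⟨⟨ha0, hb0, fun _ => ⟨t / (1 - t), div_pos ht0 (by linarith), ?_⟩⟩, ?_, ?_⟩
  · rw [ha, hb, smul_smul, div_mul_cancel₀ _ (by linarith)]
  · have hnot : ∀ j ∈ {j | j ≠ i}, z ∉ P.edge j := by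
      intro j hj h
      rcases P.exists_eq_vertex_of_mem_edge hj (openSegment_subset_segment _ _ _ hz) h with h | h
      · exact ha0 (by rw [h.2, sub_self])
      · exact hb0 (by rw [h.1, h.2, sub_self])
    filter_upwards [P.eventually_not_mem_edge _ hnot,
      Metric.ball_mem_nhds z (norm_pos_iff.2 ha0),
      Metric.ball_mem_nhds z (norm_pos_iff.2 hb0)] with x hx hxa hxb
    rw [P.frontier_eq_iUnion_edge, Set.mem_iUnion, ← mem_segment_iff_mem_ray hxa,
      ← mem_segment_iff_mem_ray hxb, ← Set.mem_union, ← hseg]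
    constructor
    · rintro ⟨j, hj⟩
      by_cases h : j = i
      · exact h ▸ hj
      · exact absurd hj (hx j h)
    · exact fun h => ⟨_, h⟩
  · refine ⟨e, (1 - t)⁻¹, inv_pos.2 (by linarith), ?_, fun s hs0 hs1 => ?_⟩
    · rw [ha, smul_smul, inv_mul_cancel₀ (by linarith), one_smul]
    · have := P.left_mem i (z + s • (P.vertex (i + 1) - z)) (by
        rw [openSegment_eq_image']
        refine ⟨t + s * (1 - t), ⟨by nlinarith, by nlinarith⟩, ?_⟩
        simp only [ha, smul_smul, add_smul]
        rw [← htz]; simp only [he]; abel)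
      simpa [rot, he] using this

theorem exists_localFrame {z : Plane} (hz : z ∈ frontier P.carrier) :
    ∃ a b, P.LocalFrame z a b := by
  rw [P.frontier_eq_iUnion_edge, Set.mem_iUnion] at hz
  obtain ⟨i, hi⟩ := hz
  rw [edge, ← insert_endpoints_openSegment] at hi
  rcases hi with rfl | rfl | h
  · have := P.localFrame_vertex (i - 1)
    rw [sub_add_cancel] at this
    exact ⟨_, _, this⟩
  · exact ⟨_, _, P.localFrame_vertex i⟩
  · exact ⟨_, _, P.localFrame_openSegment i h⟩

/-- A preconnected set that avoids the boundary lies in `K` as soon as it meets `K`. -/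
theorem subset_carrier_of_isPreconnected {s : Set Plane} (hs : IsPreconnected s)
    (hd : Disjoint s (frontier P.carrier)) (hm : (s ∩ P.carrier).Nonempty) : s ⊆ P.carrier := by
  refine hs.subset_left_of_subset_union P.isOpen isClosed_closure.isOpen_compl
    (disjoint_compl_right.mono_left subset_closure) (fun x hx => ?_) hm
  by_cases h : x ∈ closure P.carrier
  · rw [closure_eq_self_union_frontier] at h
    exact Or.inl (h.resolve_right (Set.disjoint_left.1 hd hx))
  · exact Or.inr h

/-- The translate of a sector, cut off at distance `ρ` from its tip. -/
def sectorAt (z a b : Plane) (ρ : ℝ) : Set Plane := {x | x - z ∈ sector a b} ∩ Metric.ball z ρ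

theorem isPreconnected_sectorAt (z a b : Plane) {ρ : ℝ} (hρ : 0 < ρ) :
    IsPreconnected (sectorAt z a b ρ) := by
  have : sectorAt z a b ρ = (fun x => x + z) '' (sector a b ∩ Metric.ball 0 ρ) := by
    ext x
    constructor
    · rintro ⟨h1, h2⟩
      exact ⟨x - z, ⟨h1, by simpa [dist_eq_norm] using h2⟩, by simp⟩
    · rintro ⟨y, ⟨h1, h2⟩, rfl⟩
      exact ⟨by simpa using h1, by simpa [dist_eq_norm] using h2⟩
  rw [this]
  exact (isPreconnected_sector_inter_ball a b hρ).image _ (by fun_prop)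

/-- Near a boundary point the sector on the left of the boundary is part of `K`: it is connected,
avoids the boundary and contains points just to the left of an edge. The other sector also avoids
the boundary. -/
theorem LocalFrame.exists_radius {z a b : Plane} (h : P.LocalFrame z a b) : ∃ ρ : ℝ, 0 < ρ ∧
    (∀ x ∈ Metric.ball z ρ, x ∈ frontier P.carrier ↔ x - z ∈ ray a ∨ x - z ∈ ray b) ∧
    sectorAt z a b ρ ⊆ P.carrier ∧ Disjoint (sectorAt z b a ρ) (frontier P.carrier) := by
  obtain ⟨ρ, hρ, hb⟩ := Metric.eventually_nhds_iff_ball.1 h.frontier_iff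
  have hd : ∀ a' b', (∀ x ∈ Metric.ball z ρ, x ∈ frontier P.carrier ↔
      x - z ∈ ray a' ∨ x - z ∈ ray b') →
      Disjoint (sectorAt z a' b' ρ) (frontier P.carrier) := by
    intro a' b' hb'
    rw [Set.disjoint_left]
    rintro x ⟨hx1, hx2⟩ hx
    rcases (hb' x hx2).1 hx with h | h
    · exact not_mem_sector_left h hx1
    · exact not_mem_sector_right h hx1
  refine ⟨ρ, hρ, hb, ?_, hd b a fun x hx => by rw [hb x hx, or_comm]⟩
  apply P.subset_carrier_of_isPreconnected (isPreconnected_sectorAt z a b hρ)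
    (hd a b hb)
  obtain ⟨d, r, hr, hda, hl⟩ := h.left_mem
  have hapos : 0 < ‖a‖ := norm_pos_iff.2 h.rayPair.left
  obtain ⟨t, ht0, ht1, ht2⟩ : ∃ t : ℝ, 0 < t ∧ t < 1 ∧ t * ‖a‖ < ρ := by
    refine ⟨min (1 / 2) (ρ / (2 * ‖a‖)), by positivity,
      (min_le_left _ _).trans_lt (by norm_num), ?_⟩
    calc _ ≤ ρ / (2 * ‖a‖) * ‖a‖ := by gcongr; exact min_le_right _ _
      _ = ρ / 2 := by field_simp
      _ < ρ := by linarith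
  have hball : ∀ᶠ s in 𝓝[>] (0 : ℝ), z + t • a + s • rot d ∈ Metric.ball z ρ := by
    have : Tendsto (fun s : ℝ => z + t • a + s • rot d) (𝓝[>] 0)
        (𝓝 (z + t • a + (0 : ℝ) • rot d)) :=
      (Continuous.tendsto (by fun_prop) _).mono_left nhdsWithin_le_nhds
    refine this.eventually (Metric.isOpen_ball.mem_nhds ?_)
    rw [Metric.mem_ball, dist_eq_norm, zero_smul, add_zero, add_sub_cancel_left, norm_smul,
      Real.norm_of_nonneg ht0.le]
    exact ht2
  obtain ⟨s, hs1, hs2, hs3⟩ := ((hl t ht0 ht1).and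
    (hball.and (h.rayPair.eventually_add_rot_mem ht0 hr hda))).exists
  refine ⟨_, ⟨?_, hs2⟩, hs1⟩
  simpa [add_assoc] using hs3

theorem isPreconnected_frontier : IsPreconnected (frontier P.carrier) := by
  have := P.neZero
  have e : frontier P.carrier = ⋃ k : ℕ, P.edge (k : ZMod n) := by
    rw [P.frontier_eq_iUnion_edge]
    ext x
    simp only [Set.mem_iUnion]
    constructor
    · rintro ⟨i, hi⟩
      exact ⟨i.val, by rwa [ZMod.natCast_rightInverse i]⟩
    · rintro ⟨k, hk⟩
      exact ⟨_, hk⟩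
  rw [e]
  apply IsPreconnected.iUnion_of_chain
  · intro k
    exact (convex_segment _ _).isPreconnected
  · intro k
    refine ⟨P.vertex ((k : ZMod n) + 1), P.vertex_add_one_mem_edge _, ?_⟩
    have := P.vertex_mem_edge ((k : ZMod n) + 1)
    simpa using this

/-- `K` lies on one side of its boundary only: no boundary point is interior to the closure.
If one boundary point were, then all would be, as the boundary is connected, and the closure of `K`
would be open and closed. -/
theorem not_mem_interior_closure {z : Plane} (hz : z ∈ frontier P.carrier) :
    z ∉ interior (closure P.carrier) := by
  intro hbad
  -- the good points form a relatively open set as well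
  have hopen : ∀ y ∈ frontier P.carrier, y ∉ interior (closure P.carrier) →
      ∀ᶠ x in 𝓝 y, x ∈ frontier P.carrier → x ∉ interior (closure P.carrier) := by
    intro y hy hgood
    obtain ⟨a, b, h⟩ := P.exists_localFrame hy
    obtain ⟨ρ, hρ, hfr, hL, hR⟩ := h.exists_radius
    have hRK : Disjoint (sectorAt y b a ρ) P.carrier := by
      rw [Set.disjoint_iff_inter_eq_empty, ← Set.not_nonempty_iff_eq_empty]
      intro hne
      have hsub := P.subset_carrier_of_isPreconnected (isPreconnected_sectorAt y b a hρ) hR hne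
      apply hgood
      rw [mem_interior_iff_mem_nhds]
      filter_upwards [Metric.ball_mem_nhds y hρ] with x hx
      by_cases hx' : x ∈ frontier P.carrier
      · exact frontier_subset_closure hx'
      · rw [hfr x hx, not_or] at hx'
        rcases h.rayPair.mem_or_mem_sector hx'.1 hx'.2 with h1 | h1
        · exact subset_closure (hL ⟨h1, hx⟩)
        · exact subset_closure (hsub ⟨h1, hx⟩)
    filter_upwards [Metric.ball_mem_nhds y hρ] with x hx hxJ hxi
    obtain ⟨c, d, -, hcd⟩ := h.rayPair.symm.exists_add_mem_sector
    have hxr := (hfr x hx).1 hxJ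
    have ht : Tendsto (fun s : ℝ => x + s • c + s • d) (𝓝[>] 0) (𝓝 x) := by
      have : Tendsto (fun s : ℝ => x + s • c + s • d) (𝓝[>] 0)
          (𝓝 (x + (0 : ℝ) • c + (0 : ℝ) • d)) :=
        (Continuous.tendsto (by fun_prop) _).mono_left nhdsWithin_le_nhds
      simpa using this
    obtain ⟨s, hs1, hs2, hs3⟩ := ((ht.eventually (isOpen_interior.mem_nhds hxi)).and
      ((ht.eventually (Metric.isOpen_ball.mem_nhds hx)).and self_mem_nhdsWithin)).exists
    have hs3' : (0 : ℝ) < s := hs3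
    have hmem : x + s • c + s • d ∈ sectorAt y b a ρ := by
      refine ⟨?_, hs2⟩
      have := hcd (x - y) (Or.inr hxr.symm) s s hs3' hs3'
      have e : x + s • c + s • d - y = x - y + s • c + s • d := by abel
      change _ ∈ sector b a
      rwa [e]
    rcases (closure_eq_self_union_frontier P.carrier ▸ interior_subset hs1 :
        x + s • c + s • d ∈ P.carrier ∪ frontier P.carrier) with h1 | h1
    · exact Set.disjoint_left.1 hRK hmem h1
    · exact Set.disjoint_left.1 hR hmem h1
  have hall : frontier P.carrier ⊆ interior (closure P.carrier) := by
    have hpre := P.isPreconnected_frontier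
    intro y hy
    by_contra hgood
    set V := {x | ∀ᶠ w in 𝓝 x, w ∈ frontier P.carrier → w ∉ interior (closure P.carrier)} with hV
    have hVo : IsOpen V := isOpen_setOfPred_eventually_nhds
    obtain ⟨w, hw, hw1, hw2⟩ := hpre _ _ isOpen_interior hVo (by
      intro x hx
      by_cases h : x ∈ interior (closure P.carrier)
      · exact Or.inl h
      · exact Or.inr (hopen x hx h)) ⟨z, hz, hbad⟩ ⟨y, hy, hopen y hy hgood⟩
    exact (hw2.self_of_nhds hw) hw1
  have hcl : IsClopen (closure P.carrier) := by
    refine ⟨isClosed_closure, ?_⟩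
    rw [← interior_eq_iff_isOpen]
    refine le_antisymm interior_subset ?_
    rw [closure_eq_self_union_frontier]
    intro x hx
    rw [← closure_eq_self_union_frontier]
    rcases hx with hx | hx
    · exact interior_mono subset_closure (P.isOpen.interior_eq.symm ▸ hx)
    · exact hall hx
  rcases isClopen_iff.1 hcl with h | h
  · exact (P.isConnected.nonempty.closure).ne_empty h
  · have := P.isBounded.closure
    rw [h] at this
    exact NormedSpace.unbounded_univ ℝ Plane this

/-- Near each point of the closure, `K` is invariant under short translations along the positive
combinations of two independent vectors. -/
theorem exists_translation {z : Plane} (hz : z ∈ closure P.carrier) :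
    ∃ c d : Plane, cross c d ≠ 0 ∧ ∃ r : ℝ, 0 < r ∧ ∀ᶠ x in 𝓝 z, x ∈ P.carrier →
      ∀ α β : ℝ, 0 < α → α < r → 0 < β → β < r → x + α • c + β • d ∈ P.carrier := by
  have hsmall : ∀ (c d : Plane) (ρ : ℝ), 0 < ρ → ∃ r : ℝ, 0 < r ∧ ∀ x ∈ Metric.ball z (ρ / 2),
      ∀ α β : ℝ, 0 < α → α < r → 0 < β → β < r → x + α • c + β • d ∈ Metric.ball z ρ := by
    intro c d ρ hρ
    refine ⟨ρ / (2 * (‖c‖ + ‖d‖ + 1)), by positivity, fun x hx α β hα hα' hβ hβ' => ?_⟩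
    rw [Metric.mem_ball, dist_eq_norm] at hx ⊢
    have e : x + α • c + β • d - z = (x - z) + (α • c + β • d) := by abel
    have h1 : ‖α • c + β • d‖ ≤ ρ / (2 * (‖c‖ + ‖d‖ + 1)) * (‖c‖ + ‖d‖) := by
      refine (norm_add_le _ _).trans ?_
      rw [norm_smul, norm_smul, Real.norm_of_nonneg hα.le, Real.norm_of_nonneg hβ.le, mul_add]
      gcongr
    have h2 : ρ / (2 * (‖c‖ + ‖d‖ + 1)) * (‖c‖ + ‖d‖) ≤ ρ / 2 := by
      rw [div_mul_eq_mul_div, div_le_div_iff₀ (by positivity) (by positivity)]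
      nlinarith [norm_nonneg c, norm_nonneg d]
    rw [e]
    linarith [norm_add_le (x - z) (α • c + β • d)]
  rw [closure_eq_self_union_frontier] at hz
  rcases hz with hz | hz
  · obtain ⟨ρ, hρ, hb⟩ := Metric.isOpen_iff.1 P.isOpen z hz
    obtain ⟨r, hr, h⟩ := hsmall (EuclideanSpace.single 0 1) (EuclideanSpace.single 1 1) ρ hρ
    refine ⟨EuclideanSpace.single 0 1, EuclideanSpace.single 1 1, by simp [cross], r, hr, ?_⟩
    filter_upwards [Metric.ball_mem_nhds z (half_pos hρ)] with x hx _ α β h1 h2 h3 h4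
    exact hb (h x hx α β h1 h2 h3 h4)
  · obtain ⟨a, b, h⟩ := P.exists_localFrame hz
    obtain ⟨ρ, hρ, hfr, hL, hR⟩ := h.exists_radius
    have hRK : Disjoint (sectorAt z b a ρ) P.carrier := by
      rw [Set.disjoint_iff_inter_eq_empty, ← Set.not_nonempty_iff_eq_empty]
      intro hne
      have hsub := P.subset_carrier_of_isPreconnected (isPreconnected_sectorAt z b a hρ) hR hne
      apply P.not_mem_interior_closure hz
      rw [mem_interior_iff_mem_nhds]
      filter_upwards [Metric.ball_mem_nhds z hρ] with x hx
      by_cases hx' : x ∈ frontier P.carrier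
      · exact frontier_subset_closure hx'
      · rw [hfr x hx, not_or] at hx'
        rcases h.rayPair.mem_or_mem_sector hx'.1 hx'.2 with h1 | h1
        · exact subset_closure (hL ⟨h1, hx⟩)
        · exact subset_closure (hsub ⟨h1, hx⟩)
    obtain ⟨c, d, hcd, hs⟩ := h.rayPair.exists_add_mem_sector
    obtain ⟨r, hr, hball⟩ := hsmall c d ρ hρ
    refine ⟨c, d, hcd, r, hr, ?_⟩
    filter_upwards [Metric.ball_mem_nhds z (half_pos hρ)] with x hx hxK α β h1 h2 h3 h4
    have hxρ : x ∈ Metric.ball z ρ := Metric.ball_subset_ball (by linarith) hx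
    have hxJ : x ∉ frontier P.carrier := fun hf =>
      Set.disjoint_left.1 (disjoint_frontier_iff_isOpen.2 P.isOpen) hf hxK
    rw [hfr x hxρ, not_or] at hxJ
    have hxs : x - z ∈ sector a b := by
      rcases h.rayPair.mem_or_mem_sector hxJ.1 hxJ.2 with h' | h'
      · exact h'
      · exact absurd hxK (Set.disjoint_left.1 hRK ⟨h', hxρ⟩)
    refine hL ⟨?_, hball x hx α β h1 h2 h3 h4⟩
    have e : x + α • c + β • d - z = x - z + α • c + β • d := by abel
    change _ ∈ sector a b
    rw [e]
    exact hs _ (Or.inl hxs) α β h1 h3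

end PlanePolygon

/-! ### Sobolev and trace inequalities -/

theorem contDiff_pd {φ : Plane → ℝ} (h : ContDiff ℝ ∞ φ) (i : Fin 2) : ContDiff ℝ ∞ (pd i φ) := by
  unfold pd
  exact (h.fderiv_right (m := ∞) (by simp)).clm_apply contDiff_const

theorem fderiv_eq_sum_pd (φ : Plane → ℝ) (x c : Plane) : fderiv ℝ φ x c = ∑ i, c i * pd i φ x := by
  have e : c = ∑ i, c i • EuclideanSpace.single i (1 : ℝ) := by
    ext j; fin_cases j <;> simp [Fin.sum_univ_two]
  conv_lhs => rw [e]
  simp [pd]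

/-- The derivative of a function in the direction `c`. -/
noncomputable def dirDeriv (c : Plane) (φ : Plane → ℝ) (x : Plane) : ℝ := fderiv ℝ φ x c

theorem contDiff_dirDeriv {φ : Plane → ℝ} (h : ContDiff ℝ ∞ φ) (c : Plane) :
    ContDiff ℝ ∞ (dirDeriv c φ) := by
  unfold dirDeriv
  exact (h.fderiv_right (m := ∞) (by simp)).clm_apply contDiff_const

theorem hasDerivAt_comp_line {φ : Plane → ℝ} (h : ContDiff ℝ ∞ φ) (x c : Plane) (s : ℝ) :
    HasDerivAt (fun s : ℝ => φ (x + s • c)) (dirDeriv c φ (x + s • c)) s := by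
  have h1 : HasDerivAt (fun s : ℝ => x + s • c) c s := by
    simpa using ((hasDerivAt_id s).smul_const c).const_add x
  exact (h.differentiable (by simp) (x + s • c)).hasFDerivAt.comp_hasDerivAt s h1

theorem enorm_add_sq_le (a b : ℝ) : ‖a + b‖ₑ ^ 2 ≤ 2 * (‖a‖ₑ ^ 2 + ‖b‖ₑ ^ 2) := by
  have e : ∀ x : ℝ, ‖x‖ₑ ^ 2 = ENNReal.ofReal (x ^ 2) := by
    intro x
    rw [Real.enorm_eq_ofReal_abs, ← ENNReal.ofReal_pow (abs_nonneg _), sq_abs]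
  rw [e, e, e, ← ENNReal.ofReal_add (sq_nonneg _) (sq_nonneg _),
    show (2 : ℝ≥0∞) = ENNReal.ofReal 2 by simp, ← ENNReal.ofReal_mul (by norm_num)]
  apply ENNReal.ofReal_le_ofReal
  nlinarith [sq_nonneg (a - b)]

theorem enorm_sq_eq_ofReal (x : ℝ) : ‖x‖ₑ ^ 2 = ENNReal.ofReal (x ^ 2) := by
  rw [Real.enorm_eq_ofReal_abs, ← ENNReal.ofReal_pow (abs_nonneg _), sq_abs]

theorem enorm_dirDeriv_sq_le (c : Plane) (φ : Plane → ℝ) (x : Plane) :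
    ‖dirDeriv c φ x‖ₑ ^ 2 ≤ ENNReal.ofReal (‖c‖ ^ 2) * ∑ i, ‖pd i φ x‖ₑ ^ 2 := by
  simp only [enorm_sq_eq_ofReal]
  rw [← ENNReal.ofReal_sum_of_nonneg (fun i _ => sq_nonneg _), ← ENNReal.ofReal_mul (sq_nonneg _)]
  apply ENNReal.ofReal_le_ofReal
  rw [dirDeriv, fderiv_eq_sum_pd, EuclideanSpace.norm_sq_eq]
  simp only [Real.norm_eq_abs, sq_abs]
  exact Finset.sum_mul_sq_le_sq_mul_sq _ _ _

/-- The one-dimensional trace inequality: differentiate `(1 - s / r) g ^ 2`. -/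
theorem sq_le_integral_of_hasDerivAt {g g' : ℝ → ℝ} (hg : ∀ s, HasDerivAt g (g' s) s)
    (hg' : Continuous g') {r : ℝ} (hr : 0 < r) :
    g 0 ^ 2 ≤ (1 / r + 1) * ∫ s in (0 : ℝ)..r, (g s ^ 2 + g' s ^ 2) := by
  have hgc : Continuous g := continuous_iff_continuousAt.2 fun s => (hg s).continuousAt
  have hd : ∀ s ∈ Set.uIcc 0 r, HasDerivAt (fun s => (s / r - 1) * g s ^ 2)
      (1 / r * g s ^ 2 + (s / r - 1) * (2 * g s * g' s)) s := by
    intro s _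
    have h1 : HasDerivAt (fun s : ℝ => s / r - 1) (1 / r) s :=
      ((hasDerivAt_id s).div_const r).sub_const 1
    have h2 : HasDerivAt (fun s => g s ^ 2) (2 * g s * g' s) s := by
      simpa using (hg s).fun_pow 2
    exact h1.mul h2
  have hi := intervalIntegral.integral_eq_sub_of_hasDerivAt hd
    (Continuous.intervalIntegrable (by fun_prop) _ _)
  rw [div_self hr.ne'] at hi
  have e : g 0 ^ 2 = ∫ s in (0 : ℝ)..r, (1 / r * g s ^ 2 + (s / r - 1) * (2 * g s * g' s)) := by
    rw [hi]; ring
  rw [e, ← intervalIntegral.integral_const_mul]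
  apply intervalIntegral.integral_mono_on hr.le (Continuous.intervalIntegrable (by fun_prop) _ _)
    (Continuous.intervalIntegrable (by fun_prop) _ _)
  intro s hs
  have h0 : 0 ≤ s / r := div_nonneg hs.1 hr.le
  have h1 : s / r ≤ 1 := (div_le_one hr).2 hs.2
  have h2 : 0 < 1 / r := by positivity
  have h3 : (s / r - 1) * (2 * g s * g' s) ≤ g s ^ 2 + g' s ^ 2 := by
    rcases le_total 0 (g s * g' s) with h | h
    · nlinarith [sq_nonneg (g s), sq_nonneg (g' s)]
    · nlinarith [sq_nonneg (g s + g' s)]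
  nlinarith [sq_nonneg (g s), sq_nonneg (g' s), mul_nonneg h2.le (sq_nonneg (g' s))]

theorem ofReal_intervalIntegral_eq_lintegral {f : ℝ → ℝ} (hf : Continuous f) (h0 : ∀ s, 0 ≤ f s)
    {r : ℝ} (hr : 0 ≤ r) :
    ENNReal.ofReal (∫ s in (0 : ℝ)..r, f s) = ∫⁻ s in Set.Ioo 0 r, ENNReal.ofReal (f s) := by
  rw [intervalIntegral.integral_of_le hr, ← restrict_Ioo_eq_restrict_Ioc,
    ofReal_integral_eq_lintegral_ofReal _ (ae_of_all _ h0)]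
  rw [restrict_Ioo_eq_restrict_Ioc]
  exact (hf.integrableOn_Icc (a := 0) (b := r)).mono_set Set.Ioc_subset_Icc_self

theorem enorm_sq_le_lintegral_line {φ : Plane → ℝ} (h : ContDiff ℝ ∞ φ) (x c : Plane) {r : ℝ}
    (hr : 0 < r) :
    ‖φ x‖ₑ ^ 2 ≤ ENNReal.ofReal (1 / r + 1) *
      ∫⁻ s in Set.Ioo 0 r, (‖φ (x + s • c)‖ₑ ^ 2 + ‖dirDeriv c φ (x + s • c)‖ₑ ^ 2) := by
  have hc : Continuous fun s : ℝ => dirDeriv c φ (x + s • c) :=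
    (contDiff_dirDeriv h c).continuous.comp (by fun_prop)
  have hc' : Continuous fun s : ℝ => φ (x + s • c) := h.continuous.comp (by fun_prop)
  have := sq_le_integral_of_hasDerivAt (hasDerivAt_comp_line h x c) hc hr
  rw [zero_smul, add_zero] at this
  rw [enorm_sq_eq_ofReal]
  refine (ENNReal.ofReal_le_ofReal this).trans ?_
  rw [ENNReal.ofReal_mul (by positivity),
    ofReal_intervalIntegral_eq_lintegral (by fun_prop) (fun s => by positivity) hr.le]
  gcongr with s
  rw [enorm_sq_eq_ofReal, enorm_sq_eq_ofReal, ENNReal.ofReal_add (sq_nonneg _) (sq_nonneg _)]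

/-- Integration over a family of parallel segments is controlled by integration over the region
that the segments sweep out. -/
theorem exists_lintegral_parallelogram_le {c d : Plane} (h : cross c d ≠ 0) :
    ∃ C : ℝ≥0, ∀ (S T : Set ℝ), MeasurableSet S → MeasurableSet T → ∀ (K : Set Plane),
      MeasurableSet K → ∀ (x : Plane), (∀ s ∈ S, ∀ t ∈ T, x + s • c + t • d ∈ K) →
      ∀ F : Plane → ℝ≥0∞, Measurable F →
        ∫⁻ s in S, ∫⁻ t in T, F (x + s • c + t • d) ≤ C * ∫⁻ y in K, F y := by
  let f : (ℝ × ℝ) →ₗ[ℝ] Plane :=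
    (LinearMap.toSpanSingleton ℝ Plane c).coprod (LinearMap.toSpanSingleton ℝ Plane d)
  have hf : ∀ p : ℝ × ℝ, f p = p.1 • c + p.2 • d := fun p => by simp [f]
  have hinj : Function.Injective f := by
    rw [injective_iff_map_eq_zero]
    intro p hp
    rw [hf] at hp
    have h1 : cross (p.1 • c + p.2 • d) d = 0 := by rw [hp, cross_zero_left]
    have h2 : cross c (p.1 • c + p.2 • d) = 0 := by rw [hp, cross_zero_right]
    rw [cross_add_left, cross_smul_left, cross_smul_left, cross_same, mul_zero, add_zero] at h1
    rw [cross_add_right, cross_smul_right, cross_smul_right, cross_same, mul_zero, zero_add] at h2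
    exact Prod.ext ((mul_eq_zero.1 h1).resolve_right h) ((mul_eq_zero.1 h2).resolve_right h)
  let e : (ℝ × ℝ) ≃L[ℝ] Plane :=
    (LinearEquiv.ofInjectiveOfFinrankEq f hinj (by simp)).toContinuousLinearEquiv
  have he : ∀ p : ℝ × ℝ, e p = p.1 • c + p.2 • d := hf
  have hH : (Measure.map e (volume : Measure (ℝ × ℝ))).IsAddHaarMeasure :=
    e.isAddHaarMeasure_map volume
  refine ⟨(Measure.map e (volume : Measure (ℝ × ℝ))).addHaarScalarFactor volume, ?_⟩
  intro S T hS hT K hK x hx F hF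
  have hm := Measure.isAddLeftInvariant_eq_smul (Measure.map e (volume : Measure (ℝ × ℝ)))
    (volume : Measure Plane)
  set k := (Measure.map e (volume : Measure (ℝ × ℝ))).addHaarScalarFactor volume
  have hFK : Measurable (K.indicator F) := hF.indicator hK
  calc ∫⁻ s in S, ∫⁻ t in T, F (x + s • c + t • d)
      ≤ ∫⁻ s in S, ∫⁻ t in T, K.indicator F (x + s • c + t • d) := by
        refine setLIntegral_mono' hS fun s hs => setLIntegral_mono' hT fun t ht => ?_
        rw [Set.indicator_of_mem (hx s hs t ht)]
    _ ≤ ∫⁻ s, ∫⁻ t, K.indicator F (x + s • c + t • d) :=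
        (setLIntegral_le_lintegral _ _).trans
          (lintegral_mono fun s => setLIntegral_le_lintegral _ _)
    _ = ∫⁻ p : ℝ × ℝ, K.indicator F (x + e p) := by
        rw [Measure.volume_eq_prod, lintegral_prod]
        · simp only [he, add_assoc]
        · exact (hFK.comp (by fun_prop)).aemeasurable
    _ = ∫⁻ y, K.indicator F (x + y) ∂(Measure.map e (volume : Measure (ℝ × ℝ))) := by
        exact (lintegral_map (f := fun y => K.indicator F (x + y)) (hFK.comp (by fun_prop))
          (by fun_prop)).symm
    _ = k * ∫⁻ y in K, F y := by
        rw [hm, lintegral_smul_measure, lintegral_add_left_eq_self (μ := volume)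
          (K.indicator F) x, lintegral_indicator hK]
        rfl

namespace PlanePolygon

variable {n : ℕ} (P : PlanePolygon n)

theorem measurableSet_carrier : MeasurableSet P.carrier := P.isOpen.measurableSet

/-- A sharpening of `exists_translation` to points of the closure. -/
theorem exists_translation_closure {z : Plane} (hz : z ∈ closure P.carrier) :
    ∃ c d : Plane, cross c d ≠ 0 ∧ ∃ r : ℝ, 0 < r ∧ ∀ᶠ x in 𝓝 z, x ∈ closure P.carrier →
      ∀ α β : ℝ, 0 < α → α < r → 0 < β → β < r → x + α • c + β • d ∈ P.carrier := by
  obtain ⟨c, d, hcd, r, hr, h⟩ := P.exists_translation hz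
  refine ⟨c, d, hcd, r, hr, ?_⟩
  filter_upwards [h.eventually_nhds] with x hx hxK α β h1 h2 h3 h4
  have hp : Tendsto (fun y => α + cross (x - y) d / cross c d) (𝓝 x) (𝓝 α) := by
    have : Continuous fun y => α + cross (x - y) d / cross c d := by unfold cross; fun_prop
    simpa [cross_zero_left] using this.tendsto x
  have hq : Tendsto (fun y => β + cross c (x - y) / cross c d) (𝓝 x) (𝓝 β) := by
    have : Continuous fun y => β + cross c (x - y) / cross c d := by unfold cross; fun_prop
    simpa [cross_zero_right] using this.tendsto x
  obtain ⟨y, hyK, hy, hy1, hy2⟩ := (mem_closure_iff_frequently.1 hxK).and_eventually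
    (hx.and ((hp.eventually (Ioo_mem_nhds h1 h2)).and (hq.eventually (Ioo_mem_nhds h3 h4)))) |>.exists
  have := hy hyK _ _ hy1.1 hy1.2 hy2.1 hy2.2
  have e : x + α • c + β • d = y + (α + cross (x - y) d / cross c d) • c +
      (β + cross c (x - y) / cross c d) • d := by
    have h0 := cross_smul_eq c d (x - y)
    have h0' : x - y = (cross (x - y) d / cross c d) • c + (cross c (x - y) / cross c d) • d := by
      rw [div_eq_inv_mul, div_eq_inv_mul, mul_smul, mul_smul, ← smul_add, ← h0, smul_smul,
        inv_mul_cancel₀ hcd, one_smul]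
    rw [add_smul, add_smul]
    generalize (cross (x - y) d / cross c d) = p at h0'
    generalize (cross c (x - y) / cross c d) = q at h0'
    rw [sub_eq_iff_eq_add.1 h0']; abel
  rwa [e]

/-- The square of the `L²(K)` norm. -/
noncomputable def normSq (f : Plane → ℝ) : ℝ≥0∞ := ∫⁻ x in P.carrier, ‖f x‖ₑ ^ 2

/-- The square of the `L²(K)` norm of the gradient. -/
noncomputable def gradSq (φ : Plane → ℝ) : ℝ≥0∞ := ∑ i, P.normSq (pd i φ)

/-- The square of the `L²(K)` norm of the Hessian. -/
noncomputable def hessSq (φ : Plane → ℝ) : ℝ≥0∞ := ∑ i, P.gradSq (pd i φ)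

theorem lintegral_sum_pd {φ : Plane → ℝ} (h : ContDiff ℝ ∞ φ) :
    ∫⁻ x in P.carrier, ∑ i, ‖pd i φ x‖ₑ ^ 2 = P.gradSq φ := by
  rw [lintegral_finsetSum]
  · rfl
  · intro i _
    exact ((contDiff_pd h i).continuous.measurable.enorm.pow_const 2)

/-- The one-dimensional trace inequality, applied in the direction `c` and then in the direction `d`. -/
theorem enorm_sq_le_iterated {φ : Plane → ℝ} (h : ContDiff ℝ ∞ φ) (x c d : Plane) {r : ℝ}
    (hr : 0 < r) :
    ‖φ x‖ₑ ^ 2 ≤ ENNReal.ofReal (1 / r + 1) ^ 2 * ∫⁻ s in Set.Ioo 0 r, ∫⁻ t in Set.Ioo 0 r,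
      (‖φ (x + s • c + t • d)‖ₑ ^ 2 + ‖dirDeriv d φ (x + s • c + t • d)‖ₑ ^ 2 +
        (‖dirDeriv c φ (x + s • c + t • d)‖ₑ ^ 2 +
          ‖dirDeriv d (dirDeriv c φ) (x + s • c + t • d)‖ₑ ^ 2)) := by
  refine (enorm_sq_le_lintegral_line h x c hr).trans ?_
  rw [sq, mul_assoc]
  gcongr
  rw [← lintegral_const_mul' _ _ ENNReal.ofReal_ne_top]
  refine lintegral_mono fun s => ?_
  have m : ∀ {f : Plane → ℝ}, ContDiff ℝ ∞ f →
      Measurable fun t : ℝ => ‖f (x + s • c + t • d)‖ₑ ^ 2 := fun hf =>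
    ((hf.continuous.comp (by fun_prop)).measurable.enorm.pow_const 2)
  have m' : Measurable fun t : ℝ => ‖φ (x + s • c + t • d)‖ₑ ^ 2 +
      ‖dirDeriv d φ (x + s • c + t • d)‖ₑ ^ 2 := (m h).add (m (contDiff_dirDeriv h d))
  rw [lintegral_add_left m', mul_add]
  exact add_le_add (enorm_sq_le_lintegral_line h _ d hr)
    (enorm_sq_le_lintegral_line (contDiff_dirDeriv h c) _ d hr)

theorem pd_dirDeriv {φ : Plane → ℝ} (h : ContDiff ℝ ∞ φ) (c : Plane) (j : Fin 2) (x : Plane) :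
    pd j (dirDeriv c φ) x = dirDeriv c (pd j φ) x := by
  have hd : DifferentiableAt ℝ (fderiv ℝ φ) x :=
    (h.fderiv_right (m := ∞) (by simp)).differentiable (by simp) x
  have hs : IsSymmSndFDerivAt ℝ φ x := h.contDiffAt.isSymmSndFDerivAt (by
    simp only [minSmoothness_of_isRCLikeNormedField]
    exact ENat.LEInfty.out)
  unfold pd dirDeriv
  rw [fderiv_clm_apply hd (by fun_prop), fderiv_clm_apply hd (by fun_prop)]
  simp only [fderiv_fun_const, Pi.zero_apply, ContinuousLinearMap.comp_zero, zero_add,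
    ContinuousLinearMap.flip_apply]
  exact hs _ _

theorem pd_comm {φ : Plane → ℝ} (h : ContDiff ℝ ∞ φ) (i j : Fin 2) (x : Plane) :
    pd j (pd i φ) x = pd i (pd j φ) x := pd_dirDeriv h _ j x

/-- The local form of the Sobolev inequality in the plane. -/
theorem exists_sobolev_of_parallelogram {c d : Plane} (h : cross c d ≠ 0) {r : ℝ} (hr : 0 < r) :
    ∃ C : ℝ≥0, ∀ x : Plane, (∀ α β : ℝ, 0 < α → α < r → 0 < β → β < r →
      x + α • c + β • d ∈ P.carrier) → ∀ φ : Plane → ℝ, ContDiff ℝ ∞ φ →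
      ‖φ x‖ₑ ^ 2 ≤ C * (P.normSq φ + P.gradSq φ + P.hessSq φ) := by
  obtain ⟨C, hC⟩ := exists_lintegral_parallelogram_le h
  set M : ℝ≥0 := 1 + Real.toNNReal (‖c‖ ^ 2) + Real.toNNReal (‖d‖ ^ 2) +
    Real.toNNReal (‖d‖ ^ 2) * Real.toNNReal (‖c‖ ^ 2) with hM
  refine ⟨Real.toNNReal (1 / r + 1) ^ 2 * (C * M), fun x hx φ hφ => ?_⟩
  have m : ∀ {f : Plane → ℝ}, ContDiff ℝ ∞ f → Measurable fun y => ‖f y‖ₑ ^ 2 := fun hf =>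
    hf.continuous.measurable.enorm.pow_const 2
  refine (enorm_sq_le_iterated hφ x c d hr).trans ?_
  rw [ENNReal.coe_mul, ENNReal.coe_pow, mul_assoc]
  gcongr
  · rfl
  have := hC (Set.Ioo 0 r) (Set.Ioo 0 r) measurableSet_Ioo measurableSet_Ioo P.carrier
    P.measurableSet_carrier x (fun s hs t ht => hx s t hs.1 hs.2 ht.1 ht.2)
    (fun y => (‖φ y‖ₑ ^ 2 + ‖dirDeriv d φ y‖ₑ ^ 2 +
        (‖dirDeriv c φ y‖ₑ ^ 2 + ‖dirDeriv d (dirDeriv c φ) y‖ₑ ^ 2)))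
    (((m hφ).add (m (contDiff_dirDeriv hφ d))).add ((m (contDiff_dirDeriv hφ c)).add
      (m (contDiff_dirDeriv (contDiff_dirDeriv hφ c) d))))
  refine this.trans ?_
  rw [ENNReal.coe_mul, mul_assoc]
  gcongr
  have hsum : P.normSq φ + P.gradSq φ + P.hessSq φ = ∫⁻ y in P.carrier, (‖φ y‖ₑ ^ 2 +
      ∑ i, ‖pd i φ y‖ₑ ^ 2 + ∑ i, ∑ j, ‖pd j (pd i φ) y‖ₑ ^ 2) := by
    have m1 : Measurable fun y => ∑ i, ‖pd i φ y‖ₑ ^ 2 :=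
      Finset.measurable_fun_sum _ fun i _ => m (contDiff_pd hφ i)
    have m2 : ∀ i, Measurable fun y => ∑ j, ‖pd j (pd i φ) y‖ₑ ^ 2 := fun i =>
      Finset.measurable_fun_sum _ fun j _ => m (contDiff_pd (contDiff_pd hφ i) j)
    have m3 : Measurable fun y => ‖φ y‖ₑ ^ 2 + ∑ i, ‖pd i φ y‖ₑ ^ 2 := (m hφ).add m1
    rw [lintegral_add_left m3, lintegral_add_left (m hφ), P.lintegral_sum_pd hφ,
      lintegral_finsetSum _ fun i _ => m2 i]
    simp only [P.lintegral_sum_pd (contDiff_pd hφ _)]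
    rfl
  rw [hsum, ← lintegral_const_mul' _ _ ENNReal.coe_ne_top]
  refine lintegral_mono fun y => ?_
  have h1 := enorm_dirDeriv_sq_le c φ y
  have h2 := enorm_dirDeriv_sq_le d φ y
  have h3 : ‖dirDeriv d (dirDeriv c φ) y‖ₑ ^ 2 ≤ ENNReal.ofReal (‖d‖ ^ 2) *
      (ENNReal.ofReal (‖c‖ ^ 2) * ∑ i, ∑ j, ‖pd j (pd i φ) y‖ₑ ^ 2) := by
    refine (enorm_dirDeriv_sq_le d _ y).trans ?_
    gcongr
    rw [Finset.mul_sum]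
    gcongr with i
    rw [pd_dirDeriv hφ]
    exact enorm_dirDeriv_sq_le c _ y
  set X := ‖φ y‖ₑ ^ 2
  set Y := ∑ i, ‖pd i φ y‖ₑ ^ 2
  set Z := ∑ i, ∑ j, ‖pd j (pd i φ) y‖ₑ ^ 2
  set γ : ℝ≥0∞ := ENNReal.ofReal (‖c‖ ^ 2)
  set δ : ℝ≥0∞ := ENNReal.ofReal (‖d‖ ^ 2)
  have hMc : (M : ℝ≥0∞) = 1 + γ + δ + δ * γ := by
    rw [hM]; push_cast; rfl
  rw [hMc]
  calc _ ≤ X + δ * Y + (γ * Y + δ * (γ * Z)) := by gcongr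
    _ ≤ X + δ * Y + (γ * Y + δ * (γ * Z)) + ((γ + δ + δ * γ) * X + (1 + δ * γ) * Y +
        (1 + γ + δ) * Z) := le_self_add
    _ = _ := by ring

/-- The Sobolev inequality: the maximum over the closure is bounded by the `H²` norm. -/
theorem exists_sobolev : ∃ C : ℝ≥0, ∀ x ∈ closure P.carrier, ∀ φ : Plane → ℝ, ContDiff ℝ ∞ φ →
    ‖φ x‖ₑ ^ 2 ≤ C * (P.normSq φ + P.gradSq φ + P.hessSq φ) := by
  have hK : IsCompact (closure P.carrier) := P.isBounded.isCompact_closure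
  refine hK.induction_on (p := fun s => ∃ C : ℝ≥0, ∀ x ∈ s, ∀ φ : Plane → ℝ, ContDiff ℝ ∞ φ →
    ‖φ x‖ₑ ^ 2 ≤ C * (P.normSq φ + P.gradSq φ + P.hessSq φ)) ⟨0, by simp⟩ ?_ ?_ ?_
  · rintro s t hst ⟨C, hC⟩
    exact ⟨C, fun x hx => hC x (hst hx)⟩
  · rintro s t ⟨C, hC⟩ ⟨D, hD⟩
    refine ⟨max C D, fun x hx φ hφ => ?_⟩
    rcases hx with hx | hx
    · refine (hC x hx φ hφ).trans ?_
      gcongr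
      exact le_max_left _ _
    · refine (hD x hx φ hφ).trans ?_
      gcongr
      exact le_max_right _ _
  · intro z hz
    obtain ⟨c, d, hcd, r, hr, h⟩ := P.exists_translation_closure hz
    obtain ⟨C, hC⟩ := P.exists_sobolev_of_parallelogram hcd hr
    refine ⟨_, mem_nhdsWithin_iff_eventually.2 (h.mono fun x hx hx' => ?_), C,
      fun x (hx : ∀ α β : ℝ, 0 < α → α < r → 0 < β → β < r →
        x + α • c + β • d ∈ P.carrier) => hC x hx⟩
    exact hx hx'

theorem edgePt_eq (i : ZMod n) (s : ℝ) :
    P.edgePt i s = P.vertex i + s • (P.vertex (i + 1) - P.vertex i) := by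
  rw [edgePt, AffineMap.lineMap_apply]
  simp [add_comm]

theorem edgePt_mem_edge (i : ZMod n) {s : ℝ} (hs : s ∈ Set.Icc (0 : ℝ) 1) :
    P.edgePt i s ∈ P.edge i := by
  rw [edge, segment_eq_image_lineMap]
  exact ⟨s, hs, rfl⟩

theorem edge_subset_frontier (i : ZMod n) : P.edge i ⊆ frontier P.carrier := by
  rw [P.frontier_eq_iUnion_edge]
  exact Set.subset_iUnion _ i

theorem edgePt_mem_closure (i : ZMod n) {s : ℝ} (hs : s ∈ Set.Icc (0 : ℝ) 1) :
    P.edgePt i s ∈ closure P.carrier :=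
  frontier_subset_closure (P.edge_subset_frontier i (P.edgePt_mem_edge i hs))

/-- The trace inequality on an edge. -/
theorem exists_trace (i : ZMod n) : ∃ C : ℝ≥0, ∀ φ : Plane → ℝ, ContDiff ℝ ∞ φ →
    ∫⁻ s in Set.Ioc 0 1, ‖φ (P.edgePt i s)‖ₑ ^ 2 ≤ C * (P.normSq φ + P.gradSq φ) := by
  suffices h : ∃ C : ℝ≥0, ∀ φ : Plane → ℝ, ContDiff ℝ ∞ φ →
      ∫⁻ s in Set.Icc 0 1, ‖φ (P.edgePt i s)‖ₑ ^ 2 ≤ C * (P.normSq φ + P.gradSq φ) by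
    obtain ⟨C, hC⟩ := h
    exact ⟨C, fun φ hφ => (lintegral_mono_set Set.Ioc_subset_Icc_self).trans (hC φ hφ)⟩
  refine (isCompact_Icc (a := (0 : ℝ)) (b := 1)).induction_on (p := fun A => ∃ C : ℝ≥0,
    ∀ φ : Plane → ℝ, ContDiff ℝ ∞ φ →
      ∫⁻ s in A, ‖φ (P.edgePt i s)‖ₑ ^ 2 ≤ C * (P.normSq φ + P.gradSq φ)) ⟨0, by simp⟩ ?_ ?_ ?_
  · rintro s t hst ⟨C, hC⟩
    exact ⟨C, fun φ hφ => (lintegral_mono_set hst).trans (hC φ hφ)⟩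
  · rintro s t ⟨C, hC⟩ ⟨D, hD⟩
    refine ⟨C + D, fun φ hφ => (lintegral_union_le _ s t).trans ?_⟩
    rw [ENNReal.coe_add, add_mul]
    exact add_le_add (hC φ hφ) (hD φ hφ)
  · intro σ hσ
    obtain ⟨c, d, hcd, r, hr, h⟩ := P.exists_translation_closure (P.edgePt_mem_closure i hσ)
    set e := P.vertex (i + 1) - P.vertex i with he
    -- some positive combination of `c` and `d` is transversal to the edge
    obtain ⟨k, hk1, hk2, hke⟩ : ∃ k : ℝ, 0 < k ∧ k ≤ 2 ∧ cross e (c + k • d) ≠ 0 := by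
      by_cases h1 : cross e (c + (1 : ℝ) • d) = 0
      · refine ⟨2, by norm_num, le_rfl, fun h2 => ?_⟩
        rw [cross_add_right, cross_smul_right] at h1 h2
        have hd : cross e d = 0 := by linarith
        have hc : cross e c = 0 := by linarith
        obtain ⟨t, rfl⟩ := exists_eq_smul_of_cross_eq_zero (sub_ne_zero.2 (P.vertex_ne i)) hd
        obtain ⟨t', rfl⟩ := exists_eq_smul_of_cross_eq_zero (sub_ne_zero.2 (P.vertex_ne i)) hc
        exact hcd (by rw [cross_smul_left, cross_smul_right, cross_same, mul_zero, mul_zero])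
      · exact ⟨1, one_pos, by norm_num, h1⟩
    obtain ⟨C, hC⟩ := exists_lintegral_parallelogram_le hke
    have hev := ((P.continuous_edgePt i).tendsto σ).eventually h
    obtain ⟨η, hη, hball⟩ := Metric.eventually_nhds_iff_ball.1 hev
    set M : ℝ≥0 := 1 + Real.toNNReal (‖c + k • d‖ ^ 2) with hM
    have hr2 : 0 < r / 2 := by positivity
    refine ⟨Metric.ball σ η ∩ Set.Icc 0 1, inter_mem (mem_nhdsWithin_of_mem_nhds
      (Metric.ball_mem_nhds σ hη)) self_mem_nhdsWithin,
      Real.toNNReal (1 / (r / 2) + 1) * (C * M), fun φ hφ => ?_⟩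
    have m : ∀ {f : Plane → ℝ}, ContDiff ℝ ∞ f → Measurable fun y => ‖f y‖ₑ ^ 2 := fun hf =>
      hf.continuous.measurable.enorm.pow_const 2
    have h1 := hC (Metric.ball σ η ∩ Set.Icc 0 1) (Set.Ioo 0 (r / 2))
      (Metric.isOpen_ball.measurableSet.inter measurableSet_Icc) measurableSet_Ioo P.carrier
      P.measurableSet_carrier (P.vertex i) (fun s hs t ht => by
        have := hball s hs.1 (P.edgePt_mem_closure i hs.2) t (t * k) ht.1 (by linarith [ht.2])
          (mul_pos ht.1 hk1) (by nlinarith [ht.1, ht.2])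
        rw [P.edgePt_eq] at this
        rw [smul_add, smul_smul, ← add_assoc]
        exact this)
      (fun y => ‖φ y‖ₑ ^ 2 + ‖dirDeriv (c + k • d) φ y‖ₑ ^ 2)
      ((m hφ).add (m (contDiff_dirDeriv hφ _)))
    calc ∫⁻ s in Metric.ball σ η ∩ Set.Icc 0 1, ‖φ (P.edgePt i s)‖ₑ ^ 2
        ≤ ∫⁻ s in Metric.ball σ η ∩ Set.Icc 0 1, ENNReal.ofReal (1 / (r / 2) + 1) *
          ∫⁻ t in Set.Ioo 0 (r / 2), (‖φ (P.vertex i + s • e + t • (c + k • d))‖ₑ ^ 2 +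
            ‖dirDeriv (c + k • d) φ (P.vertex i + s • e + t • (c + k • d))‖ₑ ^ 2) := by
          refine lintegral_mono fun s => ?_
          simp only
          rw [P.edgePt_eq]
          exact enorm_sq_le_lintegral_line hφ _ _ hr2
      _ ≤ ENNReal.ofReal (1 / (r / 2) + 1) * (C * ∫⁻ y in P.carrier,
          (‖φ y‖ₑ ^ 2 + ‖dirDeriv (c + k • d) φ y‖ₑ ^ 2)) := by
          rw [lintegral_const_mul' _ _ ENNReal.ofReal_ne_top]
          gcongr
      _ ≤ _ := by
          rw [ENNReal.coe_mul, ENNReal.coe_mul, mul_assoc, mul_assoc]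
          gcongr
          · rfl
          rw [← P.lintegral_sum_pd hφ, normSq, ← lintegral_add_left (m hφ),
            ← lintegral_const_mul' _ _ ENNReal.coe_ne_top]
          refine lintegral_mono fun y => ?_
          have h2 := enorm_dirDeriv_sq_le (c + k • d) φ y
          have hMc : (M : ℝ≥0∞) = 1 + ENNReal.ofReal (‖c + k • d‖ ^ 2) := by
            rw [hM]; push_cast; rfl
          rw [hMc]
          set X := ‖φ y‖ₑ ^ 2
          set Y := ∑ i, ‖pd i φ y‖ₑ ^ 2
          set γ := ENNReal.ofReal (‖c + k • d‖ ^ 2)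
          calc _ ≤ X + γ * Y := by gcongr
            _ ≤ X + γ * Y + (γ * X + Y) := le_self_add
            _ = _ := by ring

end PlanePolygon

/-! ### The Poincaré inequality -/

/-- The Cauchy-Schwarz inequality for the increment of a function. -/
theorem sq_sub_le_integral_of_hasDerivAt {g g' : ℝ → ℝ} (hg : ∀ s, HasDerivAt g (g' s) s)
    (hg' : Continuous g') {r : ℝ} (hr : 0 < r) :
    (g r - g 0) ^ 2 ≤ r * ∫ s in (0 : ℝ)..r, g' s ^ 2 := by
  have hi := intervalIntegral.integral_eq_sub_of_hasDerivAt (fun s _ => hg s)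
    (hg'.intervalIntegrable 0 r)
  set c := (g r - g 0) / r with hc
  have h0 : 0 ≤ ∫ s in (0 : ℝ)..r, (g' s - c) ^ 2 :=
    intervalIntegral.integral_nonneg hr.le fun s _ => sq_nonneg _
  have e : ∫ s in (0 : ℝ)..r, (g' s - c) ^ 2 =
      (∫ s in (0 : ℝ)..r, g' s ^ 2) - 2 * c * (∫ s in (0 : ℝ)..r, g' s) + r * c ^ 2 := by
    have : (fun s => (g' s - c) ^ 2) = fun s => (g' s ^ 2 - 2 * c * g' s) + c ^ 2 := by
      ext s; ring
    rw [this, intervalIntegral.integral_add (Continuous.intervalIntegrable (by fun_prop) _ _)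
      (Continuous.intervalIntegrable (by fun_prop) _ _),
      intervalIntegral.integral_sub (Continuous.intervalIntegrable (by fun_prop) _ _)
      (Continuous.intervalIntegrable (by fun_prop) _ _),
      intervalIntegral.integral_const_mul, intervalIntegral.integral_const]
    simp
  rw [e, hi] at h0
  have hcr : g r - g 0 = r * c := by rw [hc]; field_simp
  rw [hcr] at h0 ⊢
  nlinarith

theorem enorm_sub_sq_le_lintegral_line {φ : Plane → ℝ} (h : ContDiff ℝ ∞ φ) (x c : Plane) {r : ℝ}
    (hr : 0 < r) :
    ‖φ x - φ (x + r • c)‖ₑ ^ 2 ≤ ENNReal.ofReal r *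
      ∫⁻ s in Set.Ioo 0 r, ‖dirDeriv c φ (x + s • c)‖ₑ ^ 2 := by
  have hc : Continuous fun s : ℝ => dirDeriv c φ (x + s • c) :=
    (contDiff_dirDeriv h c).continuous.comp (by fun_prop)
  have := sq_sub_le_integral_of_hasDerivAt (hasDerivAt_comp_line h x c) hc hr
  rw [zero_smul, add_zero] at this
  rw [enorm_sq_eq_ofReal, ← neg_sub, neg_sq]
  refine (ENNReal.ofReal_le_ofReal this).trans ?_
  rw [ENNReal.ofReal_mul hr.le,
    ofReal_intervalIntegral_eq_lintegral (by fun_prop) (fun s => by positivity) hr.le]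
  simp only [enorm_sq_eq_ofReal, le_refl]

theorem enorm_sub_sq_le_two (a b c : ℝ) :
    ‖a - c‖ₑ ^ 2 ≤ 2 * (‖a - b‖ₑ ^ 2 + ‖b - c‖ₑ ^ 2) := by
  have := enorm_add_sq_le (a - b) (b - c)
  rwa [sub_add_sub_cancel] at this

/-- A homothety with ratio at least `1 / 2` increases integrals over the plane at most fourfold. -/
theorem lintegral_homothety_le {K : Set Plane} (hK : MeasurableSet K) {F : Plane → ℝ≥0∞}
    (hF : Measurable F) {A : Set Plane} (hA : MeasurableSet A) {t : ℝ} (ht : t ≤ 1 / 2) (y : Plane)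
    (h : ∀ x ∈ A, x + t • (y - x) ∈ K) :
    ∫⁻ x in A, F (x + t • (y - x)) ≤ 4 * ∫⁻ x in K, F x := by
  have hFK : Measurable (K.indicator F) := hF.indicator hK
  have hr : (1 - t) ≠ 0 := by linarith
  calc ∫⁻ x in A, F (x + t • (y - x)) ≤ ∫⁻ x in A, K.indicator F (t • y + (1 - t) • x) := by
        refine setLIntegral_mono' hA fun x hx => ?_
        have e : t • y + (1 - t) • x = x + t • (y - x) := by
          rw [smul_sub, sub_smul, one_smul]; abel
        rw [e, Set.indicator_of_mem (h x hx)]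
    _ ≤ ∫⁻ x, K.indicator F (t • y + (1 - t) • x) := setLIntegral_le_lintegral _ _
    _ = ∫⁻ x, K.indicator F (t • y + x) ∂(Measure.map ((1 - t) • ·) (volume : Measure Plane)) :=
        (lintegral_map (f := fun x => K.indicator F (t • y + x)) (hFK.comp (by fun_prop))
          (by fun_prop)).symm
    _ = ENNReal.ofReal |((1 - t) ^ 2)⁻¹| * ∫⁻ x in K, F x := by
        rw [Measure.map_addHaar_smul _ hr, lintegral_smul_measure,
          lintegral_add_left_eq_self (μ := volume) (K.indicator F), lintegral_indicator hK]
        simp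
    _ ≤ _ := by
        gcongr
        rw [show (4 : ℝ≥0∞) = ENNReal.ofReal 4 by simp]
        apply ENNReal.ofReal_le_ofReal
        rw [abs_of_pos (by positivity), inv_le_comm₀ (by positivity) (by norm_num)]
        nlinarith

namespace PlanePolygon

variable {n : ℕ} (P : PlanePolygon n)

theorem volume_ne_top : volume P.carrier ≠ ⊤ := P.isBounded.measure_lt_top.ne

/-- The mean square difference of the values on `A` and on `B` of a smooth function is controlled
by its Dirichlet integral on `K`. -/
def Linked (A B : Set Plane) : Prop := ∃ C : ℝ≥0, ∀ φ : Plane → ℝ, ContDiff ℝ ∞ φ →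
  ∫⁻ x in A, ∫⁻ y in B, ‖φ x - φ y‖ₑ ^ 2 ≤ C * P.gradSq φ

variable {P}

theorem Linked.mono {A B A' B' : Set Plane} (h : P.Linked A B) (hA : A' ⊆ A) (hB : B' ⊆ B) :
    P.Linked A' B' := by
  obtain ⟨C, hC⟩ := h
  refine ⟨C, fun φ hφ => le_trans ?_ (hC φ hφ)⟩
  exact (lintegral_mono_set hA).trans (lintegral_mono fun x => lintegral_mono_set hB)

theorem measurable_enorm_sub_sq {φ : Plane → ℝ} (hφ : ContDiff ℝ ∞ φ) :
    Measurable fun p : Plane × Plane => ‖φ p.1 - φ p.2‖ₑ ^ 2 :=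
  (((hφ.continuous.comp continuous_fst).sub
    (hφ.continuous.comp continuous_snd)).measurable.enorm.pow_const 2)

theorem Linked.symm {A B : Set Plane} (h : P.Linked A B) : P.Linked B A := by
  obtain ⟨C, hC⟩ := h
  refine ⟨C, fun φ hφ => le_trans (le_of_eq ?_) (hC φ hφ)⟩
  rw [lintegral_lintegral_swap (measurable_enorm_sub_sq hφ).aemeasurable]
  simp only [enorm_sub_rev]

theorem Linked.union {A A' B : Set Plane} (h : P.Linked A B) (h' : P.Linked A' B) :
    P.Linked (A ∪ A') B := by
  obtain ⟨C, hC⟩ := h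
  obtain ⟨D, hD⟩ := h'
  refine ⟨C + D, fun φ hφ => (lintegral_union_le _ A A').trans ?_⟩
  rw [ENNReal.coe_add, add_mul]
  exact add_le_add (hC φ hφ) (hD φ hφ)

theorem Linked.trans {A B D : Set Plane} (h : P.Linked A B) (h' : P.Linked B D)
    (hA : A ⊆ P.carrier) (hB : B ⊆ P.carrier) (hD : D ⊆ P.carrier) (hpos : volume B ≠ 0)  :
    P.Linked A D := by
  obtain ⟨C, hC⟩ := h
  obtain ⟨C', hC'⟩ := h'
  have hAf : volume A ≠ ⊤ := measure_ne_top_of_subset hA P.volume_ne_top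
  have hBf : volume B ≠ ⊤ := measure_ne_top_of_subset hB P.volume_ne_top
  have hDf : volume D ≠ ⊤ := measure_ne_top_of_subset hD P.volume_ne_top
  refine ⟨(volume B).toNNReal⁻¹ * (2 * ((volume D).toNNReal * C + (volume A).toNNReal * C')),
    fun φ hφ => ?_⟩
  have hbp : (volume B).toNNReal ≠ 0 := by
    rw [Ne, ENNReal.toNNReal_eq_zero_iff]; tauto
  have m1 : ∀ y, Measurable fun x => ‖φ x - φ y‖ₑ ^ 2 := fun y =>
    (hφ.continuous.sub continuous_const).measurable.enorm.pow_const 2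
  have m2 : ∀ y, Measurable fun x => ‖φ y - φ x‖ₑ ^ 2 := fun y =>
    (continuous_const.sub hφ.continuous).measurable.enorm.pow_const 2
  have key : volume B * ∫⁻ x in A, ∫⁻ z in D, ‖φ x - φ z‖ₑ ^ 2 ≤
      2 * (volume D * (C * P.gradSq φ) + volume A * (C' * P.gradSq φ)) := by
    calc volume B * ∫⁻ x in A, ∫⁻ z in D, ‖φ x - φ z‖ₑ ^ 2
        = ∫⁻ x in A, ∫⁻ z in D, ∫⁻ _ in B, ‖φ x - φ z‖ₑ ^ 2 := by
          rw [← lintegral_const_mul' _ _ hBf]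
          congr 1; ext x
          rw [← lintegral_const_mul' _ _ hBf]
          congr 1; ext z
          rw [setLIntegral_const, mul_comm]
      _ ≤ ∫⁻ x in A, ∫⁻ z in D, ∫⁻ y in B, 2 * (‖φ x - φ y‖ₑ ^ 2 + ‖φ y - φ z‖ₑ ^ 2) := by
          gcongr
          exact enorm_sub_sq_le_two _ _ _
      _ = ∫⁻ x in A, ∫⁻ z in D, 2 * ((∫⁻ y in B, ‖φ x - φ y‖ₑ ^ 2) +
            ∫⁻ y in B, ‖φ y - φ z‖ₑ ^ 2) := by
          congr 1; ext x
          congr 1; ext z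
          rw [lintegral_const_mul' _ _ (by simp), lintegral_add_left (m2 x)]
      _ = ∫⁻ x in A, 2 * (volume D * (∫⁻ y in B, ‖φ x - φ y‖ₑ ^ 2) +
            ∫⁻ z in D, ∫⁻ y in B, ‖φ y - φ z‖ₑ ^ 2) := by
          congr 1; ext x
          rw [lintegral_const_mul' _ _ (by simp), lintegral_add_left measurable_const,
            setLIntegral_const, mul_comm (volume D)]
      _ = 2 * (volume D * (∫⁻ x in A, ∫⁻ y in B, ‖φ x - φ y‖ₑ ^ 2) +
            volume A * ∫⁻ z in D, ∫⁻ y in B, ‖φ y - φ z‖ₑ ^ 2) := by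
          rw [lintegral_const_mul' _ _ (by simp), lintegral_add_right _ measurable_const,
            setLIntegral_const, lintegral_const_mul' _ _ hDf, mul_comm (volume A)]
      _ ≤ _ := by
          gcongr
          · exact hC φ hφ
          · rw [lintegral_lintegral_swap
              (f := fun z y => ‖φ y - φ z‖ₑ ^ 2)
              ((measurable_enorm_sub_sq hφ).comp measurable_swap).aemeasurable]
            exact hC' φ hφ
  have e : ((((volume B).toNNReal⁻¹ * (2 * ((volume D).toNNReal * C +
      (volume A).toNNReal * C')) : ℝ≥0)) : ℝ≥0∞) * P.gradSq φ =
      (volume B)⁻¹ * (2 * (volume D * (C * P.gradSq φ) + volume A * (C' * P.gradSq φ))) := by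
    rw [ENNReal.coe_mul, ENNReal.coe_inv hbp, ENNReal.coe_toNNReal hBf]
    push_cast
    rw [ENNReal.coe_toNNReal hDf, ENNReal.coe_toNNReal hAf]
    ring
  rw [e, ← ENNReal.div_eq_inv_mul, ENNReal.le_div_iff_mul_le (Or.inl hpos) (Or.inl hBf), mul_comm]
  exact key

/-- The difference between the value at `x` and that at the midpoint of `x` and `y` is an integral
of the gradient at points `x + t • (y - x)` with `t ≤ 1 / 2`; for fixed `y` and `t` these depend on
`x` through a homothety with ratio at least `1 / 2`. -/
theorem linked_aux {A B : Set Plane} (hA : MeasurableSet A) (hB : MeasurableSet B)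
    (h : ∀ x ∈ A, ∀ y ∈ B, segment ℝ x y ⊆ P.carrier) : ∃ C : ℝ≥0, ∀ φ : Plane → ℝ,
    ContDiff ℝ ∞ φ →
    ∫⁻ x in A, ∫⁻ y in B, ‖φ x - φ (x + (1 / 2 : ℝ) • (y - x))‖ₑ ^ 2 ≤ C * P.gradSq φ := by
  obtain ⟨D, hD⟩ := P.isBounded.exists_norm_le
  by_cases hAne : A.Nonempty
  swap
  · rw [Set.not_nonempty_iff_eq_empty] at hAne
    exact ⟨0, by simp [hAne]⟩
  have hBK : B ⊆ P.carrier := fun y hy =>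
    h _ hAne.some_mem y hy (right_mem_segment _ _ _)
  have hBf : volume B ≠ ⊤ := measure_ne_top_of_subset hBK P.volume_ne_top
  refine ⟨Real.toNNReal (1 / 2) * (Real.toNNReal ((2 * D) ^ 2) *
    ((volume B).toNNReal * (Real.toNNReal (1 / 2) * 4))), fun φ hφ => ?_⟩
  set ψ : Plane → ℝ≥0∞ := fun y => ∑ i, ‖pd i φ y‖ₑ ^ 2 with hψ
  have hψm : Measurable ψ := Finset.measurable_fun_sum _ fun i _ =>
    (contDiff_pd hφ i).continuous.measurable.enorm.pow_const 2
  have hseg : ∀ x ∈ A, ∀ y ∈ B, ∀ t ∈ Set.Ioo (0 : ℝ) (1 / 2), x + t • (y - x) ∈ P.carrier := by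
    intro x hx y hy t ht
    apply h x hx y hy
    rw [segment_eq_image']
    exact ⟨t, ⟨ht.1.le, by linarith [ht.2]⟩, rfl⟩
  calc ∫⁻ x in A, ∫⁻ y in B, ‖φ x - φ (x + (1 / 2 : ℝ) • (y - x))‖ₑ ^ 2
      ≤ ∫⁻ x in A, ∫⁻ y in B, ENNReal.ofReal (1 / 2) * (ENNReal.ofReal ((2 * D) ^ 2) *
          ∫⁻ t in Set.Ioo (0 : ℝ) (1 / 2), ψ (x + t • (y - x))) := by
        refine setLIntegral_mono' hA fun x hx => setLIntegral_mono' hB fun y hy => ?_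
        refine (enorm_sub_sq_le_lintegral_line hφ x (y - x) one_half_pos).trans ?_
        gcongr
        rw [← lintegral_const_mul' _ _ ENNReal.ofReal_ne_top]
        refine lintegral_mono fun t => (enorm_dirDeriv_sq_le _ _ _).trans ?_
        gcongr
        have h1 := hD y (hBK hy)
        have h2 := hD x (h x hx y hy (left_mem_segment _ _ _))
        linarith [norm_sub_le y x]
    _ = ENNReal.ofReal (1 / 2) * (ENNReal.ofReal ((2 * D) ^ 2) *
          ∫⁻ x in A, ∫⁻ y in B, ∫⁻ t in Set.Ioo (0 : ℝ) (1 / 2), ψ (x + t • (y - x))) := by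
        rw [← lintegral_const_mul' _ _ ENNReal.ofReal_ne_top,
          ← lintegral_const_mul' _ _ ENNReal.ofReal_ne_top]
        congr 1; ext x
        rw [← lintegral_const_mul' _ _ ENNReal.ofReal_ne_top,
          ← lintegral_const_mul' _ _ ENNReal.ofReal_ne_top]
    _ = ENNReal.ofReal (1 / 2) * (ENNReal.ofReal ((2 * D) ^ 2) *
          ∫⁻ y in B, ∫⁻ t in Set.Ioo (0 : ℝ) (1 / 2), ∫⁻ x in A, ψ (x + t • (y - x))) := by
        congr 2
        rw [lintegral_lintegral_swap]
        · congr 1; ext y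
          rw [lintegral_lintegral_swap]
          exact (hψm.comp (by fun_prop)).aemeasurable
        · refine Measurable.aemeasurable ?_
          exact Measurable.lintegral_prod_right' (f := fun q : (Plane × Plane) × ℝ =>
            ψ (q.1.1 + q.2 • (q.1.2 - q.1.1))) (hψm.comp (by fun_prop))
    _ ≤ ENNReal.ofReal (1 / 2) * (ENNReal.ofReal ((2 * D) ^ 2) *
          ∫⁻ y in B, ∫⁻ t in Set.Ioo (0 : ℝ) (1 / 2), 4 * P.gradSq φ) := by
        gcongr ENNReal.ofReal (1 / 2) * (ENNReal.ofReal ((2 * D) ^ 2) * ?_)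
        refine setLIntegral_mono' hB fun y hy => setLIntegral_mono' measurableSet_Ioo
          fun t ht => ?_
        refine (lintegral_homothety_le P.measurableSet_carrier hψm hA ht.2.le y
          fun x hx => hseg x hx y hy t ht).trans (le_of_eq ?_)
        rw [hψ, P.lintegral_sum_pd hφ]
    _ = _ := by
        rw [setLIntegral_const, setLIntegral_const, Real.volume_Ioo, sub_zero]
        push_cast
        rw [ENNReal.coe_toNNReal hBf]
        simp only [ENNReal.ofReal]
        ring

/-- Each segment is cut at its midpoint, so that both halves are images under homotheties with ratio
at least `1 / 2` with respect to their far end. -/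
theorem linked_of_segment {A B : Set Plane} (hA : MeasurableSet A) (hB : MeasurableSet B)
    (h : ∀ x ∈ A, ∀ y ∈ B, segment ℝ x y ⊆ P.carrier) : P.Linked A B := by
  obtain ⟨C, hC⟩ := linked_aux hA hB h
  obtain ⟨D, hD⟩ := linked_aux hB hA fun y hy x hx => segment_symm ℝ x y ▸ h x hx y hy
  refine ⟨2 * (C + D), fun φ hφ => ?_⟩
  have m1 : Measurable fun p : Plane × Plane =>
      ‖φ p.1 - φ (p.1 + (1 / 2 : ℝ) • (p.2 - p.1))‖ₑ ^ 2 := by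
    refine Measurable.pow_const (Continuous.measurable ?_).enorm 2
    exact (hφ.continuous.comp continuous_fst).sub (hφ.continuous.comp (by fun_prop))
  calc ∫⁻ x in A, ∫⁻ y in B, ‖φ x - φ y‖ₑ ^ 2
      ≤ ∫⁻ x in A, ∫⁻ y in B, 2 * (‖φ x - φ (x + (1 / 2 : ℝ) • (y - x))‖ₑ ^ 2 +
          ‖φ y - φ (y + (1 / 2 : ℝ) • (x - y))‖ₑ ^ 2) := by
        gcongr with x y
        refine (enorm_sub_sq_le_two _ (φ (x + (1 / 2 : ℝ) • (y - x))) _).trans ?_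
        have e : y + (1 / 2 : ℝ) • (x - y) = x + (1 / 2 : ℝ) • (y - x) := by
          ext i; simp; ring
        rw [e, enorm_sub_rev _ (φ y)]
    _ = 2 * ((∫⁻ x in A, ∫⁻ y in B, ‖φ x - φ (x + (1 / 2 : ℝ) • (y - x))‖ₑ ^ 2) +
          ∫⁻ y in B, ∫⁻ x in A, ‖φ y - φ (y + (1 / 2 : ℝ) • (x - y))‖ₑ ^ 2) := by
        rw [lintegral_lintegral_swap (μ := volume.restrict B)
          (f := fun y x => ‖φ y - φ (y + (1 / 2 : ℝ) • (x - y))‖ₑ ^ 2) m1.aemeasurable,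
          ← lintegral_add_left (m1.lintegral_prod_right'), ← lintegral_const_mul' _ _ (by simp)]
        congr 1; ext x
        have m2 : Measurable fun y => ‖φ x - φ (x + (1 / 2 : ℝ) • (y - x))‖ₑ ^ 2 :=
          m1.comp (measurable_prodMk_left (x := x))
        rw [← lintegral_add_left m2, ← lintegral_const_mul' _ _ (by simp)]
    _ ≤ 2 * (C * P.gradSq φ + D * P.gradSq φ) := by
        gcongr
        · exact hC φ hφ
        · exact hD φ hφ
    _ = _ := by push_cast; ring

/-- Neighbourhoods of any two points of `K` are linked, as `K` is connected. -/
theorem exists_nhds_linked {x y : Plane} (hx : x ∈ P.carrier) (hy : y ∈ P.carrier) :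
    ∃ U ∈ 𝓝 x, ∃ V ∈ 𝓝 y, P.Linked (U ∩ P.carrier) (V ∩ P.carrier) := by
  refine P.isConnected.isPreconnected.induction₂
    (fun x y => ∃ U ∈ 𝓝 x, ∃ V ∈ 𝓝 y, P.Linked (U ∩ P.carrier) (V ∩ P.carrier)) ?_ ?_ ?_ hx hy
  · intro x hx
    obtain ⟨ρ, hρ, hb⟩ := Metric.isOpen_iff.1 P.isOpen x hx
    refine mem_nhdsWithin_of_mem_nhds ?_
    filter_upwards [Metric.ball_mem_nhds x hρ] with y hy
    refine ⟨_, Metric.ball_mem_nhds x hρ, _, Metric.isOpen_ball.mem_nhds hy, ?_⟩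
    have hm : MeasurableSet (Metric.ball x ρ ∩ P.carrier) :=
      Metric.isOpen_ball.measurableSet.inter P.measurableSet_carrier
    exact linked_of_segment hm hm fun a ha b hb' =>
      ((convex_ball x ρ).segment_subset ha.1 hb'.1).trans hb
  · rintro x y z hx hy hz ⟨U, hU, V, hV, h⟩ ⟨V', hV', W, hW, h'⟩
    refine ⟨U, hU, W, hW, Linked.trans (B := V ∩ V' ∩ P.carrier)
      (h.mono subset_rfl ?_) (h'.mono ?_ subset_rfl) Set.inter_subset_right
      Set.inter_subset_right Set.inter_subset_right ?_⟩
    · exact Set.inter_subset_inter_left _ Set.inter_subset_left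
    · exact Set.inter_subset_inter_left _ Set.inter_subset_right
    · exact (Measure.measure_pos_of_mem_nhds volume (inter_mem (inter_mem hV hV')
        (P.isOpen.mem_nhds hy))).ne'
  · rintro x y hx hy ⟨U, hU, V, hV, h⟩
    exact ⟨V, hV, U, hU, h.symm⟩

/-- Near each point of its closure, `K` is star-shaped with respect to all points of some
nonempty open set. -/
theorem exists_star_center {z : Plane} (hz : z ∈ closure P.carrier) :
    ∃ U ∈ 𝓝 z, ∃ B : Set Plane, IsOpen U ∧ IsOpen B ∧ (B ∩ P.carrier).Nonempty ∧
      ∀ x ∈ U ∩ P.carrier, ∀ y ∈ B, segment ℝ x y ⊆ P.carrier := by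
  obtain ⟨c, d, hcd, r, hr, h⟩ := P.exists_translation hz
  obtain ⟨ρ, hρ, hball⟩ := Metric.eventually_nhds_iff_ball.1 h
  have c1 : Continuous fun y => cross (y - z) d / cross c d := by unfold cross; fun_prop
  have c2 : Continuous fun y => cross c (y - z) / cross c d := by unfold cross; fun_prop
  set U : Set Plane := (Metric.ball z ρ ∩ (fun y => cross (y - z) d / cross c d) ⁻¹'
    Set.Ioo (-(r / 3)) (r / 3)) ∩ (fun y => cross c (y - z) / cross c d) ⁻¹'
    Set.Ioo (-(r / 3)) (r / 3) with hU
  set B : Set Plane := (fun y => cross (y - z) d / cross c d) ⁻¹' Set.Ioo (r / 3) (2 * r / 3) ∩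
    (fun y => cross c (y - z) / cross c d) ⁻¹' Set.Ioo (r / 3) (2 * r / 3) with hB
  have hUo : IsOpen U := (Metric.isOpen_ball.inter (isOpen_Ioo.preimage c1)).inter
    (isOpen_Ioo.preimage c2)
  have hBo : IsOpen B := (isOpen_Ioo.preimage c1).inter (isOpen_Ioo.preimage c2)
  have hUz : U ∈ 𝓝 z := hUo.mem_nhds (by
    refine ⟨⟨Metric.mem_ball_self hρ, ?_⟩, ?_⟩ <;>
    simp [cross_zero_left, cross_zero_right, hr])
  have hseg : ∀ x ∈ U ∩ P.carrier, ∀ y ∈ B, segment ℝ x y ⊆ P.carrier := by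
    rintro x ⟨⟨⟨hx0, hx1⟩, hx2⟩, hxK⟩ y ⟨hy1, hy2⟩ w hw
    simp only [Set.mem_preimage, Set.mem_Ioo] at hx1 hx2 hy1 hy2
    rw [segment_eq_image'] at hw
    obtain ⟨t, ⟨ht0, ht1⟩, rfl⟩ := hw
    rcases ht0.eq_or_lt with rfl | ht0
    · simpa using hxK
    have e : y - x = ((cross (y - z) d - cross (x - z) d) / cross c d) • c +
        ((cross c (y - z) - cross c (x - z)) / cross c d) • d := by
      have h0 := cross_smul_eq c d (y - x)
      have e1 : cross (y - x) d = cross (y - z) d - cross (x - z) d := by simp [cross]; ring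
      have e2 : cross c (y - x) = cross c (y - z) - cross c (x - z) := by simp [cross]; ring
      rw [← e1, ← e2, div_eq_inv_mul, div_eq_inv_mul, mul_smul, mul_smul, ← smul_add, ← h0,
        smul_smul, inv_mul_cancel₀ hcd, one_smul]
    simp only [e, smul_add, smul_smul, ← add_assoc]
    apply hball x hx0 hxK
    all_goals rw [sub_div]
    · exact mul_pos ht0 (by linarith)
    · nlinarith
    · exact mul_pos ht0 (by linarith)
    · nlinarith
  refine ⟨U, hUz, B, hUo, hBo, ?_, hseg⟩
  obtain ⟨x, hxU, hxK⟩ := mem_closure_iff_nhds.1 hz U hUz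
  refine ⟨z + (r / 2) • c + (r / 2) • d, ?_, ?_⟩
  · have e1 : cross (z + (r / 2) • c + (r / 2) • d - z) d = r / 2 * cross c d := by
      simp [cross]; ring
    have e2 : cross c (z + (r / 2) • c + (r / 2) • d - z) = r / 2 * cross c d := by
      simp [cross]; ring
    constructor
    · simp only [Set.mem_preimage, e1, mul_div_cancel_right₀ _ hcd]
      constructor <;> linarith
    · simp only [Set.mem_preimage, e2, mul_div_cancel_right₀ _ hcd]
      constructor <;> linarith
  · have e1 : cross (z + (r / 2) • c + (r / 2) • d - z) d = r / 2 * cross c d := by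
      simp [cross]; ring
    have e2 : cross c (z + (r / 2) • c + (r / 2) • d - z) = r / 2 * cross c d := by
      simp [cross]; ring
    refine hseg x ⟨hxU, hxK⟩ (z + (r / 2) • c + (r / 2) • d) ?_ (right_mem_segment _ _ _)
    constructor
    · simp only [Set.mem_preimage, e1, mul_div_cancel_right₀ _ hcd]
      constructor <;> linarith
    · simp only [Set.mem_preimage, e2, mul_div_cancel_right₀ _ hcd]
      constructor <;> linarith

/-- By compactness finitely many star-shaped pieces cover `K`, and all of them are linked to the
neighbourhood of one point. -/
theorem linked_carrier : P.Linked P.carrier P.carrier := by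
  obtain ⟨x₀, hx₀⟩ := P.isConnected.nonempty
  have hK : IsCompact (closure P.carrier) := P.isBounded.isCompact_closure
  obtain ⟨W, hW, h⟩ : ∃ W ∈ 𝓝 x₀, P.Linked (closure P.carrier ∩ P.carrier) (W ∩ P.carrier) := by
    refine hK.induction_on (p := fun s => ∃ W ∈ 𝓝 x₀, P.Linked (s ∩ P.carrier) (W ∩ P.carrier))
      ⟨Set.univ, univ_mem, 0, by simp⟩ ?_ ?_ ?_
    · rintro s t hst ⟨W, hW, h⟩
      exact ⟨W, hW, h.mono (Set.inter_subset_inter_left _ hst) subset_rfl⟩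
    · rintro s t ⟨W, hW, h⟩ ⟨W', hW', h'⟩
      refine ⟨W ∩ W', inter_mem hW hW', ?_⟩
      rw [Set.union_inter_distrib_right]
      exact (h.mono subset_rfl (Set.inter_subset_inter_left _ Set.inter_subset_left)).union
        (h'.mono subset_rfl (Set.inter_subset_inter_left _ Set.inter_subset_right))
    · intro z hz
      obtain ⟨U, hU, B, hUo, hBo, ⟨y, hyB, hyK⟩, hseg⟩ := exists_star_center hz
      obtain ⟨V, hV, W, hW, h⟩ := exists_nhds_linked hyK hx₀
      refine ⟨U, mem_nhdsWithin_of_mem_nhds hU, W, hW, ?_⟩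
      have h1 : P.Linked (U ∩ P.carrier) B :=
        linked_of_segment (hUo.measurableSet.inter P.measurableSet_carrier) hBo.measurableSet hseg
      refine Linked.trans (B := B ∩ V ∩ P.carrier) (h1.mono subset_rfl ?_)
        (h.mono ?_ subset_rfl) Set.inter_subset_right Set.inter_subset_right
        Set.inter_subset_right ?_
      · exact Set.inter_subset_left.trans Set.inter_subset_left
      · exact Set.inter_subset_inter_left _ Set.inter_subset_right
      · exact (Measure.measure_pos_of_mem_nhds volume (inter_mem (inter_mem (hBo.mem_nhds hyB) hV)
          (P.isOpen.mem_nhds hyK))).ne'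
  rw [Set.inter_eq_right.2 subset_closure] at h
  exact Linked.trans (B := W ∩ P.carrier) h h.symm subset_rfl Set.inter_subset_right
    subset_rfl (Measure.measure_pos_of_mem_nhds volume (inter_mem hW (P.isOpen.mem_nhds hx₀))).ne'

variable (P)

/-- The Poincaré inequality. -/
theorem exists_poincare : ∃ C : ℝ≥0, ∀ φ : Plane → ℝ, ContDiff ℝ ∞ φ →
    ∃ m : ℝ, P.normSq (fun x => φ x - m) ≤ C * P.gradSq φ := by
  obtain ⟨C, hC⟩ := P.linked_carrier
  have hpos : volume P.carrier ≠ 0 := (P.isOpen.measure_pos volume P.isConnected.nonempty).ne'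
  refine ⟨(volume P.carrier).toNNReal⁻¹ * C, fun φ hφ => ?_⟩
  obtain ⟨y, -, hy⟩ := exists_le_setLAverage hpos P.volume_ne_top
    (f := fun y => ∫⁻ x in P.carrier, ‖φ y - φ x‖ₑ ^ 2)
    ((measurable_enorm_sub_sq hφ).lintegral_prod_right').aemeasurable
  refine ⟨φ y, ?_⟩
  rw [normSq]
  simp only [enorm_sub_rev _ (φ y)]
  refine hy.trans ?_
  rw [setLAverage_eq, ENNReal.div_eq_inv_mul, ENNReal.coe_mul, ENNReal.coe_inv (by
    rw [Ne, ENNReal.toNNReal_eq_zero_iff]; have := P.volume_ne_top; tauto),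
    ENNReal.coe_toNNReal P.volume_ne_top, mul_assoc]
  gcongr
  exact hC φ hφ

end PlanePolygon

theorem eLpNorm_two_sq {α : Type*} [MeasurableSpace α] (f : α → ℝ) (μ : Measure α) :
    eLpNorm f 2 μ ^ 2 = ∫⁻ x, ‖f x‖ₑ ^ 2 ∂μ := by
  have h := eLpNorm_nnreal_pow_eq_lintegral (f := f) (μ := μ) (p := 2) (by norm_num)
  have e : ((2 : ℝ≥0) : ℝ) = ((2 : ℕ) : ℝ) := by norm_num
  rw [e] at h
  simp only [ENNReal.rpow_natCast] at h
  simpa using h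

/-! ### Mollification -/

/-- Translations act continuously on `L²`. -/
theorem eventually_eLpNorm_translate_sub_le {f : Plane → ℝ} (hf : MemLp f 2 volume) {ε : ℝ≥0∞}
    (hε : ε ≠ 0) : ∀ᶠ y in 𝓝 (0 : Plane), eLpNorm (fun x => f (x - y) - f x) 2 volume ≤ ε := by
  have hc : Continuous fun y : Plane => DomAddAct.mk (-y) +ᵥ hf.toLp f := by
    have : Continuous fun y : Plane => DomAddAct.mk (-y) :=
      DomAddAct.mkHomeomorph.continuous.comp continuous_neg
    have h2 : Fact ((2 : ℝ≥0∞) ≠ ⊤) := ⟨by norm_num⟩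
    exact this.vadd continuous_const
  have ht := hc.tendsto 0
  have hz : DomAddAct.mk (-(0 : Plane)) +ᵥ hf.toLp f = hf.toLp f := by
    rw [neg_zero]; exact zero_vadd _ _
  rw [hz] at ht
  filter_upwards [ht.eventually (Metric.eball_mem_nhds (hf.toLp f) (pos_iff_ne_zero.2 hε))] with y hy
  rw [DomAddAct.mk_vadd_toLp] at hy
  change edist _ _ < ε at hy
  rw [Lp.edist_toLp_toLp] at hy
  refine le_trans (le_of_eq ?_) hy.le
  congr 1
  ext x
  simp [sub_eq_neg_add]

/-- Convolution of scalar functions on the plane. -/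
noncomputable def mollify (f ρ : Plane → ℝ) (x : Plane) : ℝ := ∫ y, f y * ρ (x - y)

theorem mollify_eq_convolution (f ρ : Plane → ℝ) :
    mollify f ρ = convolution f ρ (ContinuousLinearMap.mul ℝ ℝ) volume := rfl

theorem contDiff_mollify {f ρ : Plane → ℝ} (hf : LocallyIntegrable f) (hρ : IsTest ρ) :
    ContDiff ℝ ∞ (mollify f ρ) := by
  rw [mollify_eq_convolution]
  exact hρ.compact.contDiff_convolution_right _ hf hρ.smooth

theorem pd_mollify {f ρ : Plane → ℝ} (hf : LocallyIntegrable f) (hρ : IsTest ρ) (i : Fin 2)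
    (x : Plane) : pd i (mollify f ρ) x = mollify f (pd i ρ) x := by
  have hρ1 : ContDiff ℝ 1 ρ := hρ.smooth.of_le (by simp)
  have h := hρ.compact.hasFDerivAt_convolution_right (ContinuousLinearMap.mul ℝ ℝ) hf hρ1 x
  rw [mollify_eq_convolution, mollify_eq_convolution, pd, h.fderiv,
    convolution_precompR_apply _ hf (hρ.compact.fderiv ℝ) (hρ1.continuous_fderiv one_ne_zero)]
  rfl

theorem mollify_eq_swap (f ρ : Plane → ℝ) (x : Plane) :
    mollify f ρ x = ∫ y, f (x - y) * ρ y := by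
  rw [mollify_eq_convolution, convolution_eq_swap]
  rfl

theorem sq_lintegral_le_of_isProbabilityMeasure {α : Type*} [MeasurableSpace α] (μ : Measure α)
    [IsProbabilityMeasure μ] {g : α → ℝ} (hg : AEStronglyMeasurable g μ) :
    (∫⁻ x, ‖g x‖ₑ ∂μ) ^ 2 ≤ ∫⁻ x, ‖g x‖ₑ ^ 2 ∂μ := by
  rw [← eLpNorm_two_sq, ← eLpNorm_one_eq_lintegral_enorm]
  gcongr
  exact eLpNorm_le_eLpNorm_of_exponent_le (by norm_num) hg

/-- Mollification with a probability density moves a function no further than the translations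
by the points of the support of the density. -/
theorem eLpNorm_mollify_sub_le {f ρ : Plane → ℝ} (hf : MemLp f 2 volume) (hfm : Measurable f)
    (hρ : IsTest ρ) (h0 : ∀ y, 0 ≤ ρ y) (h1 : ∫ y, ρ y = 1) {ε : ℝ≥0∞}
    (h : ∀ y, ρ y ≠ 0 → eLpNorm (fun x => f (x - y) - f x) 2 volume ≤ ε) :
    eLpNorm (fun x => mollify f ρ x - f x) 2 volume ≤ ε := by
  have hρm : Measurable fun y => ENNReal.ofReal (ρ y) :=
    hρ.smooth.continuous.measurable.ennreal_ofReal
  have hρi : Integrable ρ := hρ.smooth.continuous.integrable_of_hasCompactSupport hρ.compact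
  set μ : Measure Plane := volume.withDensity fun y => ENNReal.ofReal (ρ y) with hμ
  have hprob : IsProbabilityMeasure μ := by
    refine ⟨?_⟩
    rw [hμ, withDensity_apply _ MeasurableSet.univ, Measure.restrict_univ,
      ← ofReal_integral_eq_lintegral_ofReal hρi (ae_of_all _ h0), h1, ENNReal.ofReal_one]
  have hlf : LocallyIntegrable f := hf.locallyIntegrable (by norm_num)
  have hpt : ∀ x, ‖mollify f ρ x - f x‖ₑ ^ 2 ≤ ∫⁻ y, ‖f (x - y) - f x‖ₑ ^ 2 ∂μ := by
    intro x
    have hm : Measurable fun y => f (x - y) - f x :=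
      (hfm.comp (measurable_const.sub measurable_id)).sub measurable_const
    refine le_trans ?_ (sq_lintegral_le_of_isProbabilityMeasure μ hm.aestronglyMeasurable)
    gcongr
    have hi : Integrable fun y => f (x - y) * ρ y := by
      have := hρ.compact.convolutionExists_right (ContinuousLinearMap.mul ℝ ℝ) hlf
        hρ.smooth.continuous x
      have h2 := this.integrable_swap
      exact h2
    have e : mollify f ρ x - f x = ∫ y, (f (x - y) - f x) * ρ y := by
      simp only [sub_mul]
      rw [integral_sub hi (hρi.const_mul _), integral_const_mul, h1, mul_one, mollify_eq_swap]
    rw [e]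
    refine (enorm_integral_le_lintegral_enorm _).trans (le_of_eq ?_)
    rw [hμ, lintegral_withDensity_eq_lintegral_mul _ hρm hm.enorm]
    congr 1
    ext y
    rw [enorm_mul, mul_comm, Pi.mul_apply, Real.enorm_of_nonneg (h0 y)]
  have hsq : eLpNorm (fun x => mollify f ρ x - f x) 2 volume ^ 2 ≤ ε ^ 2 := by
    rw [eLpNorm_two_sq]
    calc ∫⁻ x, ‖mollify f ρ x - f x‖ₑ ^ 2 ≤ ∫⁻ x, ∫⁻ y, ‖f (x - y) - f x‖ₑ ^ 2 ∂μ :=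
          lintegral_mono hpt
      _ = ∫⁻ y, (∫⁻ x, ‖f (x - y) - f x‖ₑ ^ 2) ∂μ := by
          have hm : Measurable fun q : Plane × Plane => ‖f (q.1 - q.2) - f q.1‖ₑ ^ 2 :=
            ((hfm.comp (measurable_fst.sub measurable_snd)).sub
              (hfm.comp measurable_fst)).enorm.pow_const 2
          exact lintegral_lintegral_swap (μ := (volume : Measure Plane)) (ν := μ)
            (f := fun x y => ‖f (x - y) - f x‖ₑ ^ 2) hm.aemeasurable
      _ = ∫⁻ y, ENNReal.ofReal (ρ y) * eLpNorm (fun x => f (x - y) - f x) 2 volume ^ 2 := by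
          have hm : Measurable fun q : Plane × Plane => ‖f (q.2 - q.1) - f q.2‖ₑ ^ 2 :=
            ((hfm.comp (measurable_snd.sub measurable_fst)).sub
              (hfm.comp measurable_snd)).enorm.pow_const 2
          have hm' : Measurable fun y => ∫⁻ x, ‖f (x - y) - f x‖ₑ ^ 2 :=
            hm.lintegral_prod_right'
          simp only [eLpNorm_two_sq]
          exact lintegral_withDensity_eq_lintegral_mul (volume : Measure Plane) hρm hm'
      _ ≤ ∫⁻ y, ENNReal.ofReal (ρ y) * ε ^ 2 := by
          refine lintegral_mono fun y => ?_
          by_cases hy : ρ y = 0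
          · simp [hy]
          · simp only
            gcongr
            exact h y hy
      _ = ε ^ 2 := by
          rw [lintegral_mul_const _ hρm, ← ofReal_integral_eq_lintegral_ofReal hρi
            (ae_of_all _ h0), h1, ENNReal.ofReal_one, one_mul]
  exact (ENNReal.pow_le_pow_left_iff two_ne_zero).1 hsq

/-- There are smooth probability densities supported in any small piece of an open cone. -/
theorem exists_density {c d : Plane} (hcd : cross c d ≠ 0) {r δ : ℝ} (hr : 0 < r) (hδ : 0 < δ) :
    ∃ ρ : Plane → ℝ, IsTest ρ ∧ (∀ y, 0 ≤ ρ y) ∧ ∫ y, ρ y = 1 ∧ ∀ y ∈ tsupport ρ,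
      y ∈ Metric.ball 0 δ ∧ ∃ α β : ℝ, 0 < α ∧ α < r ∧ 0 < β ∧ β < r ∧ -y = α • c + β • d := by
  have c1 : Continuous fun y => cross (-y) d / cross c d := by unfold cross; fun_prop
  have c2 : Continuous fun y => cross c (-y) / cross c d := by unfold cross; fun_prop
  set S : Set Plane := Metric.ball 0 δ ∩ ((fun y => cross (-y) d / cross c d) ⁻¹' Set.Ioo 0 r ∩
    (fun y => cross c (-y) / cross c d) ⁻¹' Set.Ioo 0 r) with hS
  have hSo : IsOpen S := Metric.isOpen_ball.inter
    ((isOpen_Ioo.preimage c1).inter (isOpen_Ioo.preimage c2))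
  obtain ⟨p, hp⟩ : S.Nonempty := by
    set t := min (r / 2) (δ / (‖c + d‖ + 1)) with ht
    have ht0 : 0 < t := by positivity
    have ht1 : t < r := (min_le_left _ _).trans_lt (by linarith)
    refine ⟨-(t • (c + d)), ?_, ?_, ?_⟩
    · rw [mem_ball_zero_iff, norm_neg, norm_smul, Real.norm_of_nonneg ht0.le]
      calc t * ‖c + d‖ < t * (‖c + d‖ + 1) := by nlinarith
        _ ≤ δ / (‖c + d‖ + 1) * (‖c + d‖ + 1) := by gcongr; exact min_le_right _ _
        _ = δ := by field_simp
    · have : cross (- -(t • (c + d))) d = t * cross c d := by simp [cross]; ring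
      simp only [Set.mem_preimage, this, mul_div_cancel_right₀ _ hcd]
      exact ⟨ht0, ht1⟩
    · have : cross c (- -(t • (c + d))) = t * cross c d := by simp [cross]; ring
      simp only [Set.mem_preimage, this, mul_div_cancel_right₀ _ hcd]
      exact ⟨ht0, ht1⟩
  obtain ⟨η, hη, hball⟩ := Metric.isOpen_iff.1 hSo p hp
  let b : ContDiffBump p := ⟨η / 4, η / 2, by positivity, by linarith⟩
  refine ⟨b.normed volume, ⟨b.contDiff_normed, b.hasCompactSupport_normed⟩, b.nonneg_normed,
    b.integral_normed, fun y hy => ?_⟩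
  rw [b.tsupport_normed_eq] at hy
  obtain ⟨h1, h2, h3⟩ := hball (Metric.closedBall_subset_ball (by simp [b, hη]) hy)
  refine ⟨h1, _, _, h2.1, h2.2, h3.1, h3.2, ?_⟩
  change -y = (cross (-y) d / cross c d) • c + (cross c (-y) / cross c d) • d
  rw [div_eq_inv_mul, div_eq_inv_mul, mul_smul, mul_smul, ← smul_add, ← cross_smul_eq, smul_smul,
    inv_mul_cancel₀ hcd, one_smul]

/-! ### Weak derivatives -/

/-- The index set of the derivatives of order at most two: the function itself, the two first
derivatives and the four second derivatives. -/
abbrev JetIndex : Type := Unit ⊕ Fin 2 ⊕ (Fin 2 × Fin 2)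

/-- The derivative with a given index; `(i, j)` stands for `∂_j ∂_i`. -/
noncomputable def jetDeriv : JetIndex → (Plane → ℝ) → Plane → ℝ
  | .inl _, φ => φ
  | .inr (.inl i), φ => pd i φ
  | .inr (.inr (i, j)), φ => pd j (pd i φ)

theorem contDiff_jetDeriv {φ : Plane → ℝ} (h : ContDiff ℝ ∞ φ) (k : JetIndex) :
    ContDiff ℝ ∞ (jetDeriv k φ) := by
  rcases k with _ | i | ⟨i, j⟩
  · exact h
  · exact contDiff_pd h i
  · exact contDiff_pd (contDiff_pd h i) j

namespace PlanePolygon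

variable {n : ℕ} (P : PlanePolygon n)

/-- `g` is the weak derivative of `f` in `K` in the `i`-th coordinate direction. -/
def WeakDeriv (i : Fin 2) (f g : Plane → ℝ) : Prop :=
  ∀ φ : Plane → ℝ, IsTest φ → tsupport φ ⊆ P.carrier →
    ∫ x, f x * pd i φ x ∂P.vol = -∫ x, g x * φ x ∂P.vol

/-- A family of functions that are the weak derivatives of order at most two of the first. -/
structure WeakJet (f : JetIndex → Plane → ℝ) : Prop where
  memLp : ∀ k, MemLp (f k) 2 P.vol
  grad : ∀ i, P.WeakDeriv i (f (.inl ())) (f (.inr (.inl i)))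
  hess : ∀ i j, P.WeakDeriv j (f (.inr (.inl i))) (f (.inr (.inr (i, j))))

theorem pd_comp_sub {ρ : Plane → ℝ} (hρ : ContDiff ℝ ∞ ρ) (i : Fin 2) (x y : Plane) :
    pd i (fun y => ρ (x - y)) y = -pd i ρ (x - y) := by
  have h1 : HasFDerivAt (fun y : Plane => x - y) (-ContinuousLinearMap.id ℝ Plane) y :=
    (hasFDerivAt_id y).const_sub x
  have h2 := (hρ.differentiable (by simp) (x - y)).hasFDerivAt.comp y h1
  unfold pd
  rw [show (fun y => ρ (x - y)) = ρ ∘ fun y => x - y from rfl, h2.fderiv]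
  simp

theorem integral_indicator_mul (f g : Plane → ℝ) :
    ∫ y, P.carrier.indicator f y * g y = ∫ y in P.carrier, f y * g y := by
  rw [← integral_indicator P.measurableSet_carrier]
  congr 1
  ext y
  by_cases hy : y ∈ P.carrier <;> simp [hy]

variable {P} in
/-- Mollification commutes with weak differentiation as long as the mollifier does not leave
`K`. -/
theorem WeakDeriv.pd_mollify_eq {i : Fin 2} {f g : Plane → ℝ} (h : P.WeakDeriv i f g)
    (hf : LocallyIntegrable (P.carrier.indicator f)) {ρ : Plane → ℝ} (hρ : IsTest ρ) {x : Plane}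
    (hx : ∀ y ∈ tsupport ρ, x - y ∈ P.carrier) :
    pd i (mollify (P.carrier.indicator f) ρ) x = mollify (P.carrier.indicator g) ρ x := by
  have hψ : IsTest fun y => ρ (x - y) :=
    ⟨hρ.smooth.comp (contDiff_const.sub contDiff_id),
      hρ.compact.comp_homeomorph (Homeomorph.subLeft x)⟩
  have hsupp : tsupport (fun y => ρ (x - y)) ⊆ P.carrier := by
    intro y hy
    have : x - y ∈ tsupport ρ := by
      have := tsupport_comp_subset_preimage ρ (f := fun y : Plane => x - y) (by fun_prop) hy
      exact this
    simpa using hx _ this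
  have e := h _ hψ hsupp
  simp only [pd_comp_sub hρ.smooth, mul_neg, integral_neg, neg_inj] at e
  rw [pd_mollify hf hρ, mollify, mollify, P.integral_indicator_mul, P.integral_indicator_mul]
  exact e

theorem mollify_eq_zero_of_forall {f ρ : Plane → ℝ} {x : Plane}
    (h : ∀ y, ρ (x - y) ≠ 0 → f y = 0) : mollify f ρ x = 0 := by
  rw [mollify]
  have : (fun y => f y * ρ (x - y)) = 0 := by
    ext y
    by_cases hy : ρ (x - y) = 0
    · simp [hy]
    · simp [h y hy]
  rw [this]; simp

/-- Near every point of the closure of `K`, functions in `H²(K)` with small support are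
approximated by smooth functions: shift the function inwards while mollifying it. -/
theorem exists_local_approx {z : Plane} (hz : z ∈ closure P.carrier) :
    ∃ U ∈ 𝓝 z, ∀ f : JetIndex → Plane → ℝ, (∀ k, Measurable (f k)) → P.WeakJet f →
      (∃ S : Set Plane, IsCompact S ∧ S ⊆ U ∧ ∀ k, ∀ x ∉ S, f k x = 0) →
      ∀ ε : ℝ≥0∞, ε ≠ 0 → ∃ φ : Plane → ℝ, ContDiff ℝ ∞ φ ∧
        ∀ k, eLpNorm (fun x => jetDeriv k φ x - f k x) 2 P.vol ≤ ε := by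
  obtain ⟨c, d, hcd, r, hr, h⟩ := P.exists_translation hz
  obtain ⟨ρ₀, hρ₀, hball⟩ := Metric.eventually_nhds_iff_ball.1 h
  refine ⟨Metric.ball z ρ₀, Metric.ball_mem_nhds z hρ₀, ?_⟩
  rintro f hfm hf ⟨S, hS, hSU, hSf⟩ ε hε
  obtain ⟨δ₁, hδ₁, hδS⟩ := hS.exists_cthickening_subset_open Metric.isOpen_ball hSU
  have hF : ∀ k, MemLp (P.carrier.indicator (f k)) 2 volume := fun k =>
    (memLp_indicator_iff_restrict P.measurableSet_carrier).2 (hf.memLp k)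
  have hFl : ∀ k, LocallyIntegrable (P.carrier.indicator (f k)) := fun k =>
    (hF k).locallyIntegrable (by norm_num)
  have hev : ∀ᶠ y in 𝓝 (0 : Plane), ∀ k, eLpNorm (fun x => P.carrier.indicator (f k) (x - y) -
      P.carrier.indicator (f k) x) 2 volume ≤ ε :=
    eventually_all.2 fun k => eventually_eLpNorm_translate_sub_le (hF k) hε
  obtain ⟨δ₂, hδ₂, hball₂⟩ := Metric.eventually_nhds_iff_ball.1 hev
  obtain ⟨ρ, hρ, hρ0, hρ1, hsupp⟩ := exists_density hcd hr (lt_min hδ₁ hδ₂)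
  have hsmooth : ∀ k, ContDiff ℝ ∞ (mollify (P.carrier.indicator (f k)) ρ) := fun k =>
    contDiff_mollify (hFl k) hρ
  -- where the supports of the mollified functions lie
  have hzero : ∀ x ∉ Metric.cthickening δ₁ S, ∀ k,
      mollify (P.carrier.indicator (f k)) ρ x = 0 := by
    intro x hx k
    refine mollify_eq_zero_of_forall fun y hy => ?_
    have hy' := (hsupp _ (subset_tsupport _ hy)).1
    have hyS : y ∉ S := by
      intro hyS
      apply hx
      refine Metric.mem_cthickening_of_dist_le x y δ₁ S hyS ?_
      rw [mem_ball_zero_iff] at hy'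
      rw [dist_eq_norm]
      exact (hy'.trans_le (min_le_left _ _)).le
    simp [hSf k y hyS]
  have hpd : ∀ (i : Fin 2) (k l : JetIndex), P.WeakDeriv i (f k) (f l) → ∀ x ∈ P.carrier,
      pd i (mollify (P.carrier.indicator (f k)) ρ) x =
        mollify (P.carrier.indicator (f l)) ρ x := by
    intro i k l hkl x hx
    by_cases hxU : x ∈ Metric.ball z ρ₀
    · refine hkl.pd_mollify_eq (hFl k) hρ fun y hy => ?_
      obtain ⟨α, β, h1, h2, h3, h4, h5⟩ := (hsupp y hy).2
      rw [sub_eq_add_neg, h5, ← add_assoc]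
      exact hball x hxU hx α β h1 h2 h3 h4
    · have hx' : x ∉ Metric.cthickening δ₁ S := fun h => hxU (hδS h)
      have he : mollify (P.carrier.indicator (f k)) ρ =ᶠ[𝓝 x] fun _ => 0 := by
        filter_upwards [Metric.isClosed_cthickening.isOpen_compl.mem_nhds hx'] with y hy
        exact hzero y hy k
      rw [hzero x hx' l, pd, he.fderiv_eq]
      simp
  have hjet : ∀ k, ∀ x ∈ P.carrier,
      jetDeriv k (mollify (P.carrier.indicator (f (.inl ()))) ρ) x =
        mollify (P.carrier.indicator (f k)) ρ x := by
    rintro (k | i | ⟨i, j⟩) x hx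
    · rfl
    · exact hpd i _ _ (hf.grad i) x hx
    · have he : pd i (mollify (P.carrier.indicator (f (.inl ()))) ρ) =ᶠ[𝓝 x]
          mollify (P.carrier.indicator (f (.inr (.inl i)))) ρ := by
        filter_upwards [P.isOpen.mem_nhds hx] with y hy
        exact hpd i _ _ (hf.grad i) y hy
      rw [← hpd j _ _ (hf.hess i j) x hx]
      change fderiv ℝ _ x _ = fderiv ℝ _ x _
      rw [he.fderiv_eq]
  refine ⟨mollify (P.carrier.indicator (f (.inl ()))) ρ, hsmooth _, fun k => ?_⟩
  have hk := eLpNorm_mollify_sub_le (hF k) ((hfm k).indicator P.measurableSet_carrier) hρ hρ0 hρ1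
    (ε := ε) fun y hy => by
      refine hball₂ y ?_ k
      exact Metric.ball_subset_ball (min_le_right _ _) (hsupp y (subset_tsupport _ hy)).1
  refine le_trans (le_of_eq_of_le (eLpNorm_congr_ae ?_)
    (eLpNorm_mono_measure _ Measure.restrict_le_self)) hk
  filter_upwards [ae_restrict_mem P.measurableSet_carrier] with x hx
  rw [hjet k x hx, Set.indicator_of_mem hx]

end PlanePolygon

/-! ### Test functions -/

/-- Smooth cut-off functions. -/
theorem exists_test_one {S O : Set Plane} (hS : IsCompact S) (hO : IsOpen O) (h : S ⊆ O) :
    ∃ χ : Plane → ℝ, IsTest χ ∧ (∀ᶠ x in 𝓝ˢ S, χ x = 1) ∧ tsupport χ ⊆ O ∧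
      ∀ x, χ x ∈ Set.Icc (0 : ℝ) 1 := by
  obtain ⟨L, hL, hSL, hLO⟩ := exists_compact_between hS hO h
  obtain ⟨f, hf1, hf0, hf⟩ := exists_contMDiffMap_one_nhds_of_subset_interior
    (modelWithCornersSelf ℝ Plane) (n := (⊤ : ℕ∞)) hS.isClosed hSL
  have hsupp : tsupport f ⊆ L := closure_minimal (fun x hx => by
    by_contra h; exact hx (hf0 x h)) hL.isClosed
  exact ⟨f, ⟨f.contMDiff.contDiff, HasCompactSupport.of_support_subset_isCompact hL
    ((subset_tsupport f).trans hsupp)⟩, hf1, hsupp.trans hLO, hf⟩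

theorem pd_add {φ ψ : Plane → ℝ} (hφ : ContDiff ℝ ∞ φ) (hψ : ContDiff ℝ ∞ ψ) (i : Fin 2) :
    pd i (φ + ψ) = pd i φ + pd i ψ := by
  ext x
  simp only [pd, Pi.add_apply]
  rw [fderiv_add (hφ.differentiable (by simp) x) (hψ.differentiable (by simp) x)]
  rfl

theorem pd_smul {φ : Plane → ℝ} (hφ : ContDiff ℝ ∞ φ) (c : ℝ) (i : Fin 2) :
    pd i (c • φ) = c • pd i φ := by
  ext x
  simp only [pd, Pi.smul_apply]
  rw [fderiv_const_smul (hφ.differentiable (by simp) x)]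
  rfl

theorem pd_mul {φ ψ : Plane → ℝ} (hφ : ContDiff ℝ ∞ φ) (hψ : ContDiff ℝ ∞ ψ) (i : Fin 2)
    (x : Plane) : pd i (φ * ψ) x = φ x * pd i ψ x + pd i φ x * ψ x := by
  simp only [pd]
  rw [fderiv_mul (hφ.differentiable (by simp) x) (hψ.differentiable (by simp) x)]
  simp [mul_comm]

theorem jetDeriv_add {φ ψ : Plane → ℝ} (hφ : ContDiff ℝ ∞ φ) (hψ : ContDiff ℝ ∞ ψ)
    (k : JetIndex) : jetDeriv k (φ + ψ) = jetDeriv k φ + jetDeriv k ψ := by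
  rcases k with _ | i | ⟨i, j⟩
  · rfl
  · exact pd_add hφ hψ i
  · simp only [jetDeriv]
    rw [pd_add hφ hψ, pd_add (contDiff_pd hφ i) (contDiff_pd hψ i)]

theorem jetDeriv_smul {φ : Plane → ℝ} (hφ : ContDiff ℝ ∞ φ) (c : ℝ) (k : JetIndex) :
    jetDeriv k (c • φ) = c • jetDeriv k φ := by
  rcases k with _ | i | ⟨i, j⟩
  · rfl
  · exact pd_smul hφ c i
  · simp only [jetDeriv]
    rw [pd_smul hφ, pd_smul (contDiff_pd hφ i)]

theorem pd_eq_zero_of_notMem_tsupport {φ : Plane → ℝ} {x : Plane} (hx : x ∉ tsupport φ)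
    (i : Fin 2) : pd i φ x = 0 := by
  have : φ =ᶠ[𝓝 x] fun _ => 0 := notMem_tsupport_iff_eventuallyEq.1 hx
  simp [pd, this.fderiv_eq]

theorem tsupport_pd_subset (φ : Plane → ℝ) (i : Fin 2) : tsupport (pd i φ) ⊆ tsupport φ :=
  closure_minimal (fun _ hx => by
    by_contra h; exact hx (pd_eq_zero_of_notMem_tsupport h i)) (isClosed_tsupport φ)

theorem jetDeriv_eq_zero_of_notMem_tsupport {φ : Plane → ℝ} {x : Plane} (hx : x ∉ tsupport φ)
    (k : JetIndex) : jetDeriv k φ x = 0 := by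
  rcases k with _ | i | ⟨i, j⟩
  · exact image_eq_zero_of_notMem_tsupport hx
  · exact pd_eq_zero_of_notMem_tsupport hx i
  · exact pd_eq_zero_of_notMem_tsupport (fun h => hx (tsupport_pd_subset φ i h)) j

theorem IsTest.add {φ ψ : Plane → ℝ} (hφ : IsTest φ) (hψ : IsTest ψ) : IsTest (φ + ψ) :=
  ⟨hφ.smooth.add hψ.smooth, hφ.compact.add hψ.compact⟩

theorem IsTest.mul_smooth {φ ψ : Plane → ℝ} (hφ : IsTest φ) (hψ : ContDiff ℝ ∞ ψ) :
    IsTest (φ * ψ) := ⟨hφ.smooth.mul hψ, hφ.compact.mul_right⟩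

theorem isTest_zero : IsTest 0 := ⟨contDiff_const, HasCompactSupport.zero⟩

/-- Localization: a test function lies in a subspace that contains all test functions with small
support. -/
theorem test_induction (N : Submodule ℝ (Plane → ℝ)) {ζ : Plane → ℝ} (hζ : IsTest ζ)
    (h : ∀ x ∈ tsupport ζ, ∃ U ∈ 𝓝 x, ∀ η, IsTest η → tsupport η ⊆ U → η ∈ N) : ζ ∈ N := by
  obtain ⟨U, -, hU, hUN⟩ : ∃ U : Set Plane, IsOpen U ∧ tsupport ζ ⊆ U ∧
      ∀ η, IsTest η → tsupport η ⊆ U → η ∈ N := by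
    refine hζ.compact.isCompact.induction_on (p := fun s => ∃ U : Set Plane, IsOpen U ∧ s ⊆ U ∧
      ∀ η, IsTest η → tsupport η ⊆ U → η ∈ N) ?_ ?_ ?_ ?_
    · refine ⟨∅, isOpen_empty, subset_rfl, fun η _ hη => ?_⟩
      rw [Set.subset_empty_iff, tsupport_eq_empty_iff] at hη
      rw [hη]; exact N.zero_mem
    · rintro s t hst ⟨U, hU, htU, h⟩
      exact ⟨U, hU, hst.trans htU, h⟩
    · rintro s t ⟨U, hU, hsU, hUN⟩ ⟨V, hV, htV, hVN⟩
      refine ⟨U ∪ V, hU.union hV, Set.union_subset_union hsU htV, fun η hη hηUV => ?_⟩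
      obtain ⟨χ, hχ, hχ1, hχU, -⟩ := exists_test_one (hη.compact.isCompact.diff hV) hU
        (fun x hx => (hηUV hx.1).resolve_right hx.2)
      have e : η = η * χ + η * (1 - χ) := by ring
      rw [e]
      refine N.add_mem (hUN _ (hη.mul_smooth hχ.smooth) ?_)
        (hVN _ (hη.mul_smooth (contDiff_const.sub hχ.smooth)) ?_)
      · exact (tsupport_mul_subset_right).trans hχU
      · intro x hx
        by_contra hxV
        have hx1 : x ∈ tsupport η := tsupport_mul_subset_left hx
        have hx2 : x ∈ tsupport (1 - χ) := tsupport_mul_subset_right hx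
        have := hχ1.filter_mono (nhds_le_nhdsSet (Set.mem_sdiff_of_mem hx1 hxV))
        refine (notMem_tsupport_iff_eventuallyEq.2 ?_) hx2
        filter_upwards [this] with y hy
        simp [hy]
    · intro x hx
      obtain ⟨U, hU, hUN⟩ := h x hx
      obtain ⟨V, hVU, hV, hxV⟩ := mem_nhds_iff.1 hU
      exact ⟨V, mem_nhdsWithin_of_mem_nhds (hV.mem_nhds hxV), V, hV, subset_rfl,
        fun η hη hηV => hUN η hη (hηV.trans hVU)⟩
  exact hUN ζ hζ hU

/-- The smooth functions on the plane. -/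
def smoothFns : Submodule ℝ (Plane → ℝ) where
  carrier := {φ | ContDiff ℝ ∞ φ}
  zero_mem' := by exact (contDiff_const : ContDiff ℝ ∞ fun _ : Plane => (0 : ℝ))
  add_mem' := by
    intro φ ψ h h'
    exact ContDiff.add (Set.mem_ofPred.1 h) (Set.mem_ofPred.1 h')
  smul_mem' := by
    intro c φ h
    exact contDiff_const.smul (Set.mem_ofPred.1 h)

theorem smoothFns_contDiff (φ : smoothFns) : ContDiff ℝ ∞ (φ : Plane → ℝ) := φ.2

namespace PlanePolygon

variable {n : ℕ} (P : PlanePolygon n)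

instance : IsFiniteMeasure P.vol := ⟨by
  rw [Measure.restrict_apply_univ]; exact P.isBounded.measure_lt_top⟩

theorem exists_forall_norm_le {f : Plane → ℝ} (hf : Continuous f) :
    ∃ C : ℝ, ∀ x ∈ closure P.carrier, ‖f x‖ ≤ C :=
  P.isBounded.isCompact_closure.exists_bound_of_continuousOn hf.continuousOn

theorem memLp_of_continuous {f : Plane → ℝ} (hf : Continuous f) : MemLp f 2 P.vol := by
  obtain ⟨C, hC⟩ := P.exists_forall_norm_le hf
  refine MemLp.of_bound hf.aestronglyMeasurable C ?_
  filter_upwards [ae_restrict_mem P.measurableSet_carrier] with x hx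
  exact hC x (subset_closure hx)

theorem memLp_continuous_mul {f g : Plane → ℝ} (hf : Continuous f) (hg : MemLp g 2 P.vol) :
    MemLp (fun x => f x * g x) 2 P.vol := by
  obtain ⟨C, hC⟩ := P.exists_forall_norm_le hf
  refine MemLp.of_le_mul (c := C) hg (hf.aestronglyMeasurable.mul hg.1) ?_
  filter_upwards [ae_restrict_mem P.measurableSet_carrier] with x hx
  rw [norm_mul]
  gcongr
  exact hC x (subset_closure hx)

theorem integrable_mul_continuous {f g : Plane → ℝ} (hf : MemLp f 2 P.vol) (hg : Continuous g) :
    Integrable (fun x => f x * g x) P.vol :=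
  hf.integrable_mul (q := 2) (P.memLp_of_continuous hg)

variable {P} in
theorem WeakDeriv.add {i : Fin 2} {f g f' g' : Plane → ℝ} (h : P.WeakDeriv i f g)
    (h' : P.WeakDeriv i f' g') (hf : MemLp f 2 P.vol) (hg : MemLp g 2 P.vol)
    (hf' : MemLp f' 2 P.vol) (hg' : MemLp g' 2 P.vol) :
    P.WeakDeriv i (fun x => f x + f' x) (fun x => g x + g' x) := by
  intro φ hφ hs
  simp only [add_mul]
  rw [integral_add (P.integrable_mul_continuous hf (hφ.pd i).smooth.continuous)
    (P.integrable_mul_continuous hf' (hφ.pd i).smooth.continuous),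
    integral_add (P.integrable_mul_continuous hg hφ.smooth.continuous)
    (P.integrable_mul_continuous hg' hφ.smooth.continuous), h φ hφ hs, h' φ hφ hs]
  ring

variable {P} in
theorem WeakDeriv.smooth_mul {i : Fin 2} {f g ζ : Plane → ℝ} (h : P.WeakDeriv i f g)
    (hf : MemLp f 2 P.vol) (hg : MemLp g 2 P.vol) (hζ : ContDiff ℝ ∞ ζ) :
    P.WeakDeriv i (fun x => ζ x * f x) (fun x => ζ x * g x + pd i ζ x * f x) := by
  intro φ hφ hs
  have hζφ : IsTest (φ * ζ) := hφ.mul_smooth hζ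
  have h1 := h _ hζφ (tsupport_mul_subset_left.trans hs)
  have e1 : (fun x => f x * pd i (φ * ζ) x) =
      fun x => f x * (φ x * pd i ζ x) + f x * (pd i φ x * ζ x) := by
    ext x; rw [pd_mul hφ.smooth hζ]; ring
  have c1 : Continuous fun x => φ x * pd i ζ x :=
    hφ.smooth.continuous.mul (contDiff_pd hζ i).continuous
  have c2 : Continuous fun x => pd i φ x * ζ x := (hφ.pd i).smooth.continuous.mul hζ.continuous
  rw [e1, integral_add (P.integrable_mul_continuous hf c1) (P.integrable_mul_continuous hf c2)]
    at h1
  have e2 : (fun x => (ζ x * g x + pd i ζ x * f x) * φ x) =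
      fun x => g x * (φ * ζ) x + f x * (φ x * pd i ζ x) := by
    ext x; simp only [Pi.mul_apply]; ring
  rw [e2, integral_add (P.integrable_mul_continuous hg hζφ.smooth.continuous)
    (P.integrable_mul_continuous hf c1)]
  have e3 : (fun x => ζ x * f x * pd i φ x) = fun x => f x * (pd i φ x * ζ x) := by
    ext x; ring
  rw [e3]
  linarith

/-- The Leibniz rule: the derivatives of the product of a smooth function `ζ` with a function
whose derivatives are `f`. -/
noncomputable def mulJet (ζ : Plane → ℝ) (f : JetIndex → Plane → ℝ) : JetIndex → Plane → ℝ
  | .inl _ => fun x => ζ x * f (.inl ()) x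
  | .inr (.inl i) => fun x => ζ x * f (.inr (.inl i)) x + pd i ζ x * f (.inl ()) x
  | .inr (.inr (i, j)) => fun x =>
      (ζ x * f (.inr (.inr (i, j))) x + pd j ζ x * f (.inr (.inl i)) x) +
        (pd i ζ x * f (.inr (.inl j)) x + pd j (pd i ζ) x * f (.inl ()) x)

variable {P} in
theorem WeakJet.mulJet {f : JetIndex → Plane → ℝ} (hf : P.WeakJet f) {ζ : Plane → ℝ}
    (hζ : ContDiff ℝ ∞ ζ) : P.WeakJet (PlanePolygon.mulJet ζ f) := by
  have m : ∀ {η : Plane → ℝ}, ContDiff ℝ ∞ η → ∀ k, MemLp (fun x => η x * f k x) 2 P.vol :=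
    fun hη k => P.memLp_continuous_mul hη.continuous (hf.memLp k)
  have hζ' := fun i => contDiff_pd hζ i
  have hζ'' := fun i j => contDiff_pd (contDiff_pd hζ i) j
  refine ⟨?_, fun i => ?_, fun i j => ?_⟩
  · rintro (k | i | ⟨i, j⟩)
    · exact m hζ _
    · exact (m hζ _).add (m (hζ' i) _)
    · exact ((m hζ _).add (m (hζ' j) _)).add ((m (hζ' i) _).add (m (hζ'' i j) _))
  · exact (hf.grad i).smooth_mul (hf.memLp _) (hf.memLp _) hζ
  · exact ((hf.hess i j).smooth_mul (hf.memLp _) (hf.memLp _) hζ).add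
      ((hf.grad j).smooth_mul (hf.memLp _) (hf.memLp _) (hζ' i)) (m hζ _)
      ((m hζ _).add (m (hζ' j) _)) (m (hζ' i) _) ((m (hζ' i) _).add (m (hζ'' i j) _))

theorem measurable_mulJet {ζ : Plane → ℝ} (hζ : ContDiff ℝ ∞ ζ) {f : JetIndex → Plane → ℝ}
    (hf : ∀ k, Measurable (f k)) (k : JetIndex) : Measurable (mulJet ζ f k) := by
  have m : ∀ {η : Plane → ℝ}, ContDiff ℝ ∞ η → ∀ k, Measurable (fun x => η x * f k x) :=
    fun hη k => hη.continuous.measurable.mul (hf k)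
  have hζ' := fun i => contDiff_pd hζ i
  rcases k with k | i | ⟨i, j⟩
  · exact m hζ _
  · exact (m hζ _).add (m (hζ' i) _)
  · exact ((m hζ _).add (m (hζ' j) _)).add ((m (hζ' i) _).add (m (contDiff_pd (hζ' i) j) _))

theorem mulJet_eq_zero {ζ : Plane → ℝ} (f : JetIndex → Plane → ℝ) (k : JetIndex) {x : Plane}
    (hx : x ∉ tsupport ζ) : mulJet ζ f k x = 0 := by
  have h0 : ζ x = 0 := image_eq_zero_of_notMem_tsupport hx
  have h1 : ∀ i, pd i ζ x = 0 := pd_eq_zero_of_notMem_tsupport hx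
  have h2 : ∀ i j, pd j (pd i ζ) x = 0 := fun i j =>
    pd_eq_zero_of_notMem_tsupport (fun h => hx (tsupport_pd_subset ζ i h)) j
  rcases k with k | i | ⟨i, j⟩ <;> simp [mulJet, h0, h1, h2]

theorem mulJet_add {ζ η : Plane → ℝ} (hζ : ContDiff ℝ ∞ ζ) (hη : ContDiff ℝ ∞ η)
    (f : JetIndex → Plane → ℝ) (k : JetIndex) :
    mulJet (ζ + η) f k = mulJet ζ f k + mulJet η f k := by
  ext x
  rcases k with k | i | ⟨i, j⟩ <;>
  simp only [mulJet, Pi.add_apply, pd_add hζ hη, pd_add (contDiff_pd hζ _) (contDiff_pd hη _)] <;>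
  ring

theorem mulJet_smul {ζ : Plane → ℝ} (hζ : ContDiff ℝ ∞ ζ) (c : ℝ)
    (f : JetIndex → Plane → ℝ) (k : JetIndex) :
    mulJet (c • ζ) f k = c • mulJet ζ f k := by
  ext x
  rcases k with k | i | ⟨i, j⟩ <;>
  simp only [mulJet, Pi.smul_apply, pd_smul hζ, pd_smul (contDiff_pd hζ _), smul_eq_mul] <;>
  ring

theorem mulJet_of_eventually_one {ζ : Plane → ℝ} {x : Plane} (h : ∀ᶠ y in 𝓝 x, ζ y = 1)
    (f : JetIndex → Plane → ℝ) (k : JetIndex) : mulJet ζ f k x = f k x := by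
  have h0 : ζ x = 1 := h.self_of_nhds
  have h1 : ∀ i, ∀ᶠ y in 𝓝 x, pd i ζ y = 0 := by
    intro i
    filter_upwards [h.eventually_nhds] with y hy
    have : ζ =ᶠ[𝓝 y] fun _ => 1 := hy
    simp [pd, this.fderiv_eq]
  have h2 : ∀ i j, pd j (pd i ζ) x = 0 := by
    intro i j
    have : pd i ζ =ᶠ[𝓝 x] fun _ => 0 := h1 i
    rw [pd, this.fderiv_eq]
    simp
  have h1' : ∀ i, pd i ζ x = 0 := fun i => (h1 i).self_of_nhds
  rcases k with k | i | ⟨i, j⟩ <;> simp [mulJet, h0, h1', h2]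

/-! ### The Sobolev space `H²(K)` -/

/-- Families of square integrable functions on `K`, one for each derivative of order at most
two. -/
abbrev JetSpace : Type := PiLp 2 fun _ : JetIndex => P.L2

/-- The class in `L²(K)` of a continuous function on the plane. -/
noncomputable def ofCont {f : Plane → ℝ} (hf : Continuous f) : P.L2 :=
  (P.memLp_of_continuous hf).toLp f

theorem coeFn_ofCont {f : Plane → ℝ} (hf : Continuous f) : P.ofCont hf =ᵐ[P.vol] f :=
  MemLp.coeFn_toLp _

/-- The derivatives of order at most two of a smooth function. -/
noncomputable def jet : smoothFns →ₗ[ℝ] P.JetSpace where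
  toFun φ := WithLp.toLp 2 fun k => P.ofCont (contDiff_jetDeriv (smoothFns_contDiff φ) k).continuous
  map_add' φ ψ := by
    ext1 k
    have c := fun χ : smoothFns => P.memLp_of_continuous
      (contDiff_jetDeriv (smoothFns_contDiff χ) k).continuous
    refine Eq.trans ?_ (MemLp.toLp_add (c φ) (c ψ))
    exact MemLp.toLp_congr (c (φ + ψ)) ((c φ).add (c ψ))
      (ae_of_all _ fun x => congrFun (jetDeriv_add φ.2 ψ.2 k) x)
  map_smul' c φ := by
    ext1 k
    have m := fun χ : smoothFns => P.memLp_of_continuous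
      (contDiff_jetDeriv (smoothFns_contDiff χ) k).continuous
    refine Eq.trans ?_ (MemLp.toLp_const_smul c (m φ))
    exact MemLp.toLp_congr (m (c • φ)) ((m φ).const_smul c)
      (ae_of_all _ fun x => congrFun (jetDeriv_smul φ.2 c k) x)

theorem coeFn_jet (φ : smoothFns) (k : JetIndex) : P.jet φ k =ᵐ[P.vol] jetDeriv k φ :=
  P.coeFn_ofCont (contDiff_jetDeriv (smoothFns_contDiff φ) k).continuous

/-- `H²(K)`, as the space of the weak derivatives of its members: the closure of the smooth
functions. -/
noncomputable def sobolev : Submodule ℝ P.JetSpace := (LinearMap.range P.jet).topologicalClosure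

theorem jet_mem_sobolev (φ : smoothFns) : P.jet φ ∈ P.sobolev :=
  Submodule.le_topologicalClosure _ ⟨φ, rfl⟩

theorem isClosed_sobolev : IsClosed (P.sobolev : Set P.JetSpace) :=
  Submodule.isClosed_topologicalClosure _

theorem tendsto_jetSpace_iff {ι : Type*} {l : Filter ι} {V : ι → P.JetSpace} {W : P.JetSpace} :
    Tendsto V l (𝓝 W) ↔
      ∀ k, Tendsto (fun m => eLpNorm (fun x => V m k x - W k x) 2 P.vol) l (𝓝 0) := by
  have h : Tendsto V l (𝓝 W) ↔ ∀ k, Tendsto (fun m => V m k) l (𝓝 (W k)) := by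
    constructor
    · intro h k
      exact ((PiLp.continuous_apply 2 _ k).tendsto W).comp h
    · intro h
      have h2 : Tendsto (fun m => WithLp.ofLp (V m)) l (𝓝 (WithLp.ofLp W)) := tendsto_pi_nhds.2 h
      exact ((PiLp.continuous_toLp 2 (fun _ : JetIndex => P.L2)).tendsto _).comp h2
  rw [h]
  exact forall_congr' fun k => Lp.tendsto_Lp_iff_tendsto_eLpNorm' _ _

theorem eq_zero_on_of_tsupport_subset_compl {η : Plane → ℝ}
    (hη : tsupport η ⊆ (closure P.carrier)ᶜ) (f : JetIndex → Plane → ℝ) (k : JetIndex) :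
    ∀ᵐ x ∂P.vol, mulJet η f k x = 0 := by
  filter_upwards [ae_restrict_mem P.measurableSet_carrier] with x hx
  exact mulJet_eq_zero f k fun h => hη h (subset_closure hx)

/-- Density of the smooth functions in `H²(K)`. -/
theorem mem_sobolev_of_weakJet {U : P.JetSpace} (hU : P.WeakJet fun k => U k) :
    U ∈ P.sobolev := by
  set f : JetIndex → Plane → ℝ := fun k => U k with hf
  have hfm : ∀ k, Measurable (f k) := fun k => (Lp.stronglyMeasurable (U k)).measurable
  let N : Submodule ℝ (Plane → ℝ) :=
    { carrier := {ζ | ContDiff ℝ ∞ ζ ∧ ∃ V ∈ P.sobolev, ∀ k, V k =ᵐ[P.vol] mulJet ζ f k}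
      zero_mem' := by
        refine ⟨contDiff_const, 0, P.sobolev.zero_mem, fun k => ?_⟩
        filter_upwards [Lp.coeFn_zero ℝ 2 P.vol] with x hx
        rw [mulJet_eq_zero f k (by simp [tsupport_eq_empty_iff.2 rfl])]
        exact hx
      add_mem' := by
        rintro ζ η ⟨hζ, V, hV, hVζ⟩ ⟨hη, W, hW, hWη⟩
        refine ⟨hζ.add hη, V + W, P.sobolev.add_mem hV hW, fun k => ?_⟩
        rw [mulJet_add hζ hη]
        exact (Lp.coeFn_add _ _).trans ((hVζ k).add (hWη k))
      smul_mem' := by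
        rintro c ζ ⟨hζ, V, hV, hVζ⟩
        refine ⟨contDiff_const.smul hζ, c • V, P.sobolev.smul_mem c hV, fun k => ?_⟩
        rw [mulJet_smul hζ]
        exact (Lp.coeFn_smul _ _).trans ((hVζ k).const_smul c) }
  obtain ⟨χ, hχ, hχ1, -, -⟩ := exists_test_one P.isBounded.isCompact_closure isOpen_univ
    (Set.subset_univ (closure P.carrier))
  have hmem : χ ∈ N := by
    refine test_induction N hχ fun x _ => ?_
    by_cases hx : x ∈ closure P.carrier
    · obtain ⟨O, hO, h⟩ := P.exists_local_approx hx
      refine ⟨O, hO, fun η hη hηO => ⟨hη.smooth, ?_⟩⟩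
      have hw : P.WeakJet (mulJet η f) := hU.mulJet hη.smooth
      have happ := h (mulJet η f) (measurable_mulJet hη.smooth hfm) hw
        ⟨tsupport η, hη.compact.isCompact, hηO, fun k x hx => mulJet_eq_zero f k hx⟩
      choose φ hφ hφk using fun m : ℕ => happ ((m : ℝ≥0∞) + 1)⁻¹ (by simp)
      refine ⟨WithLp.toLp 2 fun k => (hw.memLp k).toLp (mulJet η f k), ?_, fun k => MemLp.coeFn_toLp (hw.memLp k)⟩
      refine P.isClosed_sobolev.mem_of_tendsto (b := atTop)
        (f := fun m => P.jet ⟨φ m, hφ m⟩) ?_ (Eventually.of_forall fun m => P.jet_mem_sobolev _)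
      rw [tendsto_jetSpace_iff]
      intro k
      refine tendsto_of_tendsto_of_tendsto_of_le_of_le tendsto_const_nhds
        (h := fun m : ℕ => ((m : ℝ≥0∞) + 1)⁻¹) ?_ (fun m => zero_le) fun m => ?_
      · have := (tendsto_add_atTop_iff_nat (f := fun m : ℕ => ((m : ℝ≥0∞))⁻¹) 1).2
          ENNReal.tendsto_inv_nat_nhds_zero
        simpa using this
      · refine le_trans (le_of_eq (eLpNorm_congr_ae ?_)) (hφk m k)
        filter_upwards [P.coeFn_jet ⟨φ m, hφ m⟩ k, MemLp.coeFn_toLp (hw.memLp k)] with x h1 h2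
        have h3 : ((WithLp.toLp 2 fun k => (hw.memLp k).toLp (mulJet η f k) : P.JetSpace) k) x =
          mulJet η f k x := h2
        rw [h1, h3]
    · refine ⟨(closure P.carrier)ᶜ, isClosed_closure.isOpen_compl.mem_nhds hx, fun η hη hηO =>
        ⟨hη.smooth, 0, P.sobolev.zero_mem, fun k => ?_⟩⟩
      filter_upwards [Lp.coeFn_zero ℝ 2 P.vol, P.eq_zero_on_of_tsupport_subset_compl hηO f k]
        with x h1 h2
      rw [h2]
      exact h1
  obtain ⟨-, V, hV, hVf⟩ := hmem
  have : V = U := by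
    ext1 k
    refine Lp.ext ((hVf k).trans ?_)
    filter_upwards [ae_restrict_mem P.measurableSet_carrier] with x hx
    exact mulJet_of_eventually_one
      (hχ1.filter_mono (nhds_le_nhdsSet (subset_closure hx))) f k
  exact this ▸ hV

theorem weakDeriv_of_smooth {φ : Plane → ℝ} (hφ : ContDiff ℝ ∞ φ) (i : Fin 2) :
    P.WeakDeriv i φ (pd i φ) := by
  intro ψ hψ hs
  have h0 : ∀ f : Plane → ℝ, (∀ x ∉ tsupport ψ, f x = 0) → ∫ x, f x ∂P.vol = ∫ x, f x := by
    intro f hf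
    exact setIntegral_eq_integral_of_forall_compl_eq_zero fun x hx => hf x fun h => hx (hs h)
  rw [h0 _ fun x hx => by rw [pd_eq_zero_of_notMem_tsupport hx, mul_zero],
    h0 _ fun x hx => by rw [image_eq_zero_of_notMem_tsupport hx, mul_zero]]
  refine integral_mul_fderiv_eq_neg_fderiv_mul_of_integrable ?_ ?_ ?_
    (fun x _ => hφ.differentiable (by simp) x) (fun x _ => hψ.smooth.differentiable (by simp) x)
  · exact ((contDiff_pd hφ i).continuous.mul hψ.smooth.continuous).integrable_of_hasCompactSupport
      hψ.compact.mul_left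
  · exact (hφ.continuous.mul (hψ.pd i).smooth.continuous).integrable_of_hasCompactSupport
      (hψ.pd i).compact.mul_left
  · exact (hφ.continuous.mul hψ.smooth.continuous).integrable_of_hasCompactSupport
      hψ.compact.mul_left

theorem integral_mul_eq_inner (u : P.L2) {f : Plane → ℝ} (hf : Continuous f) :
    ∫ x, u x * f x ∂P.vol = inner ℝ (P.ofCont hf) u := by
  rw [L2.inner_def]
  refine integral_congr_ae ?_
  filter_upwards [P.coeFn_ofCont hf] with x hx
  rw [hx]
  simp [mul_comm]

/-- Weak derivatives pass to limits in `L²(K)`. -/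
theorem weakJet_of_mem_sobolev {U : P.JetSpace} (hU : U ∈ P.sobolev) :
    P.WeakJet fun k => U k := by
  have key : ∀ (i : Fin 2) (k l : JetIndex), (∀ φ, jetDeriv l φ = pd i (jetDeriv k φ)) →
      P.WeakDeriv i (U k) (U l) := by
    intro i k l hkl ψ hψ hs
    rw [P.integral_mul_eq_inner _ (hψ.pd i).smooth.continuous,
      P.integral_mul_eq_inner _ hψ.smooth.continuous]
    have hcl : IsClosed {V : P.JetSpace | inner ℝ (P.ofCont (hψ.pd i).smooth.continuous) (V k) =
        -inner ℝ (P.ofCont hψ.smooth.continuous) (V l)} := by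
      apply isClosed_eq
      · exact continuous_const.inner (PiLp.continuous_apply 2 _ k)
      · exact (continuous_const.inner (PiLp.continuous_apply 2 _ l)).neg
    refine (closure_minimal ?_ hcl) hU
    rintro _ ⟨φ, rfl⟩
    have := P.weakDeriv_of_smooth (contDiff_jetDeriv (smoothFns_contDiff φ) k) i ψ hψ hs
    rw [← hkl] at this
    have e1 : ∫ x, P.jet φ k x * pd i ψ x ∂P.vol = ∫ x, jetDeriv k φ x * pd i ψ x ∂P.vol := by
      refine integral_congr_ae ?_
      filter_upwards [P.coeFn_jet φ k] with x hx
      rw [hx]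
    have e2 : ∫ x, P.jet φ l x * ψ x ∂P.vol = ∫ x, jetDeriv l φ x * ψ x ∂P.vol := by
      refine integral_congr_ae ?_
      filter_upwards [P.coeFn_jet φ l] with x hx
      rw [hx]
    rw [Set.mem_ofPred_eq, ← P.integral_mul_eq_inner, ← P.integral_mul_eq_inner, e1, e2]
    exact this
  exact ⟨fun _ => Lp.memLp _, fun i => key i _ _ fun φ => rfl, fun i j => key j _ _ fun φ => rfl⟩

/-- A function in `L²(K)` has at most one weak derivative in each direction. -/
theorem weakDeriv_unique {i : Fin 2} {f : Plane → ℝ} {u v : P.L2} (hu : P.WeakDeriv i f u)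
    (hv : P.WeakDeriv i f v) : u = v := by
  have h0 : ∀ᵐ x, x ∈ P.carrier → u x - v x = 0 := by
    have hloc : LocallyIntegrableOn (fun x => u x - v x) P.carrier := by
      have h1 : Integrable (fun x => u x - v x) P.vol :=
        ((Lp.memLp u).sub (Lp.memLp v)).integrable (by norm_num)
      exact IntegrableOn.locallyIntegrableOn h1
    refine P.isOpen.ae_eq_zero_of_integral_contDiff_smul_eq_zero hloc fun φ hφ hc hs => ?_
    have ht : IsTest φ := ⟨hφ, hc⟩
    have h1 : ∫ x, φ x • (u x - v x) = ∫ x, φ x • (u x - v x) ∂P.vol :=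
      (setIntegral_eq_integral_of_forall_compl_eq_zero fun x hx => by
        rw [image_eq_zero_of_notMem_tsupport fun h => hx (hs h), zero_smul]).symm
    have h2 : (fun x => φ x • (u x - v x)) = fun x => u x * φ x - v x * φ x := by
      ext x; simp only [smul_eq_mul]; ring
    rw [h1, h2, integral_sub (P.integrable_mul u ht) (P.integrable_mul v ht)]
    have := (hu φ ht hs).symm.trans (hv φ ht hs)
    linarith
  refine Lp.ext ?_
  have := (ae_restrict_iff' P.measurableSet_carrier).2 h0
  filter_upwards [this] with x hx
  linarith

/-- The member of the jet space with given components. -/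
noncomputable def mkJet (u : P.L2) (G : Fin 2 → P.L2) (H : Fin 2 → Fin 2 → P.L2) : P.JetSpace :=
  WithLp.toLp 2 fun
    | .inl _ => u
    | .inr (.inl i) => G i
    | .inr (.inr (i, j)) => H i j

theorem mkJet_mem_sobolev {u : P.L2} {G : Fin 2 → P.L2} {H : Fin 2 → Fin 2 → P.L2}
    (h : P.HasWeakHessian u G H) : P.mkJet u G H ∈ P.sobolev :=
  P.mem_sobolev_of_weakJet ⟨fun _ => Lp.memLp _, fun i => h.grad i, fun i j => h.hess i j⟩

theorem hasWeakHessian_of_mem_sobolev {U : P.JetSpace} (hU : U ∈ P.sobolev) :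
    P.HasWeakHessian (U (.inl ())) (fun i => U (.inr (.inl i)))
      (fun i j => U (.inr (.inr (i, j)))) :=
  ⟨(P.weakJet_of_mem_sobolev hU).grad, (P.weakJet_of_mem_sobolev hU).hess⟩

/-- A weakly differentiable function determines its weak derivatives. -/
theorem eq_mkJet {U : P.JetSpace} (hU : U ∈ P.sobolev) {G : Fin 2 → P.L2}
    {H : Fin 2 → Fin 2 → P.L2} (h : P.HasWeakHessian (U (.inl ())) G H) :
    U = P.mkJet (U (.inl ())) G H := by
  have hw := P.weakJet_of_mem_sobolev hU
  have hG : ∀ i, U (.inr (.inl i)) = G i := fun i => P.weakDeriv_unique (hw.grad i) (h.grad i)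
  ext1 k
  rcases k with k | i | ⟨i, j⟩
  · rfl
  · exact hG i
  · refine P.weakDeriv_unique (hw.hess i j) ?_
    rw [hG i]
    exact h.hess i j

theorem ext_of_mem_sobolev {U V : P.JetSpace} (hU : U ∈ P.sobolev) (hV : V ∈ P.sobolev)
    (h : U (.inl ()) = V (.inl ())) : U = V := by
  have h1 := P.hasWeakHessian_of_mem_sobolev hV
  rw [← h] at h1
  have h2 := P.hasWeakHessian_of_mem_sobolev hV
  exact (P.eq_mkJet hU h1).trans (by rw [h]; exact (P.eq_mkJet hV h2).symm)

end PlanePolygon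

/-! ### Traces and degrees of freedom on `H²(K)` -/

theorem norm_le_of_enorm_sq_le {E F : Type*} [SeminormedAddGroup E] [SeminormedAddGroup F] {a : E}
    {b : F} {C : ℝ≥0} (h : ‖a‖ₑ ^ 2 ≤ C * ‖b‖ₑ ^ 2) : ‖a‖ ≤ NNReal.sqrt C * ‖b‖ := by
  have h1 : ‖a‖₊ ^ 2 ≤ C * ‖b‖₊ ^ 2 := by
    simp only [enorm_eq_nnnorm] at h
    exact_mod_cast h
  have h2 : ‖a‖₊ ≤ NNReal.sqrt C * ‖b‖₊ := by
    rw [← pow_le_pow_iff_left₀ zero_le zero_le two_ne_zero]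
    rwa [mul_pow, NNReal.sq_sqrt]
  have h3 := NNReal.coe_le_coe.2 h2
  rwa [NNReal.coe_mul, coe_nnnorm, coe_nnnorm] at h3

theorem enorm_Lp_sq {α : Type*} [MeasurableSpace α] {μ : Measure α} (u : Lp ℝ 2 μ) {f : α → ℝ}
    (h : u =ᵐ[μ] f) : ‖u‖ₑ ^ 2 = ∫⁻ x, ‖f x‖ₑ ^ 2 ∂μ := by
  rw [Lp.enorm_def, eLpNorm_congr_ae h, eLpNorm_two_sq]

/-- Square integrable functions of the affine parameter of an edge. -/
abbrev EdgeL2 : Type := Lp ℝ 2 ((volume : Measure ℝ).restrict (Set.Ioc 0 1))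

theorem memLp_edge (f : C(ℝ, ℝ)) : MemLp f 2 ((volume : Measure ℝ).restrict (Set.Ioc 0 1)) := by
  obtain ⟨C, hC⟩ := (isCompact_Icc (a := (0 : ℝ)) (b := 1)).exists_bound_of_continuousOn
    f.continuous.continuousOn
  refine MemLp.of_bound f.continuous.aestronglyMeasurable C ?_
  filter_upwards [ae_restrict_mem measurableSet_Ioc] with x hx
  exact hC x (Set.Ioc_subset_Icc_self hx)

/-- The class of a continuous function of the affine parameter. -/
noncomputable def toEdgeL2 : C(ℝ, ℝ) →ₗ[ℝ] EdgeL2 where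
  toFun f := (memLp_edge f).toLp f
  map_add' _ _ := rfl
  map_smul' _ _ := rfl

theorem coeFn_toEdgeL2 (f : C(ℝ, ℝ)) :
    toEdgeL2 f =ᵐ[(volume : Measure ℝ).restrict (Set.Ioc 0 1)] f :=
  MemLp.coeFn_toLp (memLp_edge f)

/-- The class of a polynomial in the affine parameter. -/
noncomputable def polyEdge : Polynomial ℝ →ₗ[ℝ] EdgeL2 :=
  toEdgeL2 ∘ₗ
    { toFun := fun q => ⟨fun s => q.eval s, q.continuous⟩
      map_add' := fun p q => by ext s; simp
      map_smul' := fun c q => by ext s; simp }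

theorem inner_polyEdge (u : EdgeL2) {f : ℝ → ℝ}
    (h : u =ᵐ[(volume : Measure ℝ).restrict (Set.Ioc 0 1)] f) (q : Polynomial ℝ) :
    inner ℝ u (polyEdge q) = ∫ s in (0 : ℝ)..1, f s * q.eval s := by
  rw [L2.inner_def, intervalIntegral.integral_of_le zero_le_one]
  refine integral_congr_ae ?_
  filter_upwards [h, coeFn_toEdgeL2 ⟨fun s => q.eval s, q.continuous⟩] with s h1 h2
  have h3 : polyEdge q s = q.eval s := h2
  rw [h1, h3]
  simp [mul_comm]

namespace PlanePolygon

variable {n : ℕ} (P : PlanePolygon n)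

noncomputable instance : CompleteSpace P.sobolev := P.isClosed_sobolev.completeSpace_coe

/-- A smooth function as a member of `H²(K)`. -/
noncomputable def smoothJet : smoothFns →ₗ[ℝ] P.sobolev :=
  P.jet.codRestrict P.sobolev P.jet_mem_sobolev

theorem denseRange_smoothJet : DenseRange P.smoothJet := by
  intro U
  rw [closure_subtype]
  have : ((↑) : P.sobolev → P.JetSpace) '' Set.range P.smoothJet = Set.range P.jet := by
    rw [← Set.range_comp]; rfl
  rw [this]
  exact U.2

theorem exists_seq_smoothJet (U : P.sobolev) :
    ∃ φ : ℕ → smoothFns, Tendsto (fun m => P.smoothJet (φ m)) atTop (𝓝 U) := by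
  obtain ⟨V, hV, hVU⟩ := mem_closure_iff_seq_limit.1 (P.denseRange_smoothJet U)
  choose φ hφ using hV
  exact ⟨φ, by simpa only [hφ] using hVU⟩

theorem enorm_jet_sq (φ : smoothFns) :
    ‖P.jet φ‖ₑ ^ 2 = P.normSq φ + P.gradSq φ + P.hessSq φ := by
  have h1 : ‖P.jet φ‖ₑ ^ 2 = ∑ k, ‖P.jet φ k‖ₑ ^ 2 := by
    have := PiLp.norm_sq_eq_of_L2 (fun _ : JetIndex => P.L2) (P.jet φ)
    rw [← ofReal_norm, ← ENNReal.ofReal_pow (norm_nonneg _), this,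
      ENNReal.ofReal_sum_of_nonneg fun k _ => by positivity]
    refine Finset.sum_congr rfl fun k _ => ?_
    rw [← ofReal_norm, ← ENNReal.ofReal_pow (norm_nonneg _)]
  rw [h1]
  have h2 : ∀ k, ‖P.jet φ k‖ₑ ^ 2 = P.normSq (jetDeriv k φ) := fun k =>
    enorm_Lp_sq _ (P.coeFn_jet φ k)
  simp only [h2, Fintype.sum_sum_type, Fintype.sum_prod_type, Finset.univ_unique,
    Finset.sum_singleton, ← add_assoc]
  rfl

instance : CompactSpace (closure P.carrier) :=
  isCompact_iff_compactSpace.1 P.isBounded.isCompact_closure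

/-- The restriction of smooth functions to the closure of `K`. -/
noncomputable def restrictClosure : smoothFns →ₗ[ℝ] C(closure P.carrier, ℝ) where
  toFun φ := ⟨fun x => (φ : Plane → ℝ) x,
    (smoothFns_contDiff φ).continuous.comp continuous_subtype_val⟩
  map_add' _ _ := rfl
  map_smul' _ _ := rfl

/-- The Sobolev embedding of `H²(K)` in the continuous functions on the closure of `K`. -/
noncomputable def toC : P.sobolev →L[ℝ] C(closure P.carrier, ℝ) :=
  P.restrictClosure.extendOfNorm P.smoothJet

theorem toC_smoothJet (φ : smoothFns) (x : closure P.carrier) :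
    P.toC (P.smoothJet φ) x = (φ : Plane → ℝ) x := by
  obtain ⟨C, hC⟩ := P.exists_sobolev
  rw [toC, LinearMap.extendOfNorm_eq P.denseRange_smoothJet ⟨NNReal.sqrt C, fun φ => ?_⟩]
  · rfl
  · rw [ContinuousMap.norm_le _ (by positivity)]
    intro x
    refine norm_le_of_enorm_sq_le ?_
    change _ ≤ C * ‖P.jet φ‖ₑ ^ 2
    rw [P.enorm_jet_sq]
    exact hC x x.2 φ (smoothFns_contDiff φ)

open Classical in
/-- The representative of a member of `H²(K)` that is continuous up to the boundary; zero outside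
the closure of `K`. -/
noncomputable def rep (U : P.sobolev) (x : Plane) : ℝ :=
  if h : x ∈ closure P.carrier then P.toC U ⟨x, h⟩ else 0

theorem rep_apply (U : P.sobolev) {x : Plane} (hx : x ∈ closure P.carrier) :
    P.rep U x = P.toC U ⟨x, hx⟩ := dif_pos hx

theorem rep_smoothJet (φ : smoothFns) {x : Plane} (hx : x ∈ closure P.carrier) :
    P.rep (P.smoothJet φ) x = (φ : Plane → ℝ) x := by
  rw [P.rep_apply _ hx, P.toC_smoothJet]

theorem continuousOn_rep (U : P.sobolev) : ContinuousOn (P.rep U) (closure P.carrier) := by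
  rw [continuousOn_iff_continuous_domRestrict]
  convert (P.toC U).continuous using 1
  ext x
  exact P.rep_apply U x.2

theorem norm_rep_sub_le (U V : P.sobolev) (x : Plane) :
    ‖P.rep U x - P.rep V x‖ ≤ ‖P.toC U - P.toC V‖ := by
  by_cases hx : x ∈ closure P.carrier
  · rw [P.rep_apply _ hx, P.rep_apply _ hx]
    exact (P.toC U - P.toC V).norm_coe_le_norm ⟨x, hx⟩
  · simp [rep, hx]

theorem tendsto_norm_toC_sub {V : ℕ → P.sobolev} {U : P.sobolev}
    (h : Tendsto V atTop (𝓝 U)) :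
    Tendsto (fun m => ENNReal.ofReal ‖P.toC (V m) - P.toC U‖) atTop (𝓝 0) := by
  have h1 : Tendsto (fun m => P.toC (V m)) atTop (𝓝 (P.toC U)) :=
    (P.toC.continuous.tendsto U).comp h
  have h2 := tendsto_iff_norm_sub_tendsto_zero.1 h1
  simpa using ENNReal.tendsto_ofReal h2

theorem ae_eq_of_tendsto {α : Type*} [MeasurableSpace α] {μ : Measure α} {f g : α → ℝ}
    {h : ℕ → α → ℝ} (hf : AEStronglyMeasurable f μ) (hg : AEStronglyMeasurable g μ)
    (hh : ∀ m, AEStronglyMeasurable (h m) μ)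
    (h1 : Tendsto (fun m => eLpNorm (fun x => h m x - f x) 2 μ) atTop (𝓝 0))
    (h2 : Tendsto (fun m => eLpNorm (fun x => h m x - g x) 2 μ) atTop (𝓝 0)) : f =ᵐ[μ] g := by
  have hle : ∀ m, eLpNorm (f - g) 2 μ ≤
      eLpNorm (fun x => h m x - f x) 2 μ + eLpNorm (fun x => h m x - g x) 2 μ := by
    intro m
    have e : f - g = (fun x => h m x - g x) - fun x => h m x - f x := by
      ext x; simp
    rw [e, add_comm]
    exact eLpNorm_sub_le ((hh m).sub hg) ((hh m).sub hf) (by norm_num)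
  have h0 : eLpNorm (f - g) 2 μ = 0 := by
    have := ge_of_tendsto' (h1.add h2) hle
    simpa using this
  rw [eLpNorm_eq_zero_iff (hf.sub hg) (by norm_num)] at h0
  exact (sub_ae_eq_zero _ _).1 h0

theorem tendsto_eLpNorm_jet {V : ℕ → P.sobolev} {U : P.sobolev}
    (h : Tendsto V atTop (𝓝 U)) (k : JetIndex) :
    Tendsto (fun m => eLpNorm (fun x => (V m).1 k x - U.1 k x) 2 P.vol) atTop (𝓝 0) :=
  P.tendsto_jetSpace_iff.1 ((continuous_subtype_val.tendsto U).comp h) k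

theorem tendsto_eLpNorm_smoothJet {φ : ℕ → smoothFns} {U : P.sobolev}
    (h : Tendsto (fun m => P.smoothJet (φ m)) atTop (𝓝 U)) (k : JetIndex) :
    Tendsto (fun m => eLpNorm (fun x => jetDeriv k (φ m) x - U.1 k x) 2 P.vol) atTop (𝓝 0) := by
  refine (P.tendsto_eLpNorm_jet h k).congr fun m => eLpNorm_congr_ae ?_
  filter_upwards [P.coeFn_jet (φ m) k] with x hx
  have hx' : (P.smoothJet (φ m)).1 k x = jetDeriv k (φ m) x := hx
  rw [hx']

theorem coeFn_ae_eq_rep (U : P.sobolev) : U.1 (.inl ()) =ᵐ[P.vol] P.rep U := by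
  obtain ⟨φ, hφ⟩ := P.exists_seq_smoothJet U
  have hmeas : AEStronglyMeasurable (P.rep U) P.vol :=
    ((P.continuousOn_rep U).mono subset_closure).aestronglyMeasurable P.measurableSet_carrier
  refine ae_eq_of_tendsto (h := fun m => (φ m : Plane → ℝ)) (Lp.aestronglyMeasurable _) hmeas
    (fun m => (smoothFns_contDiff (φ m)).continuous.aestronglyMeasurable)
    (P.tendsto_eLpNorm_smoothJet hφ (.inl ())) ?_
  have hbound : ∀ m, eLpNorm (fun x => (φ m : Plane → ℝ) x - P.rep U x) 2 P.vol ≤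
      P.vol Set.univ ^ ((2 : ℝ≥0∞).toReal⁻¹) *
        ENNReal.ofReal ‖P.toC (P.smoothJet (φ m)) - P.toC U‖ := by
    intro m
    refine eLpNorm_le_of_ae_bound ?_
    filter_upwards [ae_restrict_mem P.measurableSet_carrier] with x hx
    rw [← P.rep_smoothJet (φ m) (subset_closure hx)]
    exact P.norm_rep_sub_le _ _ x
  refine tendsto_of_tendsto_of_tendsto_of_le_of_le tendsto_const_nhds ?_ (fun m => zero_le) hbound
  have := ENNReal.Tendsto.const_mul (a := P.vol Set.univ ^ ((2 : ℝ≥0∞).toReal⁻¹))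
    (P.tendsto_norm_toC_sub hφ) (Or.inr (ENNReal.rpow_ne_top_of_nonneg (by positivity)
      (measure_ne_top _ _)))
  simpa using this

/-- The representative that is continuous up to the boundary is unique. -/
theorem eqOn_rep (U : P.sobolev) {f : Plane → ℝ} (hf : ContinuousOn f (closure P.carrier))
    (h : U.1 (.inl ()) =ᵐ[P.vol] f) : Set.EqOn f (P.rep U) (closure P.carrier) := by
  have h1 : f =ᵐ[P.vol] P.rep U := h.symm.trans (P.coeFn_ae_eq_rep U)
  have h2 : Set.EqOn f (P.rep U) P.carrier :=
    Measure.eqOn_open_of_ae_eq h1 P.isOpen (hf.mono subset_closure)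
      ((P.continuousOn_rep U).mono subset_closure)
  exact h2.of_subset_closure hf (P.continuousOn_rep U) subset_closure subset_rfl

/-- The derivatives of order at most one. -/
def lowIndex : Unit ⊕ Fin 2 → JetIndex := Sum.map id Sum.inl

/-- The restriction to an edge of a derivative of order at most one of a smooth function. -/
noncomputable def smoothTrace (i : ZMod n) (k : Unit ⊕ Fin 2) : smoothFns →ₗ[ℝ] EdgeL2 :=
  toEdgeL2 ∘ₗ
    { toFun := fun φ => ⟨fun s => jetDeriv (lowIndex k) φ (P.edgePt i s),
        (contDiff_jetDeriv (smoothFns_contDiff φ) _).continuous.comp (P.continuous_edgePt i)⟩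
      map_add' := fun φ ψ => by
        ext s
        exact congrFun (jetDeriv_add (smoothFns_contDiff φ) (smoothFns_contDiff ψ) _) _
      map_smul' := fun c φ => by
        ext s
        exact congrFun (jetDeriv_smul (smoothFns_contDiff φ) c _) _ }

theorem coeFn_smoothTrace (i : ZMod n) (k : Unit ⊕ Fin 2) (φ : smoothFns) :
    P.smoothTrace i k φ =ᵐ[(volume : Measure ℝ).restrict (Set.Ioc 0 1)]
      fun s => jetDeriv (lowIndex k) φ (P.edgePt i s) :=
  coeFn_toEdgeL2 _

/-- The trace on an edge of a derivative of order at most one of a member of `H²(K)`. -/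
noncomputable def edgeTrace (i : ZMod n) (k : Unit ⊕ Fin 2) : P.sobolev →L[ℝ] EdgeL2 :=
  (P.smoothTrace i k).extendOfNorm P.smoothJet

theorem normSq_add_gradSq_jetDeriv_le (φ : smoothFns) (k : Unit ⊕ Fin 2) :
    P.normSq (jetDeriv (lowIndex k) φ) + P.gradSq (jetDeriv (lowIndex k) φ) ≤
      ‖P.jet φ‖ₑ ^ 2 := by
  rw [P.enorm_jet_sq]
  rcases k with k | j
  · exact le_self_add
  · have h1 : P.normSq (pd j φ) ≤ P.gradSq φ :=
      Finset.single_le_sum (f := fun j => P.normSq (pd j φ)) (fun _ _ => zero_le)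
        (Finset.mem_univ j)
    have h2 : P.gradSq (pd j φ) ≤ P.hessSq φ :=
      Finset.single_le_sum (f := fun j => P.gradSq (pd j φ)) (fun _ _ => zero_le)
        (Finset.mem_univ j)
    exact (add_le_add h1 h2).trans (add_le_add le_add_self le_rfl)

theorem edgeTrace_smoothJet (i : ZMod n) (k : Unit ⊕ Fin 2) (φ : smoothFns) :
    P.edgeTrace i k (P.smoothJet φ) = P.smoothTrace i k φ := by
  obtain ⟨C, hC⟩ := P.exists_trace i
  rw [edgeTrace, LinearMap.extendOfNorm_eq P.denseRange_smoothJet ⟨NNReal.sqrt C, fun φ => ?_⟩]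
  refine norm_le_of_enorm_sq_le ?_
  rw [enorm_Lp_sq _ (P.coeFn_smoothTrace i k φ)]
  refine (hC _ (contDiff_jetDeriv (smoothFns_contDiff φ) _)).trans ?_
  gcongr
  exact P.normSq_add_gradSq_jetDeriv_le φ k

theorem tendsto_eLpNorm_edgeTrace {φ : ℕ → smoothFns} {U : P.sobolev}
    (h : Tendsto (fun m => P.smoothJet (φ m)) atTop (𝓝 U)) (i : ZMod n) (k : Unit ⊕ Fin 2) :
    Tendsto (fun m => eLpNorm (fun s => jetDeriv (lowIndex k) (φ m) (P.edgePt i s) -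
      P.edgeTrace i k U s) 2 ((volume : Measure ℝ).restrict (Set.Ioc 0 1))) atTop (𝓝 0) := by
  have h1 := ((P.edgeTrace i k).continuous.tendsto U).comp h
  have h2 := (Lp.tendsto_Lp_iff_tendsto_eLpNorm' _ _).1 h1
  refine h2.congr fun m => eLpNorm_congr_ae ?_
  filter_upwards [P.coeFn_smoothTrace i k (φ m)] with s hs
  have e : (((P.edgeTrace i k) ∘ fun m => P.smoothJet (φ m)) m) = P.smoothTrace i k (φ m) :=
    P.edgeTrace_smoothJet i k (φ m)
  rw [Pi.sub_apply, e, hs]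

/-- The values on an edge of the representative that is continuous up to the boundary. -/
theorem coeFn_edgeTrace_inl (i : ZMod n) (U : P.sobolev) :
    P.edgeTrace i (.inl ()) U =ᵐ[(volume : Measure ℝ).restrict (Set.Ioc 0 1)]
      fun s => P.rep U (P.edgePt i s) := by
  obtain ⟨φ, hφ⟩ := P.exists_seq_smoothJet U
  have hc : ContinuousOn (fun s => P.rep U (P.edgePt i s)) (Set.Ioc 0 1) :=
    (P.continuousOn_rep U).comp (P.continuous_edgePt i).continuousOn
      fun s hs => P.edgePt_mem_closure i (Set.Ioc_subset_Icc_self hs)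
  refine ae_eq_of_tendsto (h := fun m s => (φ m : Plane → ℝ) (P.edgePt i s))
    (Lp.aestronglyMeasurable _) (hc.aestronglyMeasurable measurableSet_Ioc)
    (fun m => ((smoothFns_contDiff (φ m)).continuous.comp
      (P.continuous_edgePt i)).aestronglyMeasurable)
    (P.tendsto_eLpNorm_edgeTrace hφ i (.inl ())) ?_
  refine tendsto_of_tendsto_of_tendsto_of_le_of_le tendsto_const_nhds
    (P.tendsto_norm_toC_sub hφ) (fun m => zero_le) fun m => ?_
  refine (eLpNorm_le_of_ae_bound (C := ‖P.toC (P.smoothJet (φ m)) - P.toC U‖) ?_).trans ?_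
  · filter_upwards [ae_restrict_mem measurableSet_Ioc] with s hs
    rw [← P.rep_smoothJet (φ m) (P.edgePt_mem_closure i (Set.Ioc_subset_Icc_self hs))]
    exact P.norm_rep_sub_le _ _ _
  · simp

theorem hasEdgeTrace_edgeTrace (i : ZMod n) (j : Fin 2) (U : P.sobolev) :
    P.HasEdgeTrace i (U.1 (.inr (.inl j))) (fun l => U.1 (.inr (.inr (j, l))))
      (P.edgeTrace i (.inr j) U) := by
  obtain ⟨φ, hφ⟩ := P.exists_seq_smoothJet U
  exact ⟨Lp.memLp _, fun m => pd j (φ m), fun m => contDiff_pd (smoothFns_contDiff (φ m)) j,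
    P.tendsto_eLpNorm_smoothJet hφ (.inr (.inl j)),
    fun l => P.tendsto_eLpNorm_smoothJet hφ (.inr (.inr (j, l))),
    P.tendsto_eLpNorm_edgeTrace hφ i (.inr j)⟩

theorem pd_sub {φ ψ : Plane → ℝ} (hφ : ContDiff ℝ ∞ φ) (hψ : ContDiff ℝ ∞ ψ) (i : Fin 2)
    (x : Plane) : pd i (fun y => φ y - ψ y) x = pd i φ x - pd i ψ x := by
  simp only [pd]
  rw [fderiv_fun_sub (hφ.differentiable (by simp) x) (hψ.differentiable (by simp) x)]
  rfl

theorem tendsto_eLpNorm_sub {α : Type*} [MeasurableSpace α] {μ : Measure α} {f : α → ℝ}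
    {g h : ℕ → α → ℝ} (hf : AEStronglyMeasurable f μ) (hg : ∀ m, AEStronglyMeasurable (g m) μ)
    (hh : ∀ m, AEStronglyMeasurable (h m) μ)
    (h1 : Tendsto (fun m => eLpNorm (fun x => g m x - f x) 2 μ) atTop (𝓝 0))
    (h2 : Tendsto (fun m => eLpNorm (fun x => h m x - f x) 2 μ) atTop (𝓝 0)) :
    Tendsto (fun m => eLpNorm (fun x => g m x - h m x) 2 μ) atTop (𝓝 0) := by
  have h3 := h1.add h2
  rw [add_zero] at h3
  refine tendsto_of_tendsto_of_tendsto_of_le_of_le tendsto_const_nhds h3 (fun m => zero_le)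
    fun m => ?_
  have e : (fun x => g m x - h m x) = (fun x => g m x - f x) - fun x => h m x - f x := by
    ext x; simp
  rw [e]
  exact eLpNorm_sub_le ((hg m).sub hf) ((hh m).sub hf) (by norm_num)

/-- The trace of a function in `H¹(K)` on an edge is unique. -/
theorem HasEdgeTrace.ae_eq {i : ZMod n} {w : P.L2} {dw : Fin 2 → P.L2} {g g' : ℝ → ℝ}
    (h : P.HasEdgeTrace i w dw g) (h' : P.HasEdgeTrace i w dw g') :
    g =ᵐ[(volume : Measure ℝ).restrict (Set.Ioc 0 1)] g' := by
  obtain ⟨hg, φ, hφ, hφw, hφd, hφg⟩ := h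
  obtain ⟨hg', ψ, hψ, hψw, hψd, hψg⟩ := h'
  obtain ⟨C, hC⟩ := P.exists_trace i
  have cφ := fun m => (hφ m).continuous
  have cψ := fun m => (hψ m).continuous
  have k0 := tendsto_eLpNorm_sub (Lp.aestronglyMeasurable _)
    (fun m => (cφ m).aestronglyMeasurable) (fun m => (cψ m).aestronglyMeasurable) hφw hψw
  have k1 : ∀ j, Tendsto (fun m => eLpNorm (pd j fun y => φ m y - ψ m y) 2 P.vol) atTop (𝓝 0) := by
    intro j
    have := tendsto_eLpNorm_sub (Lp.aestronglyMeasurable _)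
      (fun m => (contDiff_pd (hφ m) j).continuous.aestronglyMeasurable)
      (fun m => (contDiff_pd (hψ m) j).continuous.aestronglyMeasurable) (hφd j) (hψd j)
    refine this.congr fun m => ?_
    congr 1
    ext x
    exact (pd_sub (hφ m) (hψ m) j x).symm
  have sq : ∀ {u : ℕ → ℝ≥0∞}, Tendsto u atTop (𝓝 0) →
      Tendsto (fun m => u m ^ 2) atTop (𝓝 0) := fun hu => by
    simpa using ENNReal.Tendsto.pow (n := 2) hu
  have k2 : Tendsto (fun m => C * (P.normSq (fun y => φ m y - ψ m y) +
      P.gradSq fun y => φ m y - ψ m y)) atTop (𝓝 0) := by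
    have e0 := sq k0
    have e1 := tendsto_finsetSum Finset.univ fun j _ => sq (k1 j)
    simp only [eLpNorm_two_sq] at e0 e1
    have := ENNReal.Tendsto.const_mul (a := (C : ℝ≥0∞)) (e0.add e1) (Or.inr ENNReal.coe_ne_top)
    simp only [Finset.sum_const_zero, add_zero, mul_zero] at this
    exact this
  have k3 : Tendsto (fun m => eLpNorm (fun s => φ m (P.edgePt i s) - ψ m (P.edgePt i s)) 2
      ((volume : Measure ℝ).restrict (Set.Ioc 0 1))) atTop (𝓝 0) := by
    have h4 : Tendsto (fun m => eLpNorm (fun s => φ m (P.edgePt i s) - ψ m (P.edgePt i s)) 2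
      ((volume : Measure ℝ).restrict (Set.Ioc 0 1)) ^ 2) atTop (𝓝 0) := by
      refine tendsto_of_tendsto_of_tendsto_of_le_of_le tendsto_const_nhds k2 (fun m => zero_le)
        fun m => ?_
      rw [eLpNorm_two_sq]
      exact hC _ ((hφ m).sub (hψ m))
    have h5 := (ENNReal.continuous_rpow_const (y := (1 / 2 : ℝ))).tendsto 0 |>.comp h4
    rw [ENNReal.zero_rpow_of_pos (by norm_num)] at h5
    refine h5.congr fun m => ?_
    simp only [Function.comp]
    rw [← ENNReal.rpow_natCast, ← ENNReal.rpow_mul]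
    norm_num
  have cφe := fun m => ((cφ m).comp (P.continuous_edgePt i)).aestronglyMeasurable
    (μ := (volume : Measure ℝ).restrict (Set.Ioc 0 1))
  have cψe := fun m => ((cψ m).comp (P.continuous_edgePt i)).aestronglyMeasurable
    (μ := (volume : Measure ℝ).restrict (Set.Ioc 0 1))
  refine ae_eq_of_tendsto hg.1 hg'.1 cφe hφg ?_
  have h6 := k3.add hψg
  rw [add_zero] at h6
  refine tendsto_of_tendsto_of_tendsto_of_le_of_le tendsto_const_nhds h6 (fun m => zero_le)
    fun m => ?_
  have e : (fun s => (φ m ∘ P.edgePt i) s - g' s) =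
      (fun s => φ m (P.edgePt i s) - ψ m (P.edgePt i s)) +
        fun s => ψ m (P.edgePt i s) - g' s := by
    ext s; simp
  rw [e]
  exact eLpNorm_add_le ((cφe m).sub (cψe m)) ((cψe m).sub hg'.1) (by norm_num)

end PlanePolygon

/-! ### The degrees of freedom as linear maps -/

instance finite_edgePoly (k : ℤ) : FiniteDimensional ℝ (edgePoly k) :=
  Module.Finite.equiv (Polynomial.degreeLTEquiv ℝ (k + 1).toNat).symm

instance finite_cellPoly (k : ℤ) : FiniteDimensional ℝ (cellPoly k) := by
  have : Finite {m : Fin 2 →₀ ℕ | (m.degree : ℤ) ≤ k} := by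
    refine (Finsupp.finite_of_degree_le (σ := Fin 2) k.toNat).subset fun m hm => ?_
    have := Set.mem_ofPred.1 hm
    exact Set.mem_ofPred.2 (by omega)
  exact Module.Finite.of_basis (MvPolynomial.basisRestrictSupport ℝ _)

namespace PlanePolygon

variable {n : ℕ} (P : PlanePolygon n)

theorem edgeLength_pos (i : ZMod n) : 0 < P.edgeLength i :=
  dist_pos.2 (P.vertex_ne i).symm

theorem vertex_mem_closure (i : ZMod n) : P.vertex i ∈ closure P.carrier :=
  frontier_subset_closure (P.edge_subset_frontier i (P.vertex_mem_edge i))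

/-- The moments of the normal derivative on an edge. -/
noncomputable def normalMoment (i : ZMod n) : P.sobolev →ₗ[ℝ] Polynomial ℝ →ₗ[ℝ] ℝ :=
  ∑ j, (P.edgeLength i * P.normal i j) •
    (innerₗ EdgeL2).compl₁₂ (P.edgeTrace i (.inr j)).toLinearMap polyEdge

/-- The moments of the values on an edge. -/
noncomputable def valueMoment (i : ZMod n) : P.sobolev →ₗ[ℝ] Polynomial ℝ →ₗ[ℝ] ℝ :=
  (innerₗ EdgeL2).compl₁₂ (P.edgeTrace i (.inl ())).toLinearMap polyEdge

/-- The class in `L²(K)` of a polynomial. -/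
noncomputable def polyCell : MvPolynomial (Fin 2) ℝ →ₗ[ℝ] P.L2 where
  toFun q := P.ofCont (continuous_polyFun q)
  map_add' p q := MemLp.toLp_congr _ ((P.memLp_of_continuous (continuous_polyFun p)).add
    (P.memLp_of_continuous (continuous_polyFun q))) (ae_of_all _ fun x => by simp [polyFun])
  map_smul' c p := MemLp.toLp_congr _ ((P.memLp_of_continuous (continuous_polyFun p)).const_smul c)
    (ae_of_all _ fun x => by simp [polyFun, MvPolynomial.smul_eval])

/-- One of the derivatives of order at most two of a member of `H²(K)`. -/
noncomputable def component (k : JetIndex) : P.sobolev →L[ℝ] P.L2 :=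
  (PiLp.proj 2 (fun _ : JetIndex => P.L2) k).comp P.sobolev.subtypeL

/-- The moments in the interior. -/
noncomputable def cellMoment : P.sobolev →ₗ[ℝ] MvPolynomial (Fin 2) ℝ →ₗ[ℝ] ℝ :=
  (volume.real P.carrier)⁻¹ •
    (innerₗ P.L2).compl₁₂ (P.component (.inl ())).toLinearMap P.polyCell

theorem cellMoment_apply (U : P.sobolev) (q : MvPolynomial (Fin 2) ℝ) :
    P.cellMoment U q =
      (volume.real P.carrier)⁻¹ * ∫ x, U.1 (.inl ()) x * polyFun q x ∂P.vol := by
  rw [P.integral_mul_eq_inner _ (continuous_polyFun q), real_inner_comm]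
  rfl

theorem valueMoment_apply (i : ZMod n) (U : P.sobolev) (q : Polynomial ℝ) :
    P.valueMoment i U q = (P.edgeLength i)⁻¹ *
      P.edgeIntegral i (fun s => P.rep U (P.edgePt i s) * q.eval s) := by
  rw [edgeIntegral, inv_mul_cancel_left₀ (P.edgeLength_pos i).ne',
    ← inner_polyEdge _ (P.coeFn_edgeTrace_inl i U)]
  rfl

theorem normalMoment_apply (i : ZMod n) (U : P.sobolev) (q : Polynomial ℝ) {τ : Fin 2 → ℝ → ℝ}
    (hτ : ∀ j, P.edgeTrace i (.inr j) U =ᵐ[(volume : Measure ℝ).restrict (Set.Ioc 0 1)] τ j) :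
    P.normalMoment i U q =
      P.edgeIntegral i (fun s => (∑ j, τ j s * P.normal i j) * q.eval s) := by
  have hi : ∀ j, IntervalIntegrable (fun s => τ j s * q.eval s) volume 0 1 := by
    intro j
    rw [intervalIntegrable_iff_integrableOn_Ioc_of_le zero_le_one]
    exact ((memLp_congr_ae (hτ j)).1 (Lp.memLp _)).integrable_mul (q := 2)
      (memLp_edge ⟨fun s => q.eval s, q.continuous⟩)
  have e : (fun s => (∑ j, τ j s * P.normal i j) * q.eval s) =
      fun s => ∑ j, P.normal i j * (τ j s * q.eval s) := by
    ext s
    rw [Finset.sum_mul]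
    exact Finset.sum_congr rfl fun j _ => by ring
  rw [edgeIntegral, e, intervalIntegral.integral_finsetSum fun j _ => (hi j).const_mul _,
    Finset.mul_sum, normalMoment]
  simp only [LinearMap.sum_apply]
  refine Finset.sum_congr rfl fun j _ => ?_
  rw [intervalIntegral.integral_const_mul, ← inner_polyEdge _ (hτ j), ← mul_assoc]
  rfl

/-- The values at the vertices. -/
noncomputable def vertexValue (i : ZMod n) : P.sobolev →L[ℝ] ℝ :=
  (ContinuousMap.evalCLM ℝ (⟨P.vertex i, P.vertex_mem_closure i⟩ : closure P.carrier)).comp P.toC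

theorem vertexValue_apply (i : ZMod n) (U : P.sobolev) :
    P.vertexValue i U = P.rep U (P.vertex i) :=
  (P.rep_apply U (P.vertex_mem_closure i)).symm

/-- The degrees of freedom of a member of `H²(K)`. -/
noncomputable def dofs (ℓ : ℕ) : P.sobolev →ₗ[ℝ] DofData n ℓ :=
  (LinearMap.pi fun i => (P.vertexValue i).toLinearMap).prod <|
    (LinearMap.pi fun i => LinearMap.domRestrict' (edgePoly ((ℓ : ℤ) - 2)) ∘ₗ P.normalMoment i).prod <|
    (LinearMap.pi fun i => LinearMap.domRestrict' (edgePoly ((ℓ : ℤ) - 3)) ∘ₗ P.valueMoment i).prod <|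
    LinearMap.domRestrict' (cellPoly ((ℓ : ℤ) - 4)) ∘ₗ P.cellMoment

variable {P} in
theorem dofs_eq_iff {ℓ : ℕ} {U : P.sobolev} {d : DofData n ℓ} :
    P.dofs ℓ U = d ↔ (∀ i, d.1 i = P.vertexValue i U) ∧
      (∀ i q, d.2.1 i q = P.normalMoment i U q.1) ∧
      (∀ i q, d.2.2.1 i q = P.valueMoment i U q.1) ∧ ∀ q, d.2.2.2 q = P.cellMoment U q.1 := by
  constructor
  · rintro rfl
    exact ⟨fun i => rfl, fun i q => rfl, fun i q => rfl, fun q => rfl⟩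
  · rintro ⟨h1, h2, h3, h4⟩
    refine Prod.ext (funext fun i => (h1 i).symm) (Prod.ext (funext fun i => LinearMap.ext fun q =>
      (h2 i q).symm) (Prod.ext (funext fun i => LinearMap.ext fun q => (h3 i q).symm)
      (LinearMap.ext fun q => (h4 q).symm)))

theorem hasDofs_iff {ℓ : ℕ} (U : P.sobolev) (d : DofData n ℓ) :
    P.HasDofs ℓ (U.1 (.inl ())) d ↔ P.dofs ℓ U = d := by
  rw [dofs_eq_iff]
  constructor
  · rintro ⟨G, H, f, τ, hGH, hf, huf, hτ, h1, h2, h3, h4⟩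
    have hrep := P.eqOn_rep U hf huf
    have hU := P.eq_mkJet U.2 hGH
    have hG : ∀ j, U.1 (.inr (.inl j)) = G j := fun j =>
      congrArg (fun V : P.JetSpace => V (.inr (.inl j))) hU
    have hH : ∀ j l, U.1 (.inr (.inr (j, l))) = H j l := fun j l =>
      congrArg (fun V : P.JetSpace => V (.inr (.inr (j, l)))) hU
    have hτ' : ∀ i j, P.edgeTrace i (.inr j) U
        =ᵐ[(volume : Measure ℝ).restrict (Set.Ioc 0 1)] τ i j := by
      intro i j
      have h := P.hasEdgeTrace_edgeTrace i j U
      simp only [hG, hH] at h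
      exact HasEdgeTrace.ae_eq P h (hτ i j)
    refine ⟨fun i => ?_, fun i q => ?_, fun i q => ?_, fun q => ?_⟩
    · rw [h1, vertexValue_apply, hrep (P.vertex_mem_closure i)]
    · rw [h2, P.normalMoment_apply i U q.1 (hτ' i)]
    · rw [h3, valueMoment_apply, edgeIntegral, edgeIntegral]
      congr 2
      refine intervalIntegral.integral_congr fun s hs => ?_
      rw [Set.uIcc_of_le zero_le_one] at hs
      exact congrArg (· * q.1.eval s) (hrep (P.edgePt_mem_closure i hs))
    · rw [h4, cellMoment_apply]
  · rintro ⟨h1, h2, h3, h4⟩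
    refine ⟨_, _, P.rep U, fun i j => P.edgeTrace i (.inr j) U,
      P.hasWeakHessian_of_mem_sobolev U.2, P.continuousOn_rep U, P.coeFn_ae_eq_rep U,
      fun i j => P.hasEdgeTrace_edgeTrace i j U, fun i => ?_, fun i q => ?_, fun i q => ?_,
      fun q => ?_⟩
    · rw [h1, vertexValue_apply]
    · rw [h2, P.normalMoment_apply i U q.1 fun j => ae_eq_refl _]
    · rw [h3, valueMoment_apply]
    · rw [h4, cellMoment_apply]

theorem continuous_normalMoment (i : ZMod n) (q : Polynomial ℝ) :
    Continuous fun U => P.normalMoment i U q := by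
  have : ∀ U, P.normalMoment i U q = ∑ j, (P.edgeLength i * P.normal i j) *
      inner ℝ (P.edgeTrace i (.inr j) U) (polyEdge q) := by
    intro U
    simp only [normalMoment, LinearMap.sum_apply]
    rfl
  simp only [this]
  exact continuous_finsetSum _ fun j _ => continuous_const.mul
    ((P.edgeTrace i (.inr j)).continuous.inner continuous_const)

theorem continuous_valueMoment (i : ZMod n) (q : Polynomial ℝ) :
    Continuous fun U => P.valueMoment i U q :=
  (P.edgeTrace i (.inl ())).continuous.inner continuous_const

theorem continuous_cellMoment (q : MvPolynomial (Fin 2) ℝ) :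
    Continuous fun U => P.cellMoment U q :=
  continuous_const.mul ((P.component (.inl ())).continuous.inner continuous_const)

theorem exists_dual_dual_eq {ι V : Type*} [Fintype ι] [AddCommGroup V] [Module ℝ V]
    [FiniteDimensional ℝ V] (L : Module.Dual ℝ (ι → Module.Dual ℝ V)) :
    ∃ v : ι → V, ∀ f, L f = ∑ i, f i (v i) := by
  classical
  choose v hv using fun i => (Module.bijective_dual_eval ℝ V).2
    (L ∘ₗ LinearMap.single ℝ (fun _ : ι => Module.Dual ℝ V) i)
  refine ⟨v, fun f => ?_⟩
  have h : ∀ i, f i (v i) = L (Pi.single i (f i)) := fun i => LinearMap.congr_fun (hv i) (f i)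
  rw [Finset.sum_congr rfl fun i _ => h i, ← map_sum, Finset.univ_sum_single]

/-- As the polynomial spaces are finite-dimensional, a linear functional of the degrees of freedom
is a combination of vertex values and moments against fixed polynomials. -/
theorem exists_dual_eq [NeZero n] {ℓ : ℕ} (Λ : Module.Dual ℝ (DofData n ℓ)) :
    ∃ (c : ZMod n → ℝ) (g : ZMod n → edgePoly ((ℓ : ℤ) - 2)) (h : ZMod n → edgePoly ((ℓ : ℤ) - 3))
      (p : cellPoly ((ℓ : ℤ) - 4)), ∀ d : DofData n ℓ, Λ d =
        ∑ i, c i * d.1 i + ∑ i, d.2.1 i (g i) + ∑ i, d.2.2.1 i (h i) + d.2.2.2 p := by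
  classical
  obtain ⟨g, hg⟩ := exists_dual_dual_eq (Λ ∘ₗ LinearMap.inr ℝ _ _ ∘ₗ LinearMap.inl ℝ _ _)
  obtain ⟨h, hh⟩ := exists_dual_dual_eq (Λ ∘ₗ LinearMap.inr ℝ _ _ ∘ₗ LinearMap.inr ℝ _ _ ∘ₗ
    LinearMap.inl ℝ _ _)
  obtain ⟨p, hp⟩ := (Module.bijective_dual_eval ℝ _).2
    (Λ ∘ₗ LinearMap.inr ℝ _ _ ∘ₗ LinearMap.inr ℝ _ _ ∘ₗ LinearMap.inr ℝ _ _)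
  refine ⟨fun i => Λ (Pi.single i 1, 0), g, h, p, fun d => ?_⟩
  obtain ⟨a, b, c, e⟩ := d
  have e0 : ((a, b, c, e) : DofData n ℓ) = (a, 0, 0, 0) + (0, b, 0, 0) + (0, 0, c, 0) +
    (0, 0, 0, e) := by simp
  have e1 : Λ (a, 0, 0, 0) = ∑ i, Λ (Pi.single i 1, 0) * a i := by
    have h1 : ∀ i, Λ (Pi.single i 1, 0) * a i =
        (Λ ∘ₗ LinearMap.inl ℝ _ _) (Pi.single i (a i)) := by
      intro i
      have : Pi.single i (a i) = a i • (Pi.single i 1 : ZMod n → ℝ) := by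
        rw [← Pi.single_smul, smul_eq_mul, mul_one]
      rw [this, map_smul, smul_eq_mul, mul_comm]
      rfl
    rw [Finset.sum_congr rfl fun i _ => h1 i, ← map_sum, Finset.univ_sum_single]
    rfl
  have e2 : Λ (0, b, 0, 0) = ∑ i, b i (g i) := hg b
  have e3 : Λ (0, 0, c, 0) = ∑ i, c i (h i) := hh c
  have e4 : Λ (0, 0, 0, e) = e p := (LinearMap.congr_fun hp e).symm
  rw [e0, map_add, map_add, map_add, e1, e2, e3, e4, ← e0]

/-- The normal derivative on an edge of a smooth function, tested with a polynomial. -/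
theorem normalMoment_smoothJet (i : ZMod n) (φ : smoothFns) (q : Polynomial ℝ) :
    P.normalMoment i (P.smoothJet φ) q =
      P.edgeIntegral i (fun s => P.normalDeriv i φ s * q.eval s) :=
  P.normalMoment_apply i _ q fun j => by
    rw [edgeTrace_smoothJet]
    exact P.coeFn_smoothTrace i (.inr j) φ

theorem valueMoment_smoothJet (i : ZMod n) (φ : smoothFns) (q : Polynomial ℝ) :
    P.valueMoment i (P.smoothJet φ) q = (P.edgeLength i)⁻¹ *
      P.edgeIntegral i (fun s => (φ : Plane → ℝ) (P.edgePt i s) * q.eval s) := by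
  rw [valueMoment_apply, edgeIntegral, edgeIntegral]
  congr 2
  refine intervalIntegral.integral_congr fun s hs => ?_
  rw [Set.uIcc_of_le zero_le_one] at hs
  exact congrArg (· * q.eval s) (P.rep_smoothJet φ (P.edgePt_mem_closure i hs))

theorem cellMoment_smoothJet (φ : smoothFns) (q : MvPolynomial (Fin 2) ℝ) :
    P.cellMoment (P.smoothJet φ) q =
      (volume.real P.carrier)⁻¹ * ∫ x, (φ : Plane → ℝ) x * polyFun q x ∂P.vol := by
  rw [cellMoment_apply]
  congr 1
  refine integral_congr_ae ?_
  filter_upwards [P.coeFn_jet φ (.inl ())] with x hx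
  exact congrArg (· * polyFun q x) hx

theorem vertexValue_smoothJet (i : ZMod n) (φ : smoothFns) :
    P.vertexValue i (P.smoothJet φ) = (φ : Plane → ℝ) (P.vertex i) := by
  rw [vertexValue_apply, P.rep_smoothJet φ (P.vertex_mem_closure i)]

end PlanePolygon

/-! ### Coercivity of the plate bending form -/

/-- The affine function `x ↦ a.1 + a.2 0 * x 0 + a.2 1 * x 1`. -/
noncomputable def affineFn : ℝ × (Fin 2 → ℝ) →ₗ[ℝ] smoothFns where
  toFun a := ⟨fun x => a.1 + ∑ j, a.2 j * x j, by
    change ContDiff ℝ ∞ fun x : Plane => a.1 + ∑ j, a.2 j * x j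
    exact contDiff_const.add (ContDiff.sum fun j _ => contDiff_const.mul
      (EuclideanSpace.proj j : Plane →L[ℝ] ℝ).contDiff)⟩
  map_add' a b := by
    ext x
    simp [Fin.sum_univ_two]
    ring
  map_smul' c a := by
    ext x
    simp [Fin.sum_univ_two]
    ring

theorem affineFn_apply (a : ℝ × (Fin 2 → ℝ)) (x : Plane) :
    (affineFn a : Plane → ℝ) x = a.1 + ∑ j, a.2 j * x j := rfl

theorem pd_affineFn (a : ℝ × (Fin 2 → ℝ)) (i : Fin 2) (x : Plane) :
    pd i (affineFn a : Plane → ℝ) x = a.2 i := by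
  have h : HasFDerivAt (affineFn a : Plane → ℝ)
      (∑ j, a.2 j • (EuclideanSpace.proj j : Plane →L[ℝ] ℝ)) x := by
    have h1 : HasFDerivAt (fun x : Plane => ∑ j, a.2 j * x j)
        (∑ j, a.2 j • (EuclideanSpace.proj j : Plane →L[ℝ] ℝ)) x :=
      HasFDerivAt.fun_sum fun j _ =>
        ((EuclideanSpace.proj j : Plane →L[ℝ] ℝ).hasFDerivAt (x := x)).const_mul (a.2 j)
    exact h1.const_add a.1
  rw [pd, h.fderiv]
  fin_cases i <;> simp [Fin.sum_univ_two]

namespace PlanePolygon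

variable {n : ℕ} (P : PlanePolygon n)

/-- An affine function that vanishes at all vertices is zero: otherwise the boundary of `K` would
lie on a line, and a ray issuing from a point of `K` in the direction away from that line would
stay in `K`. -/
theorem eq_zero_of_affineFn_vertex (a : ℝ × (Fin 2 → ℝ))
    (h : ∀ i, (affineFn a : Plane → ℝ) (P.vertex i) = 0) : a = 0 := by
  have hadd : ∀ (x v : Plane) (t : ℝ), (affineFn a : Plane → ℝ) (x + t • v) =
      (affineFn a : Plane → ℝ) x + t * ∑ j, a.2 j * v j := by
    intro x v t
    simp only [affineFn_apply, Fin.sum_univ_two, PiLp.add_apply, PiLp.smul_apply, smul_eq_mul]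
    ring
  have hfr : ∀ x ∈ frontier P.carrier, (affineFn a : Plane → ℝ) x = 0 := by
    intro x hx
    rw [P.frontier_eq_iUnion_edge, Set.mem_iUnion] at hx
    obtain ⟨i, s, t, -, -, hst, rfl⟩ := hx
    have h1 := h i
    have h2 := h (i + 1)
    simp only [affineFn_apply, Fin.sum_univ_two, PiLp.add_apply, PiLp.smul_apply,
      smul_eq_mul] at h1 h2 ⊢
    have : s = 1 - t := by linarith
    subst this
    linear_combination (1 - t) * h1 + t * h2
  have hα : a.2 = 0 := by
    by_contra hne
    set v : Plane := WithLp.toLp 2 a.2 with hv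
    set S : ℝ := ∑ j, a.2 j * v j with hS
    have hSpos : 0 < S := by
      obtain ⟨j, hj⟩ := Function.ne_iff.1 hne
      refine Finset.sum_pos' (fun j _ => mul_self_nonneg (a.2 j))
        ⟨j, Finset.mem_univ j, mul_self_pos.2 hj⟩
    obtain ⟨x, hx⟩ := P.isConnected.nonempty
    obtain ⟨M, hM⟩ := P.exists_forall_norm_le (smoothFns_contDiff (affineFn a)).continuous
    obtain ⟨σ, hσ⟩ : ∃ σ : ℝ, ∀ t, 0 ≤ t → |(affineFn a : Plane → ℝ) (x + (t * σ) • v)| =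
        |(affineFn a : Plane → ℝ) x| + t * S := by
      rcases le_total 0 ((affineFn a : Plane → ℝ) x) with h0 | h0
      · refine ⟨1, fun t ht => ?_⟩
        rw [hadd, abs_of_nonneg h0, abs_of_nonneg (by positivity), mul_one]
      · refine ⟨-1, fun t ht => ?_⟩
        rw [hadd, abs_of_nonpos h0, ← hS, abs_of_nonpos (by nlinarith)]
        ring
    have hray : (fun t : ℝ => x + (t * σ) • v) '' Set.Ici 0 ⊆ P.carrier := by
      refine P.subset_carrier_of_isPreconnected ?_ ?_ ⟨x, ⟨0, Set.self_mem_Ici, by simp⟩, hx⟩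
      · exact isPreconnected_Ici.image _ (by fun_prop)
      · rw [Set.disjoint_left]
        rintro _ ⟨t, ht, rfl⟩ hf
        have h1 := hσ t ht
        rw [hfr _ hf, abs_zero] at h1
        have ht0 : t = 0 := by
          have : 0 ≤ t * S := mul_nonneg ht hSpos.le
          have h2 := abs_nonneg ((affineFn a : Plane → ℝ) x)
          exact (mul_eq_zero.1 (by linarith : t * S = 0)).resolve_right hSpos.ne'
        subst ht0
        rw [P.isOpen.frontier_eq] at hf
        exact hf.2 (by simpa using hx)
    have hM0 : 0 ≤ M := (norm_nonneg _).trans (hM x (subset_closure hx))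
    have ht : (0 : ℝ) ≤ (M + 1) / S := by positivity
    have h1 := hM _ (subset_closure (hray ⟨(M + 1) / S, ht, rfl⟩))
    rw [Real.norm_eq_abs, hσ _ ht, div_mul_cancel₀ _ hSpos.ne'] at h1
    linarith [abs_nonneg ((affineFn a : Plane → ℝ) x)]
  refine Prod.ext ?_ hα
  have := h 0
  rw [affineFn_apply, hα] at this
  simpa using this

/-- The affine functions, as a subspace of `H²(K)`. -/
noncomputable def affineSpace : Submodule ℝ P.sobolev :=
  LinearMap.range (P.smoothJet ∘ₗ affineFn)

instance : FiniteDimensional ℝ P.affineSpace :=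
  inferInstanceAs (FiniteDimensional ℝ (LinearMap.range (P.smoothJet ∘ₗ affineFn)))

/-- The square of the norm of the Hessian. -/
noncomputable def hessNormSq (U : P.sobolev) : ℝ :=
  ∑ i, ∑ j, ‖P.component (.inr (.inr (i, j))) U‖ ^ 2

theorem hessSq_eq (φ : smoothFns) : P.hessSq φ = ENNReal.ofReal (P.hessNormSq (P.smoothJet φ)) := by
  rw [hessNormSq, ENNReal.ofReal_sum_of_nonneg fun i _ => by positivity, hessSq]
  refine Finset.sum_congr rfl fun i _ => ?_
  rw [ENNReal.ofReal_sum_of_nonneg fun i _ => by positivity, gradSq]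
  refine Finset.sum_congr rfl fun j _ => ?_
  rw [ENNReal.ofReal_pow (norm_nonneg _), ofReal_norm]
  exact (enorm_Lp_sq _ (P.coeFn_jet φ (.inr (.inr (i, j))))).symm

/-- The Poincaré inequality, applied to the first derivatives and then to the function: the Hessian
controls the distance to the affine functions. -/
theorem exists_infDist_affineSpace_le : ∃ C : ℝ≥0, ∀ U : P.sobolev,
    Metric.infDist U P.affineSpace ^ 2 ≤ C * P.hessNormSq U := by
  obtain ⟨C, hC⟩ := P.exists_poincare
  refine ⟨C * C + C + 1, fun U => ?_⟩
  have hcl : IsClosed {U : P.sobolev | Metric.infDist U P.affineSpace ^ 2 ≤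
      (C * C + C + 1 : ℝ≥0) * P.hessNormSq U} := by
    refine isClosed_le ((Metric.continuous_infDist_pt _).pow 2) (continuous_const.mul ?_)
    exact continuous_finsetSum _ fun i _ => continuous_finsetSum _ fun j _ =>
      (P.component _).continuous.norm.pow 2
  refine closure_minimal ?_ hcl (P.denseRange_smoothJet U)
  rintro _ ⟨φ, rfl⟩
  have hφ := smoothFns_contDiff φ
  choose m hm using fun i => hC (pd i φ) (contDiff_pd hφ i)
  set ψ : smoothFns := φ - affineFn (0, m) with hψ
  have hψc := smoothFns_contDiff ψ
  obtain ⟨c, hc⟩ := hC ψ hψc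
  set χ : smoothFns := φ - affineFn (c, m) with hχ
  have e1 : ∀ i x, pd i (ψ : Plane → ℝ) x = pd i φ x - m i := by
    intro i x
    have := pd_sub hφ (smoothFns_contDiff (affineFn (0, m))) i x
    rw [pd_affineFn] at this
    exact this
  have e2 : ∀ i, pd i (χ : Plane → ℝ) = pd i (ψ : Plane → ℝ) := by
    intro i
    ext x
    rw [e1]
    have := pd_sub hφ (smoothFns_contDiff (affineFn (c, m))) i x
    rw [pd_affineFn] at this
    exact this
  have e3 : ∀ i j x, pd j (pd i (ψ : Plane → ℝ)) x = pd j (pd i φ) x := by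
    intro i j x
    have : pd i (ψ : Plane → ℝ) = fun x => pd i φ x - m i := funext (e1 i)
    rw [this, pd, fderiv_sub_const]
    rfl
  have e4 : (χ : Plane → ℝ) = fun x => (ψ : Plane → ℝ) x - c := by
    ext x
    have h1 : (χ : Plane → ℝ) x = (φ : Plane → ℝ) x - (affineFn (c, m) : Plane → ℝ) x := rfl
    have h2 : (ψ : Plane → ℝ) x = (φ : Plane → ℝ) x - (affineFn (0, m) : Plane → ℝ) x := rfl
    rw [h1, h2, affineFn_apply, affineFn_apply]
    ring
  have hH : P.hessSq χ = P.hessSq φ := by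
    simp only [hessSq, gradSq, e2]
    refine Finset.sum_congr rfl fun i _ => Finset.sum_congr rfl fun j _ => ?_
    rw [show pd j (pd i (ψ : Plane → ℝ)) = pd j (pd i φ) from funext (e3 i j)]
  have hG : P.gradSq ψ ≤ C * P.hessSq φ := by
    rw [hessSq, Finset.mul_sum, gradSq]
    refine Finset.sum_le_sum fun i _ => ?_
    rw [show pd i (ψ : Plane → ℝ) = fun x => pd i φ x - m i from funext (e1 i)]
    exact hm i
  have hG' : P.gradSq χ = P.gradSq ψ := by simp only [gradSq, e2]
  have hN : P.normSq χ ≤ C * (C * P.hessSq φ) := by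
    rw [e4]
    exact hc.trans (by gcongr)
  have htot : ‖P.jet χ‖ₑ ^ 2 ≤ (C * C + C + 1 : ℝ≥0) * P.hessSq φ := by
    rw [P.enorm_jet_sq, hH, hG']
    calc _ ≤ C * (C * P.hessSq φ) + C * P.hessSq φ + P.hessSq φ := by gcongr
      _ = _ := by push_cast; ring
  have hreal : ‖P.smoothJet χ‖ ^ 2 ≤ (C * C + C + 1 : ℝ≥0) * P.hessNormSq (P.smoothJet φ) := by
    rw [hessSq_eq, ← ENNReal.ofReal_coe_nnreal, ← ENNReal.ofReal_mul NNReal.zero_le_coe,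
      ← ofReal_norm, ← ENNReal.ofReal_pow (norm_nonneg _), ENNReal.ofReal_le_ofReal_iff] at htot
    · exact htot
    · exact mul_nonneg NNReal.zero_le_coe (Finset.sum_nonneg fun i _ => Finset.sum_nonneg
        fun j _ => by positivity)
  refine le_trans ?_ hreal
  have hmem : P.smoothJet (affineFn (c, m)) ∈ P.affineSpace := ⟨(c, m), rfl⟩
  have := Metric.infDist_le_dist_of_mem (x := P.smoothJet φ) hmem
  rw [dist_eq_norm, ← map_sub] at this
  exact pow_le_pow_left₀ Metric.infDist_nonneg this 2

theorem isClosed_ker_dofs (ℓ : ℕ) : IsClosed ((LinearMap.ker (P.dofs ℓ) : Submodule ℝ P.sobolev) :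
    Set P.sobolev) := by
  have : ((LinearMap.ker (P.dofs ℓ) : Submodule ℝ P.sobolev) : Set P.sobolev) =
      (⋂ i, {U | 0 = P.vertexValue i U}) ∩
      ((⋂ i, ⋂ q : edgePoly ((ℓ : ℤ) - 2), {U | 0 = P.normalMoment i U q.1}) ∩
      ((⋂ i, ⋂ q : edgePoly ((ℓ : ℤ) - 3), {U | 0 = P.valueMoment i U q.1}) ∩
      ⋂ q : cellPoly ((ℓ : ℤ) - 4), {U | 0 = P.cellMoment U q.1})) := by
    ext U
    simp only [SetLike.mem_coe, LinearMap.mem_ker, dofs_eq_iff, Set.mem_inter_iff, Set.mem_iInter,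
      Set.mem_ofPred_eq]
    rfl
  rw [this]
  have h1 : IsClosed (⋂ i, {U | 0 = P.vertexValue i U}) :=
    isClosed_iInter fun i => isClosed_eq continuous_const (P.vertexValue i).continuous
  have h2 : IsClosed (⋂ i, ⋂ q : edgePoly ((ℓ : ℤ) - 2), {U | 0 = P.normalMoment i U q.1}) :=
    isClosed_iInter fun i => isClosed_iInter fun q =>
      isClosed_eq continuous_const (P.continuous_normalMoment i q.1)
  have h3 : IsClosed (⋂ i, ⋂ q : edgePoly ((ℓ : ℤ) - 3), {U | 0 = P.valueMoment i U q.1}) :=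
    isClosed_iInter fun i => isClosed_iInter fun q =>
      isClosed_eq continuous_const (P.continuous_valueMoment i q.1)
  have h4 : IsClosed (⋂ q : cellPoly ((ℓ : ℤ) - 4), {U | 0 = P.cellMoment U q.1}) :=
    isClosed_iInter fun q => isClosed_eq continuous_const (P.continuous_cellMoment q.1)
  exact h1.inter (h2.inter (h3.inter h4))

/-- The angle between a closed subspace and a finite-dimensional one that it meets trivially is
positive. -/
theorem exists_norm_le_norm_sub {E : Type*} [NormedAddCommGroup E] [NormedSpace ℝ E]
    (N A : Submodule ℝ E) (hN : IsClosed (N : Set E)) [FiniteDimensional ℝ A] (h : N ⊓ A = ⊥) :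
    ∃ C : ℝ≥0, ∀ w ∈ N, ∀ a ∈ A, ‖w‖ ≤ C * ‖w - a‖ := by
  have : IsClosed (N.toAddSubgroup : Set E) := hN
  let f : A →ₗ[ℝ] E ⧸ N := N.mkQ ∘ₗ A.subtype
  have hf : LinearMap.ker f = ⊥ := by
    rw [LinearMap.ker_eq_bot']
    intro a ha
    have h1 : (a : E) ∈ N := (Submodule.Quotient.mk_eq_zero N).1 ha
    have h2 : (a : E) ∈ N ⊓ A := ⟨h1, a.2⟩
    rw [h] at h2
    exact Subtype.ext ((Submodule.mem_bot ℝ).1 h2)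
  obtain ⟨K, -, hK⟩ := f.exists_antilipschitzWith hf
  refine ⟨K + 1, fun w hw a ha => ?_⟩
  have h1 := hK.le_mul_dist ⟨a, ha⟩ 0
  rw [dist_zero_right, map_zero, dist_zero_right] at h1
  have h2 : ‖f ⟨a, ha⟩‖ ≤ ‖w - a‖ := by
    have e : f ⟨a, ha⟩ = N.mkQ (a - w) := by
      rw [map_sub, (Submodule.Quotient.mk_eq_zero N).2 hw |> fun h => (h : N.mkQ w = 0), sub_zero]
      rfl
    rw [e, norm_sub_rev]
    exact Submodule.Quotient.norm_mk_le N (a - w)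
  have h3 : ‖a‖ ≤ K * ‖w - a‖ := h1.trans (by gcongr)
  calc ‖w‖ = ‖(w - a) + a‖ := by simp
    _ ≤ ‖w - a‖ + ‖a‖ := norm_add_le _ _
    _ ≤ ‖w - a‖ + K * ‖w - a‖ := by gcongr
    _ = _ := by push_cast; ring

/-- The Hessian controls the functions whose degrees of freedom vanish, because no nonzero affine
function is among them. -/
theorem exists_norm_sq_le_hessNormSq (ℓ : ℕ) : ∃ C : ℝ≥0, ∀ U ∈ LinearMap.ker (P.dofs ℓ),
    ‖U‖ ^ 2 ≤ C * P.hessNormSq U := by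
  obtain ⟨C, hC⟩ := P.exists_infDist_affineSpace_le
  have hbot : LinearMap.ker (P.dofs ℓ) ⊓ P.affineSpace = ⊥ := by
    rw [eq_bot_iff]
    rintro _ ⟨h1, a, rfl⟩
    have h2 := (dofs_eq_iff.1 (LinearMap.mem_ker.1 h1)).1
    have : a = 0 := P.eq_zero_of_affineFn_vertex a fun i => by
      rw [← P.vertexValue_smoothJet i]
      exact (h2 i).symm
    rw [this, map_zero]
    exact Submodule.zero_mem _
  obtain ⟨K, hK⟩ := exists_norm_le_norm_sub _ _ (P.isClosed_ker_dofs ℓ) hbot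
  refine ⟨(K + 1) ^ 2 * C, fun U hU => ?_⟩
  have h1 : ‖U‖ / (K + 1) ≤ Metric.infDist U P.affineSpace := by
    rw [Metric.le_infDist ⟨0, P.affineSpace.zero_mem⟩]
    intro a ha
    rw [div_le_iff₀ (by positivity), dist_eq_norm]
    nlinarith [hK U hU a ha, norm_nonneg (U - a)]
  rw [div_le_iff₀ (by positivity)] at h1
  calc ‖U‖ ^ 2 ≤ (Metric.infDist U P.affineSpace * (K + 1)) ^ 2 :=
        pow_le_pow_left₀ (norm_nonneg _) h1 2
    _ = (K + 1) ^ 2 * Metric.infDist U P.affineSpace ^ 2 := by ring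
    _ ≤ (K + 1) ^ 2 * (C * P.hessNormSq U) := by gcongr; exact hC U
    _ = _ := by push_cast; ring

/-- The symmetric bilinear form `(u, w) ↦ ⟪T u, T w⟫`. -/
noncomputable def pullbackInner {E F : Type*} [NormedAddCommGroup E] [NormedSpace ℝ E]
    [NormedAddCommGroup F] [InnerProductSpace ℝ F] (T : E →L[ℝ] F) : E →L[ℝ] E →L[ℝ] ℝ :=
  LinearMap.mkContinuous₂ ((innerₗ F).compl₁₂ T.toLinearMap T.toLinearMap) (‖T‖ * ‖T‖)
    fun u w => by
      refine (norm_inner_le_norm (𝕜 := ℝ) (T u) (T w)).trans ?_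
      calc ‖T u‖ * ‖T w‖ ≤ (‖T‖ * ‖u‖) * (‖T‖ * ‖w‖) := by
            gcongr <;> exact T.le_opNorm _
        _ = _ := by ring

theorem pullbackInner_apply {E F : Type*} [NormedAddCommGroup E] [NormedSpace ℝ E]
    [NormedAddCommGroup F] [InnerProductSpace ℝ F] (T : E →L[ℝ] F) (u w : E) :
    pullbackInner T u w = inner ℝ (T u) (T w) := rfl

/-- The Laplacian on `H²(K)`. -/
noncomputable def laplacian : P.sobolev →L[ℝ] P.L2 := ∑ i, P.component (.inr (.inr (i, i)))

/-- The plate bending form built from a Laplacian `L` and second derivatives `T`. -/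
noncomputable def bendingForm {E F : Type*} [NormedAddCommGroup E] [NormedSpace ℝ E]
    [NormedAddCommGroup F] [InnerProductSpace ℝ F] (ν : ℝ) (L : E →L[ℝ] F)
    (T : Fin 2 → Fin 2 → E →L[ℝ] F) : E →L[ℝ] E →L[ℝ] ℝ :=
  ν • pullbackInner L + (1 - ν) • ∑ i, ∑ j, pullbackInner (T i j)

theorem bendingForm_apply {E F : Type*} [NormedAddCommGroup E] [NormedSpace ℝ E]
    [NormedAddCommGroup F] [InnerProductSpace ℝ F] (ν : ℝ) (L : E →L[ℝ] F)
    (T : Fin 2 → Fin 2 → E →L[ℝ] F) (u w : E) : bendingForm ν L T u w =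
      ν * inner ℝ (L u) (L w) + (1 - ν) * ∑ i, ∑ j, inner ℝ (T i j u) (T i j w) := by
  simp [bendingForm, pullbackInner_apply]
  ring

/-- The plate bending form on `H²(K)`. -/
noncomputable def energy (ν : ℝ) : P.sobolev →L[ℝ] P.sobolev →L[ℝ] ℝ :=
  bendingForm ν P.laplacian fun i j => P.component (.inr (.inr (i, j)))

theorem energy_apply (ν : ℝ) (U W : P.sobolev) :
    P.energy ν U W = ν * inner ℝ (P.laplacian U) (P.laplacian W) +
      (1 - ν) * ∑ i, ∑ j, inner ℝ (P.component (.inr (.inr (i, j))) U)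
        (P.component (.inr (.inr (i, j))) W) :=
  bendingForm_apply _ _ _ _ _

/-- For negative `ν` this uses that the square of the Laplacian is at most twice that of the
Hessian. -/
theorem mul_hessNormSq_le_energy (ν : ℝ) (U : P.sobolev) :
    min (1 - ν) (1 + ν) * P.hessNormSq U ≤ P.energy ν U U := by
  rw [energy_apply]
  simp only [real_inner_self_eq_norm_sq]
  change _ ≤ ν * ‖P.laplacian U‖ ^ 2 + (1 - ν) * P.hessNormSq U
  have h0 : 0 ≤ P.hessNormSq U := Finset.sum_nonneg fun i _ => Finset.sum_nonneg
    fun j _ => by positivity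
  rcases le_total 0 ν with h | h
  · have h1 : min (1 - ν) (1 + ν) ≤ 1 - ν := min_le_left _ _
    nlinarith [sq_nonneg ‖P.laplacian U‖]
  · have h1 : min (1 - ν) (1 + ν) ≤ 1 + ν := min_le_right _ _
    have h2 : ‖P.laplacian U‖ ^ 2 ≤ 2 * P.hessNormSq U := by
      have e : P.laplacian U = P.component (.inr (.inr (0, 0))) U +
          P.component (.inr (.inr (1, 1))) U := by
        simp [laplacian, Fin.sum_univ_two]
      have h3 := norm_add_le (P.component (.inr (.inr (0, 0))) U)
        (P.component (.inr (.inr (1, 1))) U)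
      rw [← e] at h3
      simp only [hessNormSq, Fin.sum_univ_two]
      nlinarith [norm_nonneg (P.laplacian U),
        sq_nonneg (‖P.component (.inr (.inr (0, 0))) U‖ - ‖P.component (.inr (.inr (1, 1))) U‖),
        sq_nonneg ‖P.component (.inr (.inr (0, 1))) U‖,
        sq_nonneg ‖P.component (.inr (.inr (1, 0))) U‖]
    nlinarith

/-- The plate bending form is coercive on the functions whose degrees of freedom vanish. -/
theorem exists_mul_norm_sq_le_energy {ν : ℝ} (hν : -1 < ν) (hν' : ν < 1) (ℓ : ℕ) :
    ∃ c : ℝ, 0 < c ∧ ∀ U ∈ LinearMap.ker (P.dofs ℓ), c * ‖U‖ ^ 2 ≤ P.energy ν U U := by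
  obtain ⟨C, hC⟩ := P.exists_norm_sq_le_hessNormSq ℓ
  have hm : 0 < min (1 - ν) (1 + ν) := lt_min (by linarith) (by linarith)
  refine ⟨min (1 - ν) (1 + ν) / (C + 1), by positivity, fun U hU => ?_⟩
  refine le_trans ?_ (P.mul_hessNormSq_le_energy ν U)
  have h0 : 0 ≤ P.hessNormSq U := Finset.sum_nonneg fun i _ => Finset.sum_nonneg
    fun j _ => by positivity
  have h1 := hC U hU
  have h2 : ‖U‖ ^ 2 / (C + 1) ≤ P.hessNormSq U := by
    rw [div_le_iff₀ (by positivity)]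
    nlinarith
  calc _ = min (1 - ν) (1 + ν) * (‖U‖ ^ 2 / (C + 1)) := by ring
    _ ≤ _ := by gcongr

/-- A bounded bilinear form that is coercive on a closed subspace has a critical point on each of
its translates. -/
theorem exists_critical {V : Type*} [NormedAddCommGroup V] [InnerProductSpace ℝ V] [CompleteSpace V]
    (B : V →L[ℝ] V →L[ℝ] ℝ) (N : Submodule ℝ V) (hN : IsClosed (N : Set V)) {c : ℝ} (hc : 0 < c)
    (h : ∀ w ∈ N, c * ‖w‖ ^ 2 ≤ B w w) (u : V) : ∃ w ∈ N, ∀ z ∈ N, B (u + w) z = 0 := by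
  have : CompleteSpace N := hN.completeSpace_coe
  let BN : N →L[ℝ] N →L[ℝ] ℝ := B.bilinearComp N.subtypeL N.subtypeL
  have hcoe : IsCoercive BN := ⟨c, hc, fun w => by
    have := h w w.2
    rw [pow_two, ← mul_assoc] at this
    exact this⟩
  let r : N := (InnerProductSpace.toDual ℝ N).symm (-(B u).comp N.subtypeL)
  refine ⟨hcoe.continuousLinearEquivOfBilin.symm r, Subtype.coe_prop _, fun z hz => ?_⟩
  have h1 := hcoe.continuousLinearEquivOfBilin_apply (hcoe.continuousLinearEquivOfBilin.symm r)
    ⟨z, hz⟩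
  rw [ContinuousLinearEquiv.apply_symm_apply, InnerProductSpace.toDual_symm_apply] at h1
  have h2 : -(B u z) = B (hcoe.continuousLinearEquivOfBilin.symm r) z := h1
  rw [map_add, add_apply, ← h2, add_neg_cancel]

end PlanePolygon

/-! ### Independence of the degrees of freedom -/

theorem mvPolynomial_eq_zero_of_eventually {p : MvPolynomial (Fin 2) ℝ} {x : Plane}
    (h : ∀ᶠ y in 𝓝 x, polyFun p y = 0) : p = 0 := by
  have h1 : ∀ᶠ y in 𝓝 (WithLp.ofLp x), polyFun p (WithLp.toLp 2 y) = 0 :=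
    ((PiLp.continuous_toLp 2 (fun _ : Fin 2 => ℝ)).tendsto (WithLp.ofLp x)).eventually h
  obtain ⟨r, hr, hb⟩ := Metric.eventually_nhds_iff_ball.1 h1
  refine MvPolynomial.funext_set (fun i => Metric.ball (x i) r) (fun i => ?_) fun y hy => ?_
  · rw [Real.ball_eq_Ioo]
    exact Set.Ioo_infinite (by linarith)
  · rw [map_zero]
    refine hb y ?_
    rw [ball_pi _ hr]
    exact hy

theorem polynomial_eq_zero_of_integral {w : ℝ → ℝ} (hw : Continuous w) (h0 : ∀ s, 0 ≤ w s)
    (h1 : 0 < w (1 / 2)) {q : Polynomial ℝ} (h : ∫ s in (0 : ℝ)..1, w s * q.eval s ^ 2 = 0) :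
    q = 0 := by
  by_contra hq
  have hU : {s : ℝ | 0 < w s} ∩ Set.Ioo 0 1 ∈ 𝓝 (1 / 2 : ℝ) :=
    inter_mem (hw.continuousAt.eventually (lt_mem_nhds h1)) (Ioo_mem_nhds (by norm_num)
      (by norm_num))
  have hinf : ({s : ℝ | 0 < w s} ∩ Set.Ioo 0 1).Infinite := infinite_of_mem_nhds _ hU
  obtain ⟨s, ⟨hs1, hs2⟩, hs⟩ : ∃ s ∈ {s : ℝ | 0 < w s} ∩ Set.Ioo 0 1, q.eval s ≠ 0 := by
    by_contra! hall
    exact hq (Polynomial.eq_zero_of_infinite_isRoot q (hinf.mono hall))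
  have hpos : 0 < ∫ s in (0 : ℝ)..1, w s * q.eval s ^ 2 := by
    refine intervalIntegral.integral_pos zero_lt_one
      (hw.mul (q.continuous.pow 2)).continuousOn (fun s _ => mul_nonneg (h0 s) (sq_nonneg _))
      ⟨s, Set.Ioo_subset_Icc_self hs2, mul_pos hs1 (by positivity)⟩
  exact hpos.ne' h

namespace PlanePolygon

variable {n : ℕ} (P : PlanePolygon n)

theorem add_one_ne (P : PlanePolygon n) (i : ZMod n) : i + 1 ≠ i := fun h =>
  P.vertex_ne i (by rw [h])

theorem edgePt_notMem_edge {i j : ZMod n} (hij : j ≠ i) : P.edgePt i (1 / 2) ∉ P.edge j := by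
  have hinj : ∀ s : ℝ, s ≠ 1 / 2 → P.edgePt i (1 / 2) ≠ P.edgePt i s := by
    intro s hs h
    rw [edgePt_eq, edgePt_eq, add_right_inj] at h
    exact hs (smul_left_injective ℝ (sub_ne_zero.2 (P.vertex_ne i)) h).symm
  intro h
  rcases P.exists_eq_vertex_of_mem_edge hij (P.edgePt_mem_edge i (by norm_num)) h with h | h
  · refine hinj 1 (by norm_num) (h.2.trans ?_)
    rw [edgePt_eq]; simp
  · refine hinj 0 (by norm_num) (h.2.trans ?_)
    rw [edgePt_eq, ← h.1]; simp

/-- The part of the plane away from all edges but one. -/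
theorem isOpen_compl_edges (i : ZMod n) : IsOpen {x | ∀ j, j ≠ i → x ∉ P.edge j} := by
  rw [isOpen_iff_mem_nhds]
  intro x hx
  filter_upwards [P.eventually_not_mem_edge {j | j ≠ i} hx] with y hy
  exact hy

theorem apply_vertex_eq_zero {i : ZMod n} {φ : Plane → ℝ}
    (h : ∀ j, j ≠ i → Disjoint (tsupport φ) (P.edge j)) (k : ZMod n) : φ (P.vertex k) = 0 := by
  refine image_eq_zero_of_notMem_tsupport fun hk => ?_
  by_cases hki : k = i
  · have h1 : k - 1 ≠ i := fun h' =>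
      P.add_one_ne (k - 1) (by rw [sub_add_cancel, h', hki])
    have h2 := P.vertex_add_one_mem_edge (k - 1)
    rw [sub_add_cancel] at h2
    exact Set.disjoint_left.1 (h _ h1) hk h2
  · exact Set.disjoint_left.1 (h k hki) hk (P.vertex_mem_edge k)

theorem edgeIntegral_eq_zero (i : ZMod n) {f : ℝ → ℝ} (h : ∀ s ∈ Set.Icc (0 : ℝ) 1, f s = 0) :
    P.edgeIntegral i f = 0 := by
  rw [edgeIntegral, intervalIntegral.integral_congr (g := fun _ => 0)]
  · simp
  · intro s hs
    rw [Set.uIcc_of_le zero_le_one] at hs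
    exact h s hs

theorem edgePt_notMem_tsupport {i : ZMod n} {φ : Plane → ℝ}
    (h : Disjoint (tsupport φ) (P.edge i)) {s : ℝ} (hs : s ∈ Set.Icc (0 : ℝ) 1) :
    P.edgePt i s ∉ tsupport φ :=
  fun h' => Set.disjoint_left.1 h h' (P.edgePt_mem_edge i hs)

theorem normalDeriv_eq_zero {i : ZMod n} {φ : Plane → ℝ}
    (h : Disjoint (tsupport φ) (P.edge i)) {s : ℝ} (hs : s ∈ Set.Icc (0 : ℝ) 1) :
    P.normalDeriv i φ s = 0 :=
  Finset.sum_eq_zero fun j _ => by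
    rw [pd_eq_zero_of_notMem_tsupport (P.edgePt_notMem_tsupport h hs), zero_mul]

/-- The degrees of freedom of a smooth function, combined by means of coefficients. -/
theorem dual_dofs_smoothJet [NeZero n] {ℓ : ℕ} {Λ : Module.Dual ℝ (DofData n ℓ)} {c : ZMod n → ℝ}
    {g : ZMod n → edgePoly ((ℓ : ℤ) - 2)} {h : ZMod n → edgePoly ((ℓ : ℤ) - 3)}
    {p : cellPoly ((ℓ : ℤ) - 4)} (hΛ : ∀ d : DofData n ℓ, Λ d =
        ∑ i, c i * d.1 i + ∑ i, d.2.1 i (g i) + ∑ i, d.2.2.1 i (h i) + d.2.2.2 p) (φ : smoothFns) :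
    Λ (P.dofs ℓ (P.smoothJet φ)) = ∑ i, c i * (φ : Plane → ℝ) (P.vertex i) +
      ∑ i, P.edgeIntegral i (fun s => P.normalDeriv i φ s * (g i).1.eval s) +
      ∑ i, (P.edgeLength i)⁻¹ *
        P.edgeIntegral i (fun s => (φ : Plane → ℝ) (P.edgePt i s) * (h i).1.eval s) +
      (volume.real P.carrier)⁻¹ * ∫ x, (φ : Plane → ℝ) x * polyFun p.1 x ∂P.vol := by
  simp only [← vertexValue_smoothJet, ← normalMoment_smoothJet, ← valueMoment_smoothJet,
    ← cellMoment_smoothJet]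
  exact hΛ _

theorem dual_dofs_smoothJet_of_disjoint [NeZero n] {ℓ : ℕ} {Λ : Module.Dual ℝ (DofData n ℓ)}
    {c : ZMod n → ℝ} {g : ZMod n → edgePoly ((ℓ : ℤ) - 2)} {h : ZMod n → edgePoly ((ℓ : ℤ) - 3)}
    {p : cellPoly ((ℓ : ℤ) - 4)} (hΛ : ∀ d : DofData n ℓ, Λ d =
        ∑ i, c i * d.1 i + ∑ i, d.2.1 i (g i) + ∑ i, d.2.2.1 i (h i) + d.2.2.2 p) (φ : smoothFns)
    {i : ZMod n} (hφ : ∀ j, j ≠ i → Disjoint (tsupport (φ : Plane → ℝ)) (P.edge j)) :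
    Λ (P.dofs ℓ (P.smoothJet φ)) =
      P.edgeIntegral i (fun s => P.normalDeriv i φ s * (g i).1.eval s) + (P.edgeLength i)⁻¹ *
        P.edgeIntegral i (fun s => (φ : Plane → ℝ) (P.edgePt i s) * (h i).1.eval s) +
      (volume.real P.carrier)⁻¹ * ∫ x, (φ : Plane → ℝ) x * polyFun p.1 x ∂P.vol := by
  rw [P.dual_dofs_smoothJet hΛ]
  congr 2
  · rw [Finset.sum_eq_zero fun k _ => by rw [P.apply_vertex_eq_zero hφ k, mul_zero], zero_add]
    refine Finset.sum_eq_single i (fun j _ hj => P.edgeIntegral_eq_zero j fun s hs => ?_)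
      fun h => absurd (Finset.mem_univ i) h
    rw [P.normalDeriv_eq_zero (hφ j hj) hs, zero_mul]
  · refine Finset.sum_eq_single i (fun j _ hj => ?_) fun h => absurd (Finset.mem_univ i) h
    rw [P.edgeIntegral_eq_zero j fun s hs => ?_, mul_zero]
    rw [image_eq_zero_of_notMem_tsupport (P.edgePt_notMem_tsupport (hφ j hj) hs), zero_mul]

theorem sq_edgeLength (i : ZMod n) : P.edgeLength i ^ 2 =
    ∑ j, (P.vertex (i + 1) j - P.vertex i j) ^ 2 := by
  rw [edgeLength, dist_comm, EuclideanSpace.dist_eq, Real.sq_sqrt (by positivity)]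
  simp only [Real.dist_eq, sq_abs]

theorem sum_normal_sq (i : ZMod n) : ∑ j, P.normal i j * P.normal i j = 1 := by
  have h1 := P.sq_edgeLength i
  have h2 := (P.edgeLength_pos i).ne'
  rw [Fin.sum_univ_two] at h1
  simp only [normal, Fin.sum_univ_two, PiLp.smul_apply, smul_eq_mul, Matrix.cons_val_zero,
    Matrix.cons_val_one]
  field_simp
  linarith

/-- The affine function that vanishes on an edge and whose normal derivative is one. -/
noncomputable def normalCoord (i : ZMod n) : smoothFns :=
  affineFn (-∑ j, P.normal i j * P.vertex i j, fun j => P.normal i j)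

theorem normalCoord_edgePt (i : ZMod n) (s : ℝ) :
    (P.normalCoord i : Plane → ℝ) (P.edgePt i s) = 0 := by
  rw [normalCoord, affineFn_apply, edgePt_eq]
  simp only [normal, Fin.sum_univ_two, PiLp.smul_apply, PiLp.add_apply, PiLp.sub_apply,
    smul_eq_mul, Matrix.cons_val_zero, Matrix.cons_val_one]
  ring

/-- The affine function that agrees on an edge with the affine parameter. -/
noncomputable def tangentCoord (i : ZMod n) : smoothFns :=
  affineFn (-∑ j, (P.vertex (i + 1) j - P.vertex i j) / P.edgeLength i ^ 2 * P.vertex i j,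
    fun j => (P.vertex (i + 1) j - P.vertex i j) / P.edgeLength i ^ 2)

theorem tangentCoord_edgePt (i : ZMod n) (s : ℝ) :
    (P.tangentCoord i : Plane → ℝ) (P.edgePt i s) = s := by
  have h1 := P.sq_edgeLength i
  have h2 := (P.edgeLength_pos i).ne'
  rw [Fin.sum_univ_two] at h1
  rw [tangentCoord, affineFn_apply, edgePt_eq]
  simp only [Fin.sum_univ_two, PiLp.smul_apply, PiLp.add_apply, PiLp.sub_apply,
    smul_eq_mul]
  field_simp
  rw [h1]
  ring

theorem contDiff_polynomial_eval (q : Polynomial ℝ) : ContDiff ℝ ∞ fun s => q.eval s := by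
  simpa only [Polynomial.coe_aeval_eq_eval] using q.contDiff_aeval (𝕜 := ℝ) ∞

/-- A linear functional that vanishes on all degrees of freedom is zero: its coefficients are
polynomials on `K`, polynomials on the edges and numbers at the vertices, which are seen to vanish, in
this order, by testing with themselves times a bump function. To test the moments of the normal
derivative on an edge, that product is multiplied by the signed distance to the edge. -/
theorem dofs_surjective (ℓ : ℕ) : Function.Surjective (P.dofs ℓ) := by
  have := P.neZero
  rw [← LinearMap.range_eq_top]
  by_contra hne
  obtain ⟨Λ, hΛ0, hΛr⟩ := Submodule.exists_le_ker_of_lt_top _ (lt_top_iff_ne_top.2 hne)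
  have hz : ∀ φ : smoothFns, Λ (P.dofs ℓ (P.smoothJet φ)) = 0 := fun φ =>
    LinearMap.mem_ker.1 (hΛr ⟨_, rfl⟩)
  obtain ⟨c, g, h, p, hΛ⟩ := exists_dual_eq Λ
  have hK : volume.real P.carrier ≠ 0 := by
    rw [measureReal_def]
    exact (ENNReal.toReal_pos (P.isOpen.measure_pos volume P.isConnected.nonempty).ne'
      P.volume_ne_top).ne'
  have hp : p.1 = 0 := by
    obtain ⟨x, hx⟩ := P.isConnected.nonempty
    obtain ⟨χ, hχ, hχ1, hχK, hχ0⟩ := exists_test_one (isCompact_singleton (x := x)) P.isOpen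
      (Set.singleton_subset_iff.2 hx)
    have hpc : ContDiff ℝ ∞ (polyFun p.1) := by
      have : ContDiff ℝ ∞ fun x : Plane => MvPolynomial.eval (fun i => x i) p.1 := by
        induction p.1 using MvPolynomial.induction_on with
        | C a => simpa using contDiff_const
        | add p q hp hq => simpa using hp.add hq
        | mul_X p i hp =>
          simpa using hp.mul (EuclideanSpace.proj i : Plane →L[ℝ] ℝ).contDiff
      exact this
    set φ : smoothFns := ⟨χ * polyFun p.1, hχ.smooth.mul hpc⟩ with hφ
    have hs : tsupport (φ : Plane → ℝ) ⊆ P.carrier := tsupport_mul_subset_left.trans hχK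
    have hd : ∀ j, Disjoint (tsupport (φ : Plane → ℝ)) (P.edge j) := fun j =>
      Set.disjoint_left.2 fun y hy hj => by
        have := P.edge_subset_frontier j hj
        rw [P.isOpen.frontier_eq] at this
        exact this.2 (hs hy)
    have h1 := hz φ
    rw [P.dual_dofs_smoothJet_of_disjoint hΛ φ (i := 0) fun j _ => hd j,
      P.edgeIntegral_eq_zero 0 fun s hs => by rw [P.normalDeriv_eq_zero (hd 0) hs, zero_mul],
      P.edgeIntegral_eq_zero 0 fun s hs => by
        rw [image_eq_zero_of_notMem_tsupport (P.edgePt_notMem_tsupport (hd 0) hs), zero_mul],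
      mul_zero, zero_add, zero_add, mul_eq_zero, or_iff_right (inv_ne_zero hK)] at h1
    have h2 : ∀ y, (φ : Plane → ℝ) y * polyFun p.1 y = χ y * polyFun p.1 y ^ 2 := fun y => by
      change χ y * polyFun p.1 y * polyFun p.1 y = _
      ring
    have hcont : Continuous fun y => (φ : Plane → ℝ) y * polyFun p.1 y :=
      (smoothFns_contDiff φ).continuous.mul hpc.continuous
    have hint : Integrable (fun y => (φ : Plane → ℝ) y * polyFun p.1 y) P.vol :=
      P.integrable_mul_continuous (P.memLp_of_continuous (smoothFns_contDiff φ).continuous)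
        hpc.continuous
    rw [integral_eq_zero_iff_of_nonneg (fun y => by
      change 0 ≤ (φ : Plane → ℝ) y * polyFun p.1 y
      rw [h2]; exact mul_nonneg (hχ0 y).1 (sq_nonneg _)) hint] at h1
    have h3 := Measure.eqOn_open_of_ae_eq h1 P.isOpen hcont.continuousOn continuousOn_const
    refine mvPolynomial_eq_zero_of_eventually (x := x) ?_
    rw [nhdsSet_singleton] at hχ1
    filter_upwards [hχ1, P.isOpen.mem_nhds hx] with y hy hyK
    have h4 : (φ : Plane → ℝ) y * polyFun p.1 y = 0 := h3 hyK
    rw [h2, hy, one_mul] at h4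
    exact pow_eq_zero_iff two_ne_zero |>.1 h4
  have hp0 : ∀ y, polyFun p.1 y = 0 := fun y => by rw [hp]; simp [polyFun]
  -- a bump function near the midpoint of the edge `i` that vanishes near all other edges
  have bump : ∀ i, ∃ χ : Plane → ℝ, IsTest χ ∧ χ (P.edgePt i (1 / 2)) = 1 ∧ (∀ x, 0 ≤ χ x) ∧
      ∀ j, j ≠ i → Disjoint (tsupport χ) (P.edge j) := by
    intro i
    obtain ⟨χ, hχ, hχ1, hχO, hχ0⟩ := exists_test_one (isCompact_singleton (x := P.edgePt i (1 / 2)))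
      (P.isOpen_compl_edges i) (Set.singleton_subset_iff.2 fun j hj => P.edgePt_notMem_edge hj)
    rw [nhdsSet_singleton] at hχ1
    exact ⟨χ, hχ, hχ1.self_of_nhds, fun x => (hχ0 x).1, fun j hj =>
      Set.disjoint_left.2 fun x hx hxj => hχO hx j hj hxj⟩
  have hpoly : ∀ (i : ZMod n) (q : Polynomial ℝ),
      ContDiff ℝ ∞ fun x => q.eval ((P.tangentCoord i : Plane → ℝ) x) := fun i q =>
    (contDiff_polynomial_eval q).comp (smoothFns_contDiff _)
  have hg : ∀ i, (g i).1 = 0 := by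
    intro i
    obtain ⟨χ, hχ, hχ1, hχ0, hχd⟩ := bump i
    have hψ : ContDiff ℝ ∞ fun x => χ x * (g i).1.eval ((P.tangentCoord i : Plane → ℝ) x) :=
      hχ.smooth.mul (hpoly i _)
    set ψ : Plane → ℝ := fun x => χ x * (g i).1.eval ((P.tangentCoord i : Plane → ℝ) x) with hψd
    set φ : smoothFns := ⟨(P.normalCoord i : Plane → ℝ) * ψ, (smoothFns_contDiff _).mul hψ⟩
    have hs : tsupport (φ : Plane → ℝ) ⊆ tsupport χ :=
      tsupport_mul_subset_right.trans tsupport_mul_subset_left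
    have h1 := hz φ
    rw [P.dual_dofs_smoothJet_of_disjoint hΛ φ fun j hj => (hχd j hj).mono_left hs] at h1
    have e1 : ∀ s, (φ : Plane → ℝ) (P.edgePt i s) = 0 := fun s => by
      change (P.normalCoord i : Plane → ℝ) (P.edgePt i s) * _ = 0
      rw [normalCoord_edgePt, zero_mul]
    have e2 : ∀ s, P.normalDeriv i φ s * (g i).1.eval s =
        χ (P.edgePt i s) * (g i).1.eval s ^ 2 := by
      intro s
      have : ∀ j, pd j (φ : Plane → ℝ) (P.edgePt i s) = P.normal i j * ψ (P.edgePt i s) := by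
        intro j
        have := pd_mul (smoothFns_contDiff (P.normalCoord i)) hψ j (P.edgePt i s)
        rw [normalCoord_edgePt, zero_mul, zero_add] at this
        refine this.trans ?_
        rw [normalCoord, pd_affineFn]
      have h4 : P.normalDeriv i φ s = ψ (P.edgePt i s) := by
        rw [normalDeriv]
        simp only [this]
        calc _ = (∑ j, P.normal i j * P.normal i j) * ψ (P.edgePt i s) := by
              rw [Finset.sum_mul]; exact Finset.sum_congr rfl fun j _ => by ring
          _ = _ := by rw [sum_normal_sq, one_mul]
      rw [h4, hψd]
      simp only [tangentCoord_edgePt]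
      ring
    simp only [e1, e2, hp0, zero_mul, mul_zero, integral_zero, add_zero] at h1
    rw [P.edgeIntegral_eq_zero i (f := fun _ => 0) fun _ _ => rfl, mul_zero, add_zero, edgeIntegral,
      mul_eq_zero, or_iff_right (P.edgeLength_pos i).ne'] at h1
    exact polynomial_eq_zero_of_integral (hχ.smooth.continuous.comp (P.continuous_edgePt i))
      (fun s => hχ0 _) (by rw [Function.comp_apply, hχ1]; exact one_pos) h1
  have hh : ∀ i, (h i).1 = 0 := by
    intro i
    obtain ⟨χ, hχ, hχ1, hχ0, hχd⟩ := bump i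
    set φ : smoothFns := ⟨fun x => χ x * (h i).1.eval ((P.tangentCoord i : Plane → ℝ) x),
      hχ.smooth.mul (hpoly i _)⟩
    have hs : tsupport (φ : Plane → ℝ) ⊆ tsupport χ := tsupport_mul_subset_left
    have h1 := hz φ
    rw [P.dual_dofs_smoothJet_of_disjoint hΛ φ fun j hj => (hχd j hj).mono_left hs] at h1
    have e1 : ∀ s, (φ : Plane → ℝ) (P.edgePt i s) * (h i).1.eval s =
        χ (P.edgePt i s) * (h i).1.eval s ^ 2 := fun s => by
      change χ (P.edgePt i s) * (h i).1.eval ((P.tangentCoord i : Plane → ℝ) (P.edgePt i s)) * _ = _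
      rw [tangentCoord_edgePt]
      ring
    simp only [e1, hg, hp0, Polynomial.eval_zero, mul_zero, integral_zero, add_zero] at h1
    rw [P.edgeIntegral_eq_zero i (f := fun _ => 0) fun _ _ => rfl, zero_add, edgeIntegral,
      inv_mul_cancel_left₀ (P.edgeLength_pos i).ne'] at h1
    exact polynomial_eq_zero_of_integral (hχ.smooth.continuous.comp (P.continuous_edgePt i))
      (fun s => hχ0 _) (by rw [Function.comp_apply, hχ1]; exact one_pos) h1
  have hc : ∀ i, c i = 0 := by
    intro i
    have hfin : IsClosed (P.vertex '' {j | j ≠ i}) := (Set.toFinite _).isClosed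
    obtain ⟨χ, hχ, hχ1, hχO, -⟩ := exists_test_one (isCompact_singleton (x := P.vertex i))
      hfin.isOpen_compl (Set.singleton_subset_iff.2 fun ⟨j, hj, hji⟩ =>
        hj (P.vertex_injective hji))
    rw [nhdsSet_singleton] at hχ1
    have h1 := hz ⟨χ, hχ.smooth⟩
    rw [P.dual_dofs_smoothJet hΛ, Finset.sum_eq_single i] at h1
    · have h2 : χ (P.vertex i) = 1 := hχ1.self_of_nhds
      simp only [hg, hh, hp0, Polynomial.eval_zero, mul_zero, integral_zero, add_zero, h2,
        mul_one] at h1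
      rw [Finset.sum_eq_zero fun j _ => P.edgeIntegral_eq_zero j (f := fun _ => 0) fun _ _ => rfl,
        Finset.sum_eq_zero fun j _ => by
          rw [P.edgeIntegral_eq_zero j (f := fun _ => 0) fun _ _ => rfl, mul_zero]] at h1
      simpa using h1
    · intro j _ hj
      have : χ (P.vertex j) = 0 := image_eq_zero_of_notMem_tsupport fun h' => hχO h' ⟨j, hj, rfl⟩
      simp [this]
    · exact fun h => absurd (Finset.mem_univ i) h
  refine hΛ0 (LinearMap.ext fun d => ?_)
  rw [hΛ, show p = 0 from Subtype.ext hp]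
  simp only [show ∀ i, g i = 0 from fun i => Subtype.ext (hg i),
    show ∀ i, h i = 0 from fun i => Subtype.ext (hh i), hc, map_zero, zero_mul]
  simp

end PlanePolygon

/-! ### Existence -/

theorem lap_eq_add (φ : Plane → ℝ) : lap φ = pd 0 (pd 0 φ) + pd 1 (pd 1 φ) := by
  ext x
  simp [lap, Fin.sum_univ_two]

theorem IsTest.mem_smoothFns {φ : Plane → ℝ} (h : IsTest φ) : φ ∈ smoothFns := h.smooth

namespace PlanePolygon

variable {n : ℕ} (P : PlanePolygon n)

theorem inner_component_smoothJet (u : P.L2) (k : JetIndex) (φ : smoothFns) :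
    inner ℝ u (P.component k (P.smoothJet φ)) = ∫ x, u x * jetDeriv k φ x ∂P.vol := by
  rw [P.integral_mul_eq_inner u (contDiff_jetDeriv (smoothFns_contDiff φ) k).continuous,
    real_inner_comm]
  rfl

theorem inner_laplacian_smoothJet (u : P.L2) {φ : Plane → ℝ} (hφ : IsTest φ) :
    inner ℝ u (P.laplacian (P.smoothJet ⟨φ, hφ.mem_smoothFns⟩)) = ∫ x, u x * lap φ x ∂P.vol := by
  rw [laplacian, _root_.sum_apply, inner_sum]
  simp only [inner_component_smoothJet]
  change ∑ i, ∫ x, u x * pd i (pd i φ) x ∂P.vol = _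
  rw [← integral_finsetSum _ fun i _ => P.integrable_mul u ((hφ.pd i).pd i)]
  congr 1
  ext x
  rw [lap, Finset.mul_sum]

/-- The Hessian of a member of `H²(K)`. -/
noncomputable def hessian (U : P.sobolev) (i j : Fin 2) : P.L2 := U.1 (.inr (.inr (i, j)))

/-- The bending form on `H²(K)` extends the one of the definition of the natural traces. -/
theorem energy_smoothJet (ν : ℝ) (U : P.sobolev) {φ : Plane → ℝ} (hφ : IsTest φ) :
    P.energy ν U (P.smoothJet ⟨φ, hφ.mem_smoothFns⟩) = P.plateForm ν (P.hessian U) φ := by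
  rw [energy_apply, P.plateForm_eq ν _ hφ, P.inner_laplacian_smoothJet _ hφ]
  congr 2
  · rw [← P.inner_laplacian_smoothJet _ hφ, laplacian, _root_.sum_apply, sum_inner]
    exact Finset.sum_congr rfl fun i _ => P.inner_laplacian_smoothJet _ hφ
  · exact Finset.sum_congr rfl fun i _ => Finset.sum_congr rfl fun j _ =>
      P.inner_component_smoothJet _ _ _

theorem hasWeakHessian (U : P.sobolev) :
    P.HasWeakHessian (U.1 (.inl ())) (fun i => U.1 (.inr (.inl i))) (P.hessian U) :=
  P.hasWeakHessian_of_mem_sobolev U.2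

theorem integral_hess_mul {u : P.L2} {G : Fin 2 → P.L2} {H : Fin 2 → Fin 2 → P.L2}
    (h : P.HasWeakHessian u G H) (i j : Fin 2) {φ : Plane → ℝ} (hφ : IsTest φ)
    (hs : tsupport φ ⊆ P.carrier) :
    ∫ x, H i j x * φ x ∂P.vol = ∫ x, u x * pd i (pd j φ) x ∂P.vol := by
  have h1 := h.grad i (pd j φ) (hφ.pd j) ((tsupport_pd_subset φ j).trans hs)
  have h2 := h.hess i j φ hφ hs
  linarith

theorem pd_pd_lap {φ : Plane → ℝ} (hφ : IsTest φ) (i : Fin 2) (x : Plane) :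
    pd i (pd i (lap φ)) x = ∑ j, pd i (pd j (pd j (pd i φ))) x := by
  have c := contDiff_pd hφ.smooth
  have c2 := fun i j => contDiff_pd (c i) j
  have hcomm : ∀ j, pd j (pd j (pd i φ)) = pd i (pd j (pd j φ)) := by
    intro j
    have h1 : pd j (pd i φ) = pd i (pd j φ) := funext (pd_comm hφ.smooth i j)
    rw [h1]
    exact funext (pd_comm (c j) i j)
  simp only [hcomm]
  rw [lap_eq_add, pd_add (c2 0 0) (c2 1 1),
    pd_add (contDiff_pd (c2 0 0) i) (contDiff_pd (c2 1 1) i), Fin.sum_univ_two]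
  rfl

/-- Integration by parts in the interior of `K`. -/
theorem plateForm_eq_integral_bilaplacian (ν : ℝ) {u : P.L2} {G : Fin 2 → P.L2}
    {H : Fin 2 → Fin 2 → P.L2} (h : P.HasWeakHessian u G H) {φ : Plane → ℝ} (hφ : IsTest φ)
    (hs : tsupport φ ⊆ P.carrier) :
    P.plateForm ν H φ = ∫ x, u x * lap (lap φ) x ∂P.vol := by
  have hsl : tsupport (lap φ) ⊆ P.carrier := by
    refine (closure_minimal (fun x hx => ?_) (isClosed_tsupport φ)).trans hs
    by_contra hx'
    exact hx (Finset.sum_eq_zero fun i _ => pd_eq_zero_of_notMem_tsupport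
      (fun h => hx' (tsupport_pd_subset φ i h)) i)
  have e1 : ∑ i, ∫ x, H i i x * lap φ x ∂P.vol = ∫ x, u x * lap (lap φ) x ∂P.vol := by
    simp only [P.integral_hess_mul h _ _ hφ.lap hsl]
    rw [← integral_finsetSum _ fun i _ => P.integrable_mul u ((hφ.lap.pd i).pd i)]
    congr 1
    ext x
    rw [lap, Finset.mul_sum]
  have e2 : ∑ i, ∑ j, ∫ x, H i j x * pd j (pd i φ) x ∂P.vol =
      ∫ x, u x * lap (lap φ) x ∂P.vol := by
    rw [← e1]
    refine Finset.sum_congr rfl fun i _ => ?_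
    rw [P.integral_hess_mul h _ _ hφ.lap hsl]
    have : ∀ j, ∫ x, H i j x * pd j (pd i φ) x ∂P.vol =
        ∫ x, u x * pd i (pd j (pd j (pd i φ))) x ∂P.vol := fun j =>
      P.integral_hess_mul h i j ((hφ.pd i).pd j)
        ((tsupport_pd_subset _ j).trans ((tsupport_pd_subset _ i).trans hs))
    simp only [this]
    rw [← integral_finsetSum _ fun j _ => P.integrable_mul u ((((hφ.pd i).pd j).pd j).pd i)]
    congr 1
    ext x
    rw [pd_pd_lap hφ, Finset.mul_sum]
  rw [P.plateForm_eq ν H hφ, e1, e2]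
  ring

theorem disjoint_edge_of_tsupport_subset {φ : Plane → ℝ} (hs : tsupport φ ⊆ P.carrier)
    (j : ZMod n) : Disjoint (tsupport φ) (P.edge j) :=
  Set.disjoint_left.2 fun y hy hj => by
    have := P.edge_subset_frontier j hj
    rw [P.isOpen.frontier_eq] at this
    exact this.2 (hs hy)

theorem edgeIntegral_const_mul (i : ZMod n) (c : ℝ) (f : ℝ → ℝ) :
    P.edgeIntegral i (fun s => c * f s) = c * P.edgeIntegral i f := by
  rw [edgeIntegral, edgeIntegral, intervalIntegral.integral_const_mul]
  ring

/-- A member of `H²(K)` whose bending energy form only depends on the degrees of freedom of the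
test function belongs to the virtual element space. -/
theorem isLocalVE_of_energy_eq {ν : ℝ} {ℓ : ℕ} {U : P.sobolev}
    (Λ : Module.Dual ℝ (DofData n ℓ)) (hU : ∀ W, P.energy ν U W = Λ (P.dofs ℓ W)) :
    P.IsLocalVE ν ℓ (U.1 (.inl ())) := by
  have := P.neZero
  obtain ⟨c, g, h, p, hΛ⟩ := exists_dual_eq Λ
  set κ := (volume.real P.carrier)⁻¹ with hκ
  have hpl : ∀ (φ : Plane → ℝ) (hφ : IsTest φ), P.plateForm ν (P.hessian U) φ =
      Λ (P.dofs ℓ (P.smoothJet ⟨φ, hφ.mem_smoothFns⟩)) := fun φ hφ => by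
    rw [← hU, P.energy_smoothJet ν U hφ]
  have hcell : ∀ φ : Plane → ℝ, ∫ x, polyFun (κ • p.1) x * φ x ∂P.vol =
      κ * ∫ x, φ x * polyFun p.1 x ∂P.vol := by
    intro φ
    rw [← integral_const_mul]
    congr 1
    ext x
    simp only [polyFun, MvPolynomial.smul_eval]
    ring
  refine ⟨_, _, P.hasWeakHessian U, κ • p.1, Submodule.smul_mem _ _ p.2, ?_, fun i =>
    ⟨(g i).1, (g i).2, (-(P.edgeLength i)⁻¹) • (h i).1, Submodule.smul_mem _ _ (h i).2, ?_⟩⟩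
  · intro φ hφ hs
    have hd := P.disjoint_edge_of_tsupport_subset hs
    rw [← P.plateForm_eq_integral_bilaplacian ν (P.hasWeakHessian U) hφ hs, hpl φ hφ,
      P.dual_dofs_smoothJet_of_disjoint hΛ ⟨φ, hφ.mem_smoothFns⟩ (i := 0) fun j _ => hd j,
      P.edgeIntegral_eq_zero 0 fun s hs => by rw [P.normalDeriv_eq_zero (hd 0) hs, zero_mul],
      P.edgeIntegral_eq_zero 0 fun s hs => by
        change φ (P.edgePt 0 s) * _ = 0
        rw [image_eq_zero_of_notMem_tsupport (P.edgePt_notMem_tsupport (hd 0) hs), zero_mul],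
      hcell]
    simp [hκ]
  · intro φ hφ hd
    rw [hpl φ hφ, P.dual_dofs_smoothJet_of_disjoint hΛ ⟨φ, hφ.mem_smoothFns⟩ hd, hcell]
    have e1 : (fun s => P.normalDeriv i φ s * (g i).1.eval s) =
        fun s => (g i).1.eval s * P.normalDeriv i φ s := by
      ext s; ring
    have e2 : (fun s => ((-(P.edgeLength i)⁻¹) • (h i).1).eval s * φ (P.edgePt i s)) =
        fun s => -(P.edgeLength i)⁻¹ * (φ (P.edgePt i s) * (h i).1.eval s) := by
      ext s
      rw [Polynomial.eval_smul, smul_eq_mul]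
      ring
    rw [e1, e2, edgeIntegral_const_mul]
    ring

/-- There are members of the virtual element space with given degrees of freedom: minimize the
bending energy. -/
theorem exists_isLocalVE_dofs_eq {ν : ℝ} (hν : -1 < ν) (hν' : ν < 1) {ℓ : ℕ} (d : DofData n ℓ) :
    ∃ U : P.sobolev, P.IsLocalVE ν ℓ (U.1 (.inl ())) ∧ P.dofs ℓ U = d := by
  obtain ⟨c, hc, hcoe⟩ := P.exists_mul_norm_sq_le_energy hν hν' ℓ
  obtain ⟨U₀, hU₀⟩ := P.dofs_surjective ℓ d
  obtain ⟨W, hW, h⟩ := exists_critical (P.energy ν) _ (P.isClosed_ker_dofs ℓ) hc hcoe U₀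
  obtain ⟨r, hr⟩ := (P.dofs ℓ).exists_rightInverse_of_surjective
    (LinearMap.range_eq_top.2 (P.dofs_surjective ℓ))
  refine ⟨U₀ + W, P.isLocalVE_of_energy_eq ((P.energy ν (U₀ + W)).toLinearMap ∘ₗ r) fun V => ?_, ?_⟩
  · have hV : V - r (P.dofs ℓ V) ∈ LinearMap.ker (P.dofs ℓ) := by
      rw [LinearMap.mem_ker, map_sub]
      have := LinearMap.congr_fun hr (P.dofs ℓ V)
      rw [LinearMap.comp_apply, LinearMap.id_apply] at this
      rw [this, sub_self]
    have := h _ hV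
    rw [map_sub, sub_eq_zero] at this
    exact this
  · rw [map_add, hU₀, LinearMap.mem_ker.1 hW, add_zero]

end PlanePolygon

/-! ### Functionals concentrated at the vertices -/

theorem sq_enorm_integral_mul_le {α : Type*} [MeasurableSpace α] {μ : Measure α} {f g : α → ℝ}
    (hf : AEMeasurable f μ) (hg : AEMeasurable g μ) :
    ‖∫ x, f x * g x ∂μ‖ₑ ^ 2 ≤ (∫⁻ x, ‖f x‖ₑ ^ 2 ∂μ) * ∫⁻ x, ‖g x‖ₑ ^ 2 ∂μ := by
  have h1 : ‖∫ x, f x * g x ∂μ‖ₑ ≤ ∫⁻ x, ‖f x‖ₑ * ‖g x‖ₑ ∂μ := by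
    refine (enorm_integral_le_lintegral_enorm _).trans (le_of_eq ?_)
    simp only [enorm_mul]
  have h2 := ENNReal.lintegral_mul_le_Lp_mul_Lq μ Real.HolderConjugate.two_two hf.enorm hg.enorm
  have h3 : ∀ a : ℝ≥0∞, (a ^ (1 / 2 : ℝ)) ^ 2 = a := fun a => by
    rw [← ENNReal.rpow_natCast, ← ENNReal.rpow_mul]
    norm_num
  calc _ ≤ (∫⁻ x, ‖f x‖ₑ * ‖g x‖ₑ ∂μ) ^ 2 := by gcongr
    _ ≤ _ := pow_le_pow_left₀ zero_le h2 2
    _ = _ := by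
      rw [mul_pow, h3, h3]
      simp only [ENNReal.rpow_two]

theorem tendsto_zero_of_enorm_sq {ι : Type*} {l : Filter ι} {f : ι → ℝ}
    (h : Tendsto (fun i => ‖f i‖ₑ ^ 2) l (𝓝 0)) : Tendsto f l (𝓝 0) := by
  have h1 := (ENNReal.tendsto_toReal ENNReal.zero_ne_top).comp h
  have h2 := (Real.continuous_sqrt.tendsto _).comp h1
  rw [ENNReal.toReal_zero, Real.sqrt_zero] at h2
  rw [tendsto_zero_iff_norm_tendsto_zero]
  refine h2.congr fun i => ?_
  simp [Real.sqrt_sq_eq_abs]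

/-- The function `χ` shrunk by the factor `ε` and centred at `v`. -/
noncomputable def zoom (χ : Plane → ℝ) (v : Plane) (ε : ℝ) (x : Plane) : ℝ := χ (ε⁻¹ • (x - v))

theorem contDiff_zoom {χ : Plane → ℝ} (hχ : ContDiff ℝ ∞ χ) (v : Plane) (ε : ℝ) :
    ContDiff ℝ ∞ (zoom χ v ε) := by
  have : ContDiff ℝ ∞ fun x : Plane => ε⁻¹ • (x - v) := by fun_prop
  exact hχ.comp this

theorem pd_zoom {χ : Plane → ℝ} (hχ : ContDiff ℝ ∞ χ) (v : Plane) (ε : ℝ) (i : Fin 2) :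
    pd i (zoom χ v ε) = ε⁻¹ • zoom (pd i χ) v ε := by
  ext x
  have h1 : HasFDerivAt (fun x : Plane => ε⁻¹ • (x - v))
      (ε⁻¹ • ContinuousLinearMap.id ℝ Plane) x :=
    ((hasFDerivAt_id x).sub_const v).const_smul ε⁻¹
  have h2 := (hχ.differentiable (by simp) (ε⁻¹ • (x - v))).hasFDerivAt.comp x h1
  have h3 : fderiv ℝ (zoom χ v ε) x =
      (fderiv ℝ χ (ε⁻¹ • (x - v))).comp (ε⁻¹ • ContinuousLinearMap.id ℝ Plane) := h2.fderiv
  rw [pd, h3]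
  simp [zoom, pd]

theorem zoom_eq_zero {χ : Plane → ℝ} (hχ : ∀ x ∉ Metric.ball (0 : Plane) 1, χ x = 0) {v : Plane}
    {ε : ℝ} (hε : 0 < ε) {x : Plane} (hx : x ∉ Metric.ball v ε) : zoom χ v ε x = 0 := by
  refine hχ _ ?_
  rw [Metric.mem_ball, dist_eq_norm] at hx
  rw [Metric.mem_ball, dist_zero_right, norm_smul, norm_inv, Real.norm_of_nonneg hε.le, not_lt,
    inv_mul_eq_div, le_div_iff₀ hε, one_mul]
  exact not_lt.1 hx

/-- The Leibniz rule for a product with a shrunk function. -/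
theorem jetDeriv_mul_zoom {φ χ : Plane → ℝ} (hφ : ContDiff ℝ ∞ φ) (hχ : ContDiff ℝ ∞ χ)
    (v : Plane) (ε : ℝ) (x : Plane) :
    (∀ i, pd i (φ * zoom χ v ε) x =
      φ x * (ε⁻¹ * zoom (pd i χ) v ε x) + pd i φ x * zoom χ v ε x) ∧
    ∀ i j, pd j (pd i (φ * zoom χ v ε)) x =
      (φ x * (ε⁻¹ * (ε⁻¹ * zoom (pd j (pd i χ)) v ε x)) +
        pd j φ x * (ε⁻¹ * zoom (pd i χ) v ε x)) +
      (pd i φ x * (ε⁻¹ * zoom (pd j χ) v ε x) + pd j (pd i φ) x * zoom χ v ε x) := by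
  have hz := contDiff_zoom hχ v ε
  have hzi := fun i => contDiff_zoom (contDiff_pd hχ i) v ε
  have h1 : ∀ i, pd i (φ * zoom χ v ε) =
      φ * (ε⁻¹ • zoom (pd i χ) v ε) + pd i φ * zoom χ v ε := by
    intro i
    ext y
    rw [pd_mul hφ hz, pd_zoom hχ]
    rfl
  refine ⟨fun i => by rw [h1]; rfl, fun i j => ?_⟩
  have hsm : ContDiff ℝ ∞ (ε⁻¹ • zoom (pd i χ) v ε) := contDiff_const.smul (hzi i)
  have e1 : ContDiff ℝ ∞ (φ * ε⁻¹ • zoom (pd i χ) v ε) := hφ.mul hsm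
  have e2 : ContDiff ℝ ∞ (pd i φ * zoom χ v ε) := (contDiff_pd hφ i).mul hz
  rw [h1, pd_add e1 e2, Pi.add_apply, pd_mul hφ hsm,
    pd_mul (contDiff_pd hφ i) hz, pd_smul (hzi i), pd_zoom (contDiff_pd hχ i), pd_zoom hχ]
  rfl

theorem IsTest.exists_bound {φ : Plane → ℝ} (hφ : IsTest φ) : ∃ C : ℝ, 0 ≤ C ∧
    ∀ k x, |jetDeriv k φ x| ≤ C := by
  have h1 : ∀ k, ∃ C : ℝ, ∀ x, |jetDeriv k φ x| ≤ C := by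
    intro k
    have hc : HasCompactSupport (jetDeriv k φ) := by
      rcases k with _ | i | ⟨i, j⟩
      · exact hφ.compact
      · exact (hφ.pd i).compact
      · exact ((hφ.pd i).pd j).compact
    exact hc.exists_bound_of_continuous (contDiff_jetDeriv hφ.smooth k).continuous
  choose C hC using h1
  refine ⟨∑ k, |C k|, Finset.sum_nonneg fun k _ => abs_nonneg _, fun k x => (hC k x).trans ?_⟩
  exact (le_abs_self _).trans (Finset.single_le_sum (f := fun k => |C k|)
    (fun k _ => abs_nonneg _) (Finset.mem_univ k))

/-- Cutting off near a zero `v` of `φ` at scale `ε`: the derivatives of order at most two are of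
order `1 / ε`, so their norms in `L²` remain bounded. -/
theorem exists_abs_jetDeriv_mul_zoom_le {φ χ : Plane → ℝ} (hφ : IsTest φ) (hχ : IsTest χ)
    (hs : tsupport χ ⊆ Metric.ball 0 1) {v : Plane} (hv : φ v = 0) :
    ∃ M : ℝ, 0 ≤ M ∧ ∀ ε : ℝ, 0 < ε → ε ≤ 1 → ∀ k x,
      |jetDeriv k (φ * zoom χ v ε) x| ≤ M * ε⁻¹ ∧
      (x ∉ Metric.ball v ε → jetDeriv k (φ * zoom χ v ε) x = 0) := by
  obtain ⟨A, hA0, hA⟩ := hφ.exists_bound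
  obtain ⟨D, hD0, hD⟩ := hχ.exists_bound
  obtain ⟨L, hL⟩ := hφ.smooth.lipschitzWith_of_hasCompactSupport hφ.compact (by simp)
  set E : ℝ := A + L with hE
  have hLE : (L : ℝ) ≤ E := by linarith
  have hAE : A ≤ E := by linarith [NNReal.zero_le_coe (q := L)]
  have hE0 : 0 ≤ E := hA0.trans hAE
  refine ⟨4 * (E * D), by positivity, fun ε hε hε1 k x => ?_⟩
  obtain ⟨l1, l2⟩ := jetDeriv_mul_zoom hφ.smooth hχ.smooth v ε x
  have ht : 1 ≤ ε⁻¹ := (one_le_inv₀ hε).2 hε1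
  have z0 : ∀ k, (∀ y ∉ Metric.ball (0 : Plane) 1, jetDeriv k χ y = 0) := fun k y hy =>
    jetDeriv_eq_zero_of_notMem_tsupport (fun h => hy (hs h)) k
  have hzero : x ∉ Metric.ball v ε → jetDeriv k (φ * zoom χ v ε) x = 0 := by
    intro hx
    have w0 : zoom χ v ε x = 0 := zoom_eq_zero (z0 (.inl ())) hε hx
    have w1 : ∀ i, zoom (pd i χ) v ε x = 0 := fun i =>
      zoom_eq_zero (z0 (.inr (.inl i))) hε hx
    have w2 : ∀ i j, zoom (pd j (pd i χ)) v ε x = 0 := fun i j =>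
      zoom_eq_zero (z0 (.inr (.inr (i, j)))) hε hx
    rcases k with _ | i | ⟨i, j⟩
    · change φ x * zoom χ v ε x = 0
      rw [w0, mul_zero]
    · exact (l1 i).trans (by rw [w0, w1]; ring)
    · exact (l2 i j).trans (by rw [w0, w1, w1, w2]; ring)
  refine ⟨?_, hzero⟩
  by_cases hx : x ∈ Metric.ball v ε
  swap
  · rw [hzero hx, abs_zero]
    positivity
  have b0 : |φ x| * ε⁻¹ ≤ E := by
    have h1 := hL.dist_le_mul x v
    rw [Real.dist_eq, hv, sub_zero] at h1
    rw [← div_eq_mul_inv, div_le_iff₀ hε]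
    exact h1.trans (mul_le_mul hLE (Metric.mem_ball.1 hx).le dist_nonneg hE0)
  have b0' : |φ x| ≤ E := (hA (.inl ()) x).trans hAE
  have b1 : ∀ i, |pd i φ x| ≤ E := fun i => (hA (.inr (.inl i)) x).trans hAE
  have b2 : ∀ i j, |pd j (pd i φ) x| ≤ E := fun i j => (hA (.inr (.inr (i, j))) x).trans hAE
  have c0 : |zoom χ v ε x| ≤ D := hD (.inl ()) _
  have c1 : ∀ i, |zoom (pd i χ) v ε x| ≤ D := fun i => hD (.inr (.inl i)) _
  have c2 : ∀ i j, |zoom (pd j (pd i χ)) v ε x| ≤ D := fun i j => hD (.inr (.inr (i, j))) _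
  have habs : |ε⁻¹| = ε⁻¹ := abs_of_pos (by positivity)
  have hED : 0 ≤ E * D := by positivity
  have hEDt : E * D ≤ E * D * ε⁻¹ := le_mul_of_one_le_right hED ht
  have hmul : ∀ {a b : ℝ}, |a| ≤ E → |b| ≤ D → |a * b| ≤ E * D := fun ha hb => by
    rw [abs_mul]; exact mul_le_mul ha hb (abs_nonneg _) hE0
  have hmul1 : ∀ {a b : ℝ}, |a| ≤ E → |b| ≤ D → |a * (ε⁻¹ * b)| ≤ E * D * ε⁻¹ := fun {a b} ha hb => by
    rw [show a * (ε⁻¹ * b) = (a * b) * ε⁻¹ by ring, abs_mul, habs]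
    gcongr
    exact hmul ha hb
  have hφ1 : ∀ {b : ℝ}, |b| ≤ D → |φ x * (ε⁻¹ * b)| ≤ E * D := fun {b} hb => by
    rw [← mul_assoc, abs_mul, abs_mul, habs]
    exact mul_le_mul b0 hb (abs_nonneg _) hE0
  rcases k with _ | i | ⟨i, j⟩
  · change |φ x * zoom χ v ε x| ≤ _
    linarith [hmul b0' c0]
  · have e : jetDeriv (.inr (.inl i)) (φ * zoom χ v ε) x = _ := l1 i
    rw [e]
    refine (abs_add_le _ _).trans ?_
    linarith [hφ1 (c1 i), hmul (b1 i) c0]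
  · have e : jetDeriv (.inr (.inr (i, j))) (φ * zoom χ v ε) x = _ := l2 i j
    rw [e]
    have h4 : |φ x * (ε⁻¹ * (ε⁻¹ * zoom (pd j (pd i χ)) v ε x))| ≤ E * D * ε⁻¹ := by
      rw [show φ x * (ε⁻¹ * (ε⁻¹ * zoom (pd j (pd i χ)) v ε x)) =
        φ x * (ε⁻¹ * zoom (pd j (pd i χ)) v ε x) * ε⁻¹ by ring, abs_mul, habs]
      gcongr
      exact hφ1 (c2 i j)
    refine (abs_add_le _ _).trans ?_
    have h5 := abs_add_le (φ x * (ε⁻¹ * (ε⁻¹ * zoom (pd j (pd i χ)) v ε x)))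
      (pd j φ x * (ε⁻¹ * zoom (pd i χ) v ε x))
    have h6 := abs_add_le (pd i φ x * (ε⁻¹ * zoom (pd j χ) v ε x))
      (pd j (pd i φ) x * zoom χ v ε x)
    linarith [hmul1 (b1 j) (c1 i), hmul1 (b1 i) (c1 j), hmul (b2 i j) c0]

namespace PlanePolygon

variable {n : ℕ} (P : PlanePolygon n)

theorem tendsto_volume_ball (v : Plane) :
    Tendsto (fun ε : ℝ => P.vol (Metric.ball v ε)) (𝓝[>] 0) (𝓝 0) := by
  have h1 : Tendsto (fun ε : ℝ => ENNReal.ofReal (ε ^ 2) * volume (Metric.ball (0 : Plane) 1))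
      (𝓝[>] 0) (𝓝 0) := by
    have h2 : Tendsto (fun ε : ℝ => ENNReal.ofReal (ε ^ 2)) (𝓝 0) (𝓝 0) := by
      have : Continuous fun ε : ℝ => ENNReal.ofReal (ε ^ 2) :=
        ENNReal.continuous_ofReal.comp (continuous_pow 2)
      simpa using this.tendsto 0
    have h3 := ENNReal.Tendsto.mul_const (b := volume (Metric.ball (0 : Plane) 1)) h2
      (Or.inr measure_ball_lt_top.ne)
    rw [zero_mul] at h3
    exact h3.mono_left nhdsWithin_le_nhds
  refine tendsto_of_tendsto_of_tendsto_of_le_of_le' tendsto_const_nhds h1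
    (Eventually.of_forall fun _ => zero_le) ?_
  filter_upwards [self_mem_nhdsWithin] with ε hε
  refine (Measure.restrict_apply_le _ _).trans (le_of_eq ?_)
  rw [Measure.addHaar_ball volume v (le_of_lt hε)]
  simp

/-- A continuous functional on `H²(K)` tends to zero along functions that are cut off near one of
their zeros, because these are bounded in `H²(K)` and their supports shrink to a point. -/
theorem tendsto_apply_mul_zoom (B : P.sobolev →L[ℝ] ℝ) {φ χ : Plane → ℝ} (hφ : IsTest φ)
    (hχ : IsTest χ) (hs : tsupport χ ⊆ Metric.ball 0 1) {v : Plane} (hv : φ v = 0)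
    (ζ : ℝ → smoothFns) (hζ : ∀ ε, (ζ ε : Plane → ℝ) = φ * zoom χ v ε) :
    Tendsto (fun ε => B (P.smoothJet (ζ ε))) (𝓝[>] 0) (𝓝 0) := by
  obtain ⟨M, hM0, hM⟩ := exists_abs_jetDeriv_mul_zoom_le hφ hχ hs hv
  set b : P.sobolev := (InnerProductSpace.toDual ℝ P.sobolev).symm B with hb
  have hB : ∀ ε, B (P.smoothJet (ζ ε)) = ∑ k, ∫ x, b.1 k x * jetDeriv k (ζ ε) x ∂P.vol := by
    intro ε
    have h1 : B (P.smoothJet (ζ ε)) = inner ℝ b (P.smoothJet (ζ ε)) :=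
      (InnerProductSpace.toDual_symm_apply).symm
    have h2 : inner ℝ b (P.smoothJet (ζ ε)) = inner ℝ b.1 (P.smoothJet (ζ ε)).1 := rfl
    rw [h1, h2, PiLp.inner_apply]
    exact Finset.sum_congr rfl fun k _ => P.inner_component_smoothJet _ k _
  simp only [hB]
  suffices h : ∀ k, Tendsto (fun ε => ∫ x, b.1 k x * jetDeriv k (ζ ε) x ∂P.vol) (𝓝[>] 0) (𝓝 0) by
    simpa only [Finset.sum_const_zero] using tendsto_finsetSum Finset.univ fun k _ => h k
  refine fun k => tendsto_zero_of_enorm_sq ?_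
  have hfin : ∫⁻ x, ‖b.1 k x‖ₑ ^ 2 ∂P.vol ≠ ⊤ := by
    rw [← eLpNorm_two_sq]
    exact ENNReal.pow_ne_top (Lp.memLp (b.1 k)).2.ne
  have h1 := tendsto_setLIntegral_zero hfin (P.tendsto_volume_ball v)
  set C : ℝ≥0∞ := ENNReal.ofReal (M ^ 2) * volume (Metric.ball (0 : Plane) 1) with hC
  have hCt : C ≠ ⊤ := ENNReal.mul_ne_top ENNReal.ofReal_ne_top measure_ball_lt_top.ne
  have h2 := ENNReal.Tendsto.mul_const (b := C) h1 (Or.inr hCt)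
  rw [zero_mul] at h2
  refine tendsto_of_tendsto_of_tendsto_of_le_of_le' tendsto_const_nhds h2
    (Eventually.of_forall fun _ => zero_le) ?_
  filter_upwards [Ioc_mem_nhdsGT zero_lt_one] with ε hε
  have hbd := hM ε hε.1 hε.2 k
  rw [← hζ ε] at hbd
  have e1 : ∫ x, b.1 k x * jetDeriv k (ζ ε) x ∂P.vol =
      ∫ x in Metric.ball v ε, b.1 k x * jetDeriv k (ζ ε) x ∂P.vol :=
    (setIntegral_eq_integral_of_forall_compl_eq_zero fun x hx => by
      rw [(hbd x).2 hx, mul_zero]).symm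
  rw [e1]
  refine (sq_enorm_integral_mul_le (Lp.aestronglyMeasurable (b.1 k)).aemeasurable.restrict
    (contDiff_jetDeriv (smoothFns_contDiff (ζ ε)) k).continuous.aemeasurable).trans ?_
  gcongr
  calc ∫⁻ x in Metric.ball v ε, ‖jetDeriv k (ζ ε) x‖ₑ ^ 2 ∂P.vol
      ≤ ∫⁻ x in Metric.ball v ε, ENNReal.ofReal ((M * ε⁻¹) ^ 2) ∂P.vol := by
        refine lintegral_mono fun x => ?_
        rw [enorm_sq_eq_ofReal]
        refine ENNReal.ofReal_le_ofReal ?_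
        rw [← sq_abs]
        exact pow_le_pow_left₀ (abs_nonneg _) (hbd x).1 2
    _ = ENNReal.ofReal ((M * ε⁻¹) ^ 2) * P.vol (Metric.ball v ε) := by
        rw [setLIntegral_const]
    _ ≤ ENNReal.ofReal ((M * ε⁻¹) ^ 2) * volume (Metric.ball v ε) := by
        gcongr
        exact Measure.restrict_le_self
    _ = C := by
        rw [Measure.addHaar_ball volume v hε.1.le, ← mul_assoc, ← ENNReal.ofReal_mul (by positivity)]
        congr 2
        have : ε ≠ 0 := hε.1.ne'
        simp
        field_simp

theorem smoothJet_congr {φ ψ : smoothFns}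
    (h : Set.EqOn (φ : Plane → ℝ) (ψ : Plane → ℝ) P.carrier) : P.smoothJet φ = P.smoothJet ψ := by
  refine Subtype.ext (PiLp.ext fun k => Lp.ext ?_)
  have h1 : P.jet φ k =ᵐ[P.vol] P.jet ψ k := by
    filter_upwards [P.coeFn_jet φ k, P.coeFn_jet ψ k, ae_restrict_mem P.measurableSet_carrier]
      with x hφ hψ hx
    rw [hφ, hψ]
    have e0 : ∀ y ∈ P.carrier, (φ : Plane → ℝ) =ᶠ[𝓝 y] (ψ : Plane → ℝ) := fun y hy =>
      h.eventuallyEq_of_mem (P.isOpen.mem_nhds hy)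
    have e1 : ∀ i, ∀ y ∈ P.carrier, pd i (φ : Plane → ℝ) y = pd i (ψ : Plane → ℝ) y :=
      fun i y hy => by rw [pd, pd, (e0 y hy).fderiv_eq]
    rcases k with _ | i | ⟨i, j⟩
    · exact h hx
    · exact e1 i x hx
    · have : pd i (φ : Plane → ℝ) =ᶠ[𝓝 x] pd i (ψ : Plane → ℝ) :=
        Set.EqOn.eventuallyEq_of_mem (e1 i) (P.isOpen.mem_nhds hx)
      change pd j (pd i (φ : Plane → ℝ)) x = pd j (pd i (ψ : Plane → ℝ)) x
      rw [pd, pd, this.fderiv_eq]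
  exact h1

/-- A continuous functional on `H²(K)` that vanishes on the test functions that meet at most one
edge is a combination of vertex values. -/
theorem apply_eq_zero_of_vertexValue_eq_zero (B : P.sobolev →L[ℝ] ℝ)
    (hB : ∀ (φ : Plane → ℝ) (hφ : IsTest φ) (i : ZMod n),
      (∀ j, j ≠ i → Disjoint (tsupport φ) (P.edge j)) → B (P.smoothJet ⟨φ, hφ.mem_smoothFns⟩) = 0)
    {W : P.sobolev} (hW : ∀ i, P.vertexValue i W = 0) : B W = 0 := by
  have := P.neZero
  have away : ∀ (φ : Plane → ℝ) (hφ : IsTest φ), (∀ i, P.vertex i ∉ tsupport φ) →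
      B (P.smoothJet ⟨φ, hφ.mem_smoothFns⟩) = 0 := by
    intro φ hφ hv
    have : φ ∈ (LinearMap.ker (B.toLinearMap ∘ₗ P.smoothJet)).map smoothFns.subtype := by
      refine test_induction _ hφ fun x hx => ?_
      obtain ⟨i, hi⟩ : ∃ i, ∀ j, j ≠ i → x ∉ P.edge j := by
        by_cases h : ∃ i, x ∈ P.edge i
        · obtain ⟨i, hi⟩ := h
          refine ⟨i, fun j hj hxj => ?_⟩
          rcases P.exists_eq_vertex_of_mem_edge hj hi hxj with h | h
          · exact hv _ (h.2 ▸ hx)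
          · exact hv _ (h.2 ▸ hx)
        · exact ⟨0, fun j _ hj => h ⟨j, hj⟩⟩
      refine ⟨_, (P.isOpen_compl_edges i).mem_nhds hi, fun η hη hηs =>
        ⟨⟨η, hη.mem_smoothFns⟩, hB η hη i fun j hj =>
          Set.disjoint_left.2 fun y hy hyj => hηs hy j hj hyj, rfl⟩⟩
    obtain ⟨ψ, hψ, rfl⟩ := this
    exact hψ
  have vanish : ∀ (φ : Plane → ℝ) (hφ : IsTest φ), (∀ i, φ (P.vertex i) = 0) →
      B (P.smoothJet ⟨φ, hφ.mem_smoothFns⟩) = 0 := by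
    intro φ hφ hv
    obtain ⟨χ, hχ, hχ1, hχs, -⟩ := exists_test_one (isCompact_singleton (x := (0 : Plane)))
      (Metric.isOpen_ball (x := (0 : Plane)) (ε := 1))
      (Set.singleton_subset_iff.2 (Metric.mem_ball_self one_pos))
    rw [nhdsSet_singleton] at hχ1
    have hz := fun (i : ZMod n) (ε : ℝ) => contDiff_zoom hχ.smooth (P.vertex i) ε
    let ζ : ZMod n → ℝ → smoothFns := fun i ε =>
      ⟨φ * zoom χ (P.vertex i) ε, (hφ.mul_smooth (hz i ε)).mem_smoothFns⟩
    have hlim : Tendsto (fun ε => ∑ i, B (P.smoothJet (ζ i ε))) (𝓝[>] 0) (𝓝 0) := by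
      simpa only [Finset.sum_const_zero] using tendsto_finsetSum Finset.univ fun i _ =>
        P.tendsto_apply_mul_zoom B hφ hχ hχs (hv i) (ζ i) fun ε => rfl
    have hsep : ∀ᶠ ε in 𝓝[>] (0 : ℝ), ∀ i k, i ≠ k → ε < dist (P.vertex k) (P.vertex i) := by
      rw [eventually_all]
      intro i
      rw [eventually_all]
      intro k
      by_cases hik : i = k
      · exact Eventually.of_forall fun ε h => absurd hik h
      · have : 0 < dist (P.vertex k) (P.vertex i) :=
          dist_pos.2 fun h => hik (P.vertex_injective h).symm
        filter_upwards [Ioo_mem_nhdsGT this] with ε hε _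
        exact hε.2
    refine tendsto_nhds_unique (tendsto_const_nhds (f := 𝓝[>] (0 : ℝ))) (hlim.congr' ?_)
    filter_upwards [hsep, self_mem_nhdsWithin] with ε hε hε0
    -- the remainder `φ - ∑ i, φ * zoom χ (P.vertex i) ε` vanishes near all vertices
    have hrem : IsTest (φ * (1 - ∑ i, zoom χ (P.vertex i) ε)) := by
      refine hφ.mul_smooth (contDiff_const.sub ?_)
      have : (∑ i, zoom χ (P.vertex i) ε) = fun x => ∑ i, zoom χ (P.vertex i) ε x := by
        ext x; simp
      rw [this]
      exact ContDiff.sum fun i _ => hz i ε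
    have h0 := away _ hrem fun k => by
      rw [notMem_tsupport_iff_eventuallyEq]
      have h1 : ∀ᶠ x in 𝓝 (P.vertex k), zoom χ (P.vertex k) ε x = 1 := by
        have : Tendsto (fun x : Plane => ε⁻¹ • (x - P.vertex k)) (𝓝 (P.vertex k)) (𝓝 0) := by
          have h : Continuous fun x : Plane => ε⁻¹ • (x - P.vertex k) := by fun_prop
          simpa using h.tendsto (P.vertex k)
        exact this.eventually hχ1
      have h2 : ∀ᶠ x in 𝓝 (P.vertex k), ∀ i, i ≠ k → zoom χ (P.vertex i) ε x = 0 := by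
        rw [eventually_all]
        intro i
        by_cases hik : i = k
        · exact Eventually.of_forall fun x h => absurd hik h
        · have h3 : ∀ᶠ x in 𝓝 (P.vertex k), ε < dist x (P.vertex i) :=
            (continuous_id.dist continuous_const).continuousAt.eventually (lt_mem_nhds (hε i k hik))
          filter_upwards [h3] with x hx _
          exact zoom_eq_zero (fun y hy => image_eq_zero_of_notMem_tsupport fun h => hy (hχs h)) hε0
            fun h => absurd (Metric.mem_ball.1 h) (not_lt.2 hx.le)
      filter_upwards [h1, h2] with x hx1 hx2
      have : (∑ i, zoom χ (P.vertex i) ε) x = 1 := by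
        rw [Finset.sum_apply, Finset.sum_eq_single k (fun i _ hi => hx2 i hi)
          fun h => absurd (Finset.mem_univ k) h, hx1]
      rw [Pi.mul_apply, Pi.sub_apply, this]
      simp
    have hdec : (⟨φ, hφ.mem_smoothFns⟩ : smoothFns) =
        ⟨φ * (1 - ∑ i, zoom χ (P.vertex i) ε), hrem.mem_smoothFns⟩ + ∑ i, ζ i ε := by
      refine Subtype.ext ?_
      rw [Submodule.coe_add, Submodule.coe_sum]
      change φ = φ * (1 - ∑ i, zoom χ (P.vertex i) ε) + ∑ i, φ * zoom χ (P.vertex i) ε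
      rw [← Finset.mul_sum]
      ring
    rw [hdec, map_add, map_add, h0, zero_add, map_sum, map_sum]
  -- functions with prescribed vertex values
  have bump : ∀ i, ∃ η : Plane → ℝ, IsTest η ∧ η (P.vertex i) = 1 ∧
      ∀ j, j ≠ i → η (P.vertex j) = 0 := by
    intro i
    have hfin : IsClosed (P.vertex '' {j | j ≠ i}) := (Set.toFinite _).isClosed
    obtain ⟨χ, hχ, hχ1, hχO, -⟩ := exists_test_one (isCompact_singleton (x := P.vertex i))
      hfin.isOpen_compl (Set.singleton_subset_iff.2 fun ⟨j, hj, hji⟩ =>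
        hj (P.vertex_injective hji))
    rw [nhdsSet_singleton] at hχ1
    exact ⟨χ, hχ, hχ1.self_of_nhds, fun j hj =>
      image_eq_zero_of_notMem_tsupport fun h' => hχO h' ⟨j, hj, rfl⟩⟩
  choose η hη hη1 hη0 using bump
  obtain ⟨χ, hχ, hχ1, -, -⟩ := exists_test_one P.isBounded.isCompact_closure isOpen_univ
    (Set.subset_univ (closure P.carrier))
  let e : ZMod n → smoothFns := fun i => ⟨η i, (hη i).mem_smoothFns⟩
  have hdense : (B : P.sobolev → ℝ) =
      fun W => ∑ i, P.vertexValue i W * B (P.smoothJet (e i)) := by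
    refine P.denseRange_smoothJet.equalizer B.continuous (continuous_finsetSum _ fun i _ =>
      (P.vertexValue i).continuous.mul continuous_const) (funext fun φ => ?_)
    change B (P.smoothJet φ) = ∑ i, P.vertexValue i (P.smoothJet φ) * B (P.smoothJet (e i))
    have hφχ : IsTest (χ * (φ : Plane → ℝ)) := hχ.mul_smooth (smoothFns_contDiff φ)
    set ψ : smoothFns := ⟨χ * (φ : Plane → ℝ), hφχ.mem_smoothFns⟩ with hψ
    have hψφ : P.smoothJet φ = P.smoothJet ψ := P.smoothJet_congr fun x hx => by
      have : χ x = 1 := (hχ1.filter_mono (nhds_le_nhdsSet (subset_closure hx))).self_of_nhds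
      change (φ : Plane → ℝ) x = χ x * (φ : Plane → ℝ) x
      rw [this, one_mul]
    rw [hψφ]
    simp only [vertexValue_smoothJet]
    have hsum : IsTest (∑ i, (ψ : Plane → ℝ) (P.vertex i) • η i) :=
      Finset.sum_induction _ IsTest (fun _ _ => IsTest.add) isTest_zero fun i _ =>
        ⟨contDiff_const.smul (hη i).smooth, (hη i).compact.smul_left⟩
    have hrem : IsTest ((χ * (φ : Plane → ℝ)) - ∑ i, (ψ : Plane → ℝ) (P.vertex i) • η i) :=
      ⟨hφχ.smooth.sub hsum.smooth, hφχ.compact.sub hsum.compact⟩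
    have h0 := vanish _ hrem fun k => by
      rw [Pi.sub_apply, Finset.sum_apply, Finset.sum_eq_single k (fun i _ hi => by
        rw [Pi.smul_apply, hη0 i k hi.symm, smul_zero]) fun h => absurd (Finset.mem_univ k) h,
        Pi.smul_apply, hη1, smul_eq_mul, mul_one]
      exact sub_self _
    have hdec : (⟨_, hrem.mem_smoothFns⟩ : smoothFns) =
        ψ - ∑ i, (ψ : Plane → ℝ) (P.vertex i) • e i := by
      refine Subtype.ext ?_
      rw [Submodule.coe_sub, Submodule.coe_sum]
      rfl
    rw [hdec, map_sub, map_sub, sub_eq_zero, map_sum, map_sum] at h0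
    rw [h0]
    exact Finset.sum_congr rfl fun i _ => by rw [map_smul, map_smul, smul_eq_mul]
  rw [hdense]
  exact Finset.sum_eq_zero fun i _ => by rw [hW, zero_mul]

end PlanePolygon

/-! ### Uniqueness -/

namespace PlanePolygon

variable {n : ℕ} (P : PlanePolygon n)

/-- A member of the virtual element space is determined by its degrees of freedom. -/
theorem eq_zero_of_isLocalVE {ν : ℝ} (hν : -1 < ν) (hν' : ν < 1) {ℓ : ℕ} {U : P.sobolev}
    (hU : P.IsLocalVE ν ℓ (U.1 (.inl ()))) (hd : P.dofs ℓ U = 0) : U = 0 := by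
  have := P.neZero
  obtain ⟨G, H, hGH, p, hp, -, ht⟩ := hU
  choose g hg h hh hgh using ht
  have hH : H = P.hessian U := funext fun i => funext fun j =>
    (congrArg (fun V : P.JetSpace => V (.inr (.inr (i, j)))) (P.eq_mkJet U.2 hGH)).symm
  subst hH
  -- the functional given by the defect in Green's formula
  let L : P.sobolev →ₗ[ℝ] ℝ := (P.energy ν U).toLinearMap -
    volume.real P.carrier • P.cellMoment.flip p - ∑ i, (P.normalMoment i).flip (g i) +
    ∑ i, P.edgeLength i • (P.valueMoment i).flip (h i)
  have hL : ∀ W, L W = P.energy ν U W - volume.real P.carrier * P.cellMoment W p -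
      ∑ i, P.normalMoment i W (g i) + ∑ i, P.edgeLength i * P.valueMoment i W (h i) := by
    intro W
    simp [L]
  have hLc : Continuous L := by
    have : (L : P.sobolev → ℝ) = _ := funext hL
    rw [this]
    exact (((P.energy ν U).continuous.sub (continuous_const.mul (P.continuous_cellMoment p))).sub
      (continuous_finsetSum _ fun i _ => P.continuous_normalMoment i (g i))).add
      (continuous_finsetSum _ fun i _ => continuous_const.mul (P.continuous_valueMoment i (h i)))
  have hK : volume.real P.carrier ≠ 0 := by
    rw [measureReal_def]
    exact (ENNReal.toReal_pos (P.isOpen.measure_pos volume P.isConnected.nonempty).ne'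
      P.volume_ne_top).ne'
  have hB : ∀ (φ : Plane → ℝ) (hφ : IsTest φ) (i : ZMod n),
      (∀ j, j ≠ i → Disjoint (tsupport φ) (P.edge j)) →
      L (P.smoothJet ⟨φ, hφ.mem_smoothFns⟩) = 0 := by
    intro φ hφ i hφd
    rw [hL, P.energy_smoothJet ν U hφ, hgh i φ hφ hφd, cellMoment_smoothJet,
      mul_inv_cancel_left₀ hK, Finset.sum_eq_single i, Finset.sum_eq_single i,
      normalMoment_smoothJet, valueMoment_smoothJet,
      mul_inv_cancel_left₀ (P.edgeLength_pos i).ne']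
    · simp only [mul_comm]
      ring
    · intro j _ hj
      rw [valueMoment_smoothJet, P.edgeIntegral_eq_zero j fun s hs => ?_, mul_zero, mul_zero]
      change φ (P.edgePt j s) * _ = 0
      rw [image_eq_zero_of_notMem_tsupport (P.edgePt_notMem_tsupport (hφd j hj) hs), zero_mul]
    · exact fun h => absurd (Finset.mem_univ i) h
    · intro j _ hj
      rw [normalMoment_smoothJet]
      refine P.edgeIntegral_eq_zero j fun s hs => ?_
      rw [P.normalDeriv_eq_zero (hφd j hj) hs, zero_mul]
    · exact fun h => absurd (Finset.mem_univ i) h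
  obtain ⟨h1, h2, h3, h4⟩ := dofs_eq_iff.1 hd
  have hU0 : L U = 0 := P.apply_eq_zero_of_vertexValue_eq_zero ⟨L, hLc⟩ hB fun i => (h1 i).symm
  have hen : P.energy ν U U = 0 := by
    have e2 : ∀ i, P.normalMoment i U (g i) = 0 := fun i => (h2 i ⟨g i, hg i⟩).symm
    have e3 : ∀ i, P.valueMoment i U (h i) = 0 := fun i => (h3 i ⟨h i, hh i⟩).symm
    have e4 : P.cellMoment U p = 0 := (h4 ⟨p, hp⟩).symm
    rw [hL, e4] at hU0
    simpa [e2, e3] using hU0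
  obtain ⟨c, hc, hcoe⟩ := P.exists_mul_norm_sq_le_energy hν hν' ℓ
  have := hcoe U (LinearMap.mem_ker.2 hd)
  rw [hen] at this
  have hn : ‖U‖ ^ 2 ≤ 0 := by
    by_contra! hpos
    exact absurd this (not_le.2 (mul_pos hc hpos))
  exact norm_eq_zero.1 (pow_eq_zero_iff two_ne_zero |>.1 (le_antisymm hn (sq_nonneg _)))

/-- The virtual element space as a space of jets. -/
noncomputable def localJets (ν : ℝ) (ℓ : ℕ) : Submodule ℝ P.sobolev :=
  (P.localVE ν ℓ).comap (P.component (.inl ())).toLinearMap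

/-- The virtual element space and the space of the jets of its members are isomorphic. -/
noncomputable def localJetsEquiv (ν : ℝ) (ℓ : ℕ) : P.localJets ν ℓ ≃ₗ[ℝ] P.localVE ν ℓ :=
  LinearEquiv.ofBijective
    ((P.component (.inl ())).toLinearMap.restrict (p := P.localJets ν ℓ) (q := P.localVE ν ℓ)
      fun _ h => h) <| by
    constructor
    · intro U V h
      exact Subtype.ext (Subtype.ext
        (P.ext_of_mem_sobolev U.1.2 V.1.2 (congrArg Subtype.val h)))
    · rintro ⟨u, hu⟩
      obtain ⟨G, H, hGH, h⟩ := id hu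
      exact ⟨⟨⟨P.mkJet u G H, P.mkJet_mem_sobolev hGH⟩, hu⟩, rfl⟩

/-- Unisolvence of the degrees of freedom. -/
theorem bijective_dofs_localJets {ν : ℝ} (hν : -1 < ν) (hν' : ν < 1) (ℓ : ℕ) :
    Function.Bijective ((P.dofs ℓ).domRestrict (P.localJets ν ℓ)) := by
  constructor
  · rw [← LinearMap.ker_eq_bot, LinearMap.ker_eq_bot']
    intro U hU
    exact Subtype.ext (P.eq_zero_of_isLocalVE hν hν' U.2 hU)
  · intro d
    obtain ⟨U, hU, hd⟩ := P.exists_isLocalVE_dofs_eq hν hν' d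
    exact ⟨⟨U, hU⟩, hd⟩

end PlanePolygon

theorem mainTheorem3 (n : ℕ) (P : PlanePolygon n) (ν : ℝ) (hν : -1 < ν) (hν' : ν < 1)
    (ℓ : ℕ) (hℓ : 2 ≤ ℓ) :
    ∃ Φ : P.localVE ν ℓ ≃ₗ[ℝ] PlanePolygon.DofData n ℓ,
      ∀ (v : P.localVE ν ℓ) (d : PlanePolygon.DofData n ℓ),
        Φ v = d ↔ P.HasDofs ℓ (v : P.L2) d := by
  refine ⟨(P.localJetsEquiv ν ℓ).symm.trans
    (LinearEquiv.ofBijective _ (P.bijective_dofs_localJets hν hν' ℓ)), fun v d => ?_⟩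
  obtain ⟨U, rfl⟩ := (P.localJetsEquiv ν ℓ).surjective v
  rw [LinearEquiv.trans_apply, LinearEquiv.symm_apply_apply]
  exact (P.hasDofs_iff U.1 d).symm
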